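/- Let $m\ge 1$ and let $\mathcal H^{\otimes m}$ be the Hilbert space of $m$ bosonic modes, with orthonormal Fock basis $|\boldsymbol n\rangle=|n_1,\dots,n_m\rangle$, $\boldsymbol n\in\mathbb N^m$ ($0\in\mathbb N$). Let $a_k,a_k^\dagger$ be the operators of mode $k$ with $a_k|\boldsymbol n\rangle=\sqrt{n_k}\,|\dots,n_k-1,\dots\rangle$ and $a_k^\dagger|\boldsymbol n\rangle=\sqrt{n_k+1}\,|\dots,n_k+1,\dots\rangle$, and put $\hat n_k=a_k^\dagger a_k$, $q_k=\frac1{\sqrt2}(a_k+a_k^\dagger)$, $p_k=\frac1{i\sqrt2}(a_k-a_k^\dagger)$. All polynomials in these operators are taken with the linear span of the Fock basis as their domain; a polynomial $P(\boldsymbol q,\boldsymbol p)$ is written with the powers of $q_k$ to the left of those of $p_k$. A polynomial Hamiltonian is a Hermitian (symmetric) operator $P(\boldsymbol q,\boldsymbol p)$. For $N_1,\dots,N_m\in\mathbb N$ let $\mathcal K=\bigotimes_{k=1}^m\mathcal H_{N_k}$ be the span of the $|\boldsymbol n\rangle$ with $n_k\le N_k$ for all $k$. Let $H$ be a Hermitian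 operator on $\mathcal K$. Then there is a polynomial Hamiltonian $P_H(\boldsymbol q,\boldsymbol p)$ with the following properties. 1. (Explicit form) With $L^{N}_{n}(X)=\prod_{0\le l\le N,\,l\ne n}\frac{X-l}{n-l}$, $$P_H(\boldsymbol q,\boldsymbol p)=\sum_{\boldsymbol i,\boldsymbol j}\langle\boldsymbol i|H|\boldsymbol j\rangle\prod_{k=1}^m\sqrt{\tfrac{\min(i_k,j_k)!}{\max(i_k,j_k)!}}\;a_k^{\dagger\,(\max(i_k,j_k)-j_k)}\,L^{N_k}_{\min(i_k,j_k)}(\hat n_k)\,a_k^{\max(i_k,j_k)-i_k},$$ where $\boldsymbol i,\boldsymbol j$ range over the multi-indices with $0\le i_k,j_k\le N_k$. 2. (Degree) If the $N_k$ are all nonzero or all zero, then $\deg P_H\le 3^mN_1\cdots N_m$. In particular, for one mode and every $d=N_1\in\mathbb N$, $\deg P_H\le 3d$. 3. (Block form) $P_H(\boldsymbol q,\boldsymbol p)=H\oplus H'$ for a densely defined Hermitian operator $H'$ on $\mathcal K^\perp$. 4. (Exponentials) $e^{itP_H}=e^{itH}\oplus e^{itH'}$ for all $t\in\mathbb R$,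 in the following sense: the strongly continuous one-parameter unitary groups generated by self-adjoint extensions of $P_H(\boldsymbol q,\boldsymbol p)$ are exactly the groups $e^{itH}\oplus U'_t$, where $U'$ is such a group for $H'$. Consequently $e^{iP_H}|\psi\rangle=e^{iH}|\psi\rangle$ for all $|\psi\rangle\in\mathcal K$, whichever self-adjoint extension is used. Moreover, for $|\psi\rangle\in\mathcal K$, the curve $t\mapsto e^{itH}|\psi\rangle$ is the unique differentiable curve $\varphi:\mathbb R\to\mathcal H^{\otimes m}$ with values in the domain of $P_H(\boldsymbol q,\boldsymbol p)$ that satisfies $\varphi(0)=|\psi\rangle$ and $\varphi'=iP_H(\boldsymbol q,\boldsymbol p)\varphi$. 5. (Complexity) $P_H$ can be computed in polynomial time: a single algorithm, given $m$, $N_1,\dots,N_m$ and the matrix entries $\langle\boldsymbol i|H|\boldsymbol j\rangle$, outputs the list of monomials of $P_H$ with their coefficients in time polynomial in $m+\prod_{k}(N_k+1)$ (so polynomial in $d$ for one mode), where exact arithmetic operations and real square roots on complex numbers have unit cost and integer operations have logarithmic cost. -/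

import Mathlib

/-! ## Fock space of `m` bosonic modes -/

/-- The Hilbert space of `m` modes, `ℓ²(ℕ^m)`; the Fock basis is indexed by occupation numbers. -/
abbrev FockSpace (m : ℕ) : Type := lp (fun _ : Fin m → ℕ => ℂ) 2

/-- The Fock basis vector `|n₁,…,n_m⟩`. -/
noncomputable def ket {m : ℕ} (n : Fin m → ℕ) : FockSpace m := lp.single 2 n 1

/-- Finite linear combinations of Fock basis vectors, as formal combinations. -/
abbrev FinVec (m : ℕ) : Type := (Fin m → ℕ) →₀ ℂ

/-- The inclusion of the finite linear combinations into the Hilbert space. -/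
noncomputable def toFock (m : ℕ) : FinVec m →ₗ[ℂ] FockSpace m :=
  Finsupp.linearCombination ℂ ket

theorem toFock_apply {m : ℕ} (f : FinVec m) (n : Fin m → ℕ) : toFock m f n = f n := by
  classical
  induction f using Finsupp.induction_linear with
  | zero => simp
  | add f g hf hg => simp [map_add, hf, hg]
  | single k c =>
    simp [toFock, ket, Finsupp.single_apply, lp.single_apply, Pi.single_apply, eq_comm]

theorem toFock_injective (m : ℕ) : Function.Injective (toFock m) := by
  intro f g h
  ext n
  rw [← toFock_apply, ← toFock_apply, h]

/-- Annihilation operator of mode `k`: `a |n⟩ = √n |n-1⟩` (which is `0` for `n = 0`). -/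
noncomputable def annihilation {m : ℕ} (k : Fin m) : Module.End ℂ (FinVec m) :=
  Finsupp.linearCombination ℂ fun n : Fin m → ℕ =>
    Finsupp.single (Function.update n k (n k - 1)) ((Real.sqrt (n k) : ℝ) : ℂ)

/-- Creation operator of mode `k`: `a† |n⟩ = √(n+1) |n+1⟩`. -/
noncomputable def creation {m : ℕ} (k : Fin m) : Module.End ℂ (FinVec m) :=
  Finsupp.linearCombination ℂ fun n : Fin m → ℕ =>
    Finsupp.single (Function.update n k (n k + 1)) ((Real.sqrt (n k + 1) : ℝ) : ℂ)

/-- Number operator `n̂ = a† a`. -/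
noncomputable def number {m : ℕ} (k : Fin m) : Module.End ℂ (FinVec m) :=
  creation k * annihilation k

/-- Position operator `q = (a + a†)/√2`. -/
noncomputable def position {m : ℕ} (k : Fin m) : Module.End ℂ (FinVec m) :=
  (1 / ((Real.sqrt 2 : ℝ) : ℂ)) • (annihilation k + creation k)

/-- Momentum operator `p = (a - a†)/(i√2)`. -/
noncomputable def momentum {m : ℕ} (k : Fin m) : Module.End ℂ (FinVec m) :=
  (1 / (Complex.I * ((Real.sqrt 2 : ℝ) : ℂ))) • (annihilation k - creation k)

/-- The operator `P(q₁,p₁,…,q_m,p_m)`. The variables `inl k` and `inr k` stand for `q_k` and `p_k`;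
in each mode the power of `q_k` is written to the left of the power of `p_k`
(operators of different modes commute). -/
noncomputable def polyOp {m : ℕ} (P : MvPolynomial (Fin m ⊕ Fin m) ℂ) :
    Module.End ℂ (FinVec m) :=
  ∑ s ∈ P.support, P.coeff s •
    (List.ofFn fun k : Fin m => position k ^ s (Sum.inl k) * momentum k ^ s (Sum.inr k)).prod

/-- An operator on finite combinations of Fock vectors, regarded as an unbounded operator on the
Hilbert space whose domain is the span of the Fock basis. -/
noncomputable def toUnbounded {m : ℕ} (T : Module.End ℂ (FinVec m)) :
    FockSpace m →ₗ.[ℂ] FockSpace m where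
  domain := LinearMap.range (toFock m)
  toFun := toFock m ∘ₗ T ∘ₗ
    (LinearEquiv.ofInjective (toFock m) (toFock_injective m)).symm.toLinearMap

/-! ## The truncated space -/

/-- The subspace `⨂ₖ H_{N_k}`, spanned by the `|n₁,…,n_m⟩` with `n_k ≤ N_k` for all `k`. -/
noncomputable def cutoffSpace {m : ℕ} (N : Fin m → ℕ) : Submodule ℂ (FockSpace m) :=
  Submodule.span ℂ (Set.range fun i : (k : Fin m) → Fin (N k + 1) => ket fun k => (i k : ℕ))

noncomputable instance cutoffSpaceFinite {m : ℕ} (N : Fin m → ℕ) :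
    FiniteDimensional ℂ (cutoffSpace N) :=
  FiniteDimensional.span_of_finite ℂ (Set.finite_range _)

/-- The Fock basis vectors of the truncated space. -/
noncomputable def cutoffKet {m : ℕ} (N : Fin m → ℕ) (i : (k : Fin m) → Fin (N k + 1)) :
    cutoffSpace N :=
  ⟨ket fun k => (i k : ℕ), Submodule.subset_span ⟨i, rfl⟩⟩

/-- The matrix element `⟨i|H|j⟩`. -/
noncomputable def entry {m : ℕ} {N : Fin m → ℕ} (H : cutoffSpace N →L[ℂ] cutoffSpace N)
    (i j : (k : Fin m) → Fin (N k + 1)) : ℂ :=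
  inner ℂ (cutoffKet N i) (H (cutoffKet N j))

/-! ## The explicit operator -/

/-- The operator
`√(min(i,j)!/max(i,j)!) a†^(max(i,j)-j) L(n̂) a^(max(i,j)-i)` on mode `k`, where `L` is the Lagrange
interpolation polynomial of degree `N` with `L(min(i,j)) = 1` that vanishes at the other integers
of `{0,…,N}`. -/
noncomputable def transitionOp {m : ℕ} (k : Fin m) (N i j : ℕ) : Module.End ℂ (FinVec m) :=
  ((Real.sqrt ((min i j).factorial / (max i j).factorial) : ℝ) : ℂ) •
    (creation k ^ (max i j - j) *
      Polynomial.aeval (number k)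
        (Lagrange.basis (Finset.range (N + 1)) (fun l : ℕ => (l : ℂ)) (min i j)) *
      annihilation k ^ (max i j - i))

/-- The sum over all `i, j` of `⟨i|H|j⟩` times the product of the single-mode operators. -/
noncomputable def interpolationOp {m : ℕ} {N : Fin m → ℕ}
    (H : cutoffSpace N →L[ℂ] cutoffSpace N) : Module.End ℂ (FinVec m) :=
  ∑ i : (k : Fin m) → Fin (N k + 1), ∑ j : (k : Fin m) → Fin (N k + 1),
    entry H i j • (List.ofFn fun k : Fin m => transitionOp k (N k) (i k) (j k)).prod

/-! ## Unbounded operators, direct sums and unitary evolutions -/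

section Operators

variable {E : Type*} [NormedAddCommGroup E] [InnerProductSpace ℂ E]

/-- Hermitian (symmetric and densely defined) operators. -/
def IsHermitianOp (A : E →ₗ.[ℂ] E) : Prop :=
  Dense (A.domain : Set E) ∧ A.IsFormalAdjoint A

/-- `B ⊕ C` for bounded operators `B` on `K` and `C` on the orthogonal complement of `K`. -/
noncomputable def boundedSum (K : Submodule ℂ E) [K.HasOrthogonalProjection]
    (B : K →L[ℂ] K) (C : Kᗮ →L[ℂ] Kᗮ) : E →L[ℂ] E :=
  K.subtypeL ∘L B ∘L K.orthogonalProjectionOnto +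
    Kᗮ.subtypeL ∘L C ∘L Kᗮ.orthogonalProjectionOnto

/-- `B ⊕ C` for a bounded operator `B` on `K` and an unbounded operator `C` on the orthogonal
complement of `K`; its domain is `K ⊕ dom C`. -/
noncomputable def unboundedSum (K : Submodule ℂ E) [K.HasOrthogonalProjection]
    (B : K →L[ℂ] K) (C : Kᗮ →ₗ.[ℂ] Kᗮ) : E →ₗ.[ℂ] E where
  domain := C.domain.comap (Kᗮ.orthogonalProjectionOnto : E →ₗ[ℂ] Kᗮ)
  toFun :=
    K.subtype ∘ₗ (B : K →ₗ[ℂ] K) ∘ₗ (K.orthogonalProjectionOnto : E →ₗ[ℂ] K) ∘ₗ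
        Submodule.subtype _ +
      Kᗮ.subtype ∘ₗ C.toFun ∘ₗ
        (Kᗮ.orthogonalProjectionOnto : E →ₗ[ℂ] Kᗮ).restrict (fun _ hx => hx)

/-- `e^{itB}` for a bounded operator `B`, by the exponential series. -/
noncomputable def expI (B : E →L[ℂ] E) (t : ℝ) : E →L[ℂ] E :=
  NormedSpace.exp ((Complex.I * (t : ℂ)) • B)

/-- `U t = e^{itA}`: `U` is a strongly continuous one-parameter unitary group whose infinitesimal
generator is `iÃ` for a self-adjoint extension `Ã` of `A`. (If `A` is essentially self-adjoint there
is exactly one such `U`; otherwise they correspond to the self-adjoint extensions of `A`.) -/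
structure IsEvolution (A : E →ₗ.[ℂ] E) (U : ℝ → E →L[ℂ] E) : Prop where
  zero : U 0 = ContinuousLinearMap.id ℂ E
  add : ∀ s t, U (s + t) = U s ∘L U t
  inner_map : ∀ t x y, inner ℂ (U t x) (U t y) = inner ℂ x y
  continuous : ∀ x, Continuous fun t => U t x
  generator : ∀ x : A.domain, HasDerivAt (fun t => U t x) (Complex.I • A x) 0

/-- `φ` takes values in the domain of `A` and solves `φ' = i A φ`. -/
def SolvesSchrodinger (A : E →ₗ.[ℂ] E) (φ : ℝ → E) : Prop :=
  ∀ t, ∃ h : φ t ∈ A.domain, HasDerivAt φ (Complex.I • A ⟨φ t, h⟩) t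

end Operators

/-! ## A real RAM

Programs work on finitely many arrays of natural numbers and of (exact) complex numbers. Operations
on complex numbers have unit cost; every natural number that is computed or read is charged its
bit length (logarithmic cost). Control flow is by bounded loops and conditionals, and does not depend
on complex data. -/

namespace RealRAM

/-- `nat a x` and `num a x` are the cells with index `x` of the `a`-th array of each kind. -/
structure State where
  nat : ℕ → ℕ → ℕ
  num : ℕ → ℕ → ℂ

/-- Integer expressions. -/
inductive NatExpr where
  | lit (n : ℕ)
  | load (array : ℕ) (index : NatExpr)
  | add (a b : NatExpr)
  | sub (a b : NatExpr)
  | mul (a b : NatExpr)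
  | div (a b : NatExpr)
  | mod (a b : NatExpr)

def NatExpr.eval (s : State) : NatExpr → ℕ
  | lit n => n
  | load array index => s.nat array (index.eval s)
  | add a b => a.eval s + b.eval s
  | sub a b => a.eval s - b.eval s
  | mul a b => a.eval s * b.eval s
  | div a b => a.eval s / b.eval s
  | mod a b => a.eval s % b.eval s

def NatExpr.cost (s : State) : NatExpr → ℕ
  | lit n => 1 + n.size
  | load array index => index.cost s + 1 + (s.nat array (index.eval s)).size
  | add a b => a.cost s + b.cost s + 1 + (a.eval s + b.eval s).size
  | sub a b => a.cost s + b.cost s + 1 + (a.eval s - b.eval s).size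
  | mul a b => a.cost s + b.cost s + 1 + (a.eval s * b.eval s).size
  | div a b => a.cost s + b.cost s + 1 + (a.eval s / b.eval s).size
  | mod a b => a.cost s + b.cost s + 1 + (a.eval s % b.eval s).size

/-- Complex expressions; `sqrt` is the square root of a nonnegative real number. -/
inductive NumExpr where
  | ofNat (n : NatExpr)
  | imagUnit
  | load (array : ℕ) (index : NatExpr)
  | add (a b : NumExpr)
  | sub (a b : NumExpr)
  | mul (a b : NumExpr)
  | div (a b : NumExpr)
  | sqrt (a : NumExpr)

noncomputable def NumExpr.eval (s : State) : NumExpr → ℂ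
  | ofNat n => (n.eval s : ℂ)
  | imagUnit => Complex.I
  | load array index => s.num array (index.eval s)
  | add a b => a.eval s + b.eval s
  | sub a b => a.eval s - b.eval s
  | mul a b => a.eval s * b.eval s
  | div a b => a.eval s / b.eval s
  | sqrt a => ((Real.sqrt (a.eval s).re : ℝ) : ℂ)

def NumExpr.cost (s : State) : NumExpr → ℕ
  | ofNat n => n.cost s + 1
  | imagUnit => 1
  | load _ index => index.cost s + 1
  | add a b => a.cost s + b.cost s + 1
  | sub a b => a.cost s + b.cost s + 1
  | mul a b => a.cost s + b.cost s + 1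
  | div a b => a.cost s + b.cost s + 1
  | sqrt a => a.cost s + 1

/-- Programs. `forLoop v b p` evaluates `b` once and runs `p` for `i = 0, …, b - 1`, with `i` stored
in cell `0` of the natural number array `v` before each round. -/
inductive Prog where
  | setNat (array : ℕ) (index value : NatExpr)
  | setNum (array : ℕ) (index : NatExpr) (value : NumExpr)
  | seq (p q : Prog)
  | ifLt (a b : NatExpr) (p q : Prog)
  | forLoop (v : ℕ) (bound : NatExpr) (p : Prog)

def State.writeNat (s : State) (array index value : ℕ) : State :=
  { s with nat := Function.update s.nat array (Function.update (s.nat array) index value) }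

def State.writeNum (s : State) (array index : ℕ) (value : ℂ) : State :=
  { s with num := Function.update s.num array (Function.update (s.num array) index value) }

/-- The state after `n` rounds of a loop with body `f` and loop variable `v`. -/
def iterate (v : ℕ) (f : State → State) (s : State) : ℕ → State
  | 0 => s
  | n + 1 => f ((iterate v f s n).writeNat v 0 n)

noncomputable def Prog.exec : Prog → State → State
  | setNat array index value, s => s.writeNat array (index.eval s) (value.eval s)
  | setNum array index value, s => s.writeNum array (index.eval s) (value.eval s)
  | seq p q, s => q.exec (p.exec s)
  | ifLt a b p q, s => if a.eval s < b.eval s then p.exec s else q.exec s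
  | forLoop v bound p, s => iterate v p.exec s (bound.eval s)

/-- The running time of a program. -/
noncomputable def Prog.time : Prog → State → ℕ
  | setNat _ index value, s => index.cost s + value.cost s + 1
  | setNum _ index value, s => index.cost s + value.cost s + 1
  | seq p q, s => p.time s + q.time (p.exec s)
  | ifLt a b p q, s =>
      a.cost s + b.cost s + 1 + if a.eval s < b.eval s then p.time s else q.time s
  | forLoop v bound p, s =>
      bound.cost s + 1 + ∑ i ∈ Finset.range (bound.eval s),
        (1 + i.size + p.time ((iterate v p.exec s i).writeNat v 0 i))

/-- The input `(m, N, H)`: the number of modes is in cell `0` of natural array `0`, the cutoffs `N_k`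
are in natural array `1`, and the matrix of `H` is in complex array `0`, row by row, the rows and
columns being numbered by mixed radix expansion. Nothing is assumed about the other cells. -/
def IsInput {m : ℕ} {N : Fin m → ℕ} (H : cutoffSpace N →L[ℂ] cutoffSpace N) (s : State) : Prop :=
  s.nat 0 0 = m ∧ (∀ k : Fin m, s.nat 1 k = N k) ∧
    ∀ i j : (k : Fin m) → Fin (N k + 1),
      s.num 0 ((finPiFinEquiv i : ℕ) * ∏ k, (N k + 1) + (finPiFinEquiv j : ℕ)) = entry H i j

/-- The exponent vector of the `t`-th monomial of the output: `2m` consecutive cells of natural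
array `3`, the exponents of `q₁,…,q_m` followed by those of `p₁,…,p_m`. -/
noncomputable def outputExponent (m : ℕ) (s : State) (t : ℕ) : (Fin m ⊕ Fin m) →₀ ℕ :=
  Finsupp.equivFunOnFinite.symm
    (Sum.elim (fun k => s.nat 3 (t * (2 * m) + k)) fun k => s.nat 3 (t * (2 * m) + m + k))

/-- The output `P`: a list of distinct monomials with their coefficients. The number of monomials is
in cell `0` of natural array `2`, the coefficients are in complex array `1`. -/
def IsOutput {m : ℕ} (P : MvPolynomial (Fin m ⊕ Fin m) ℂ) (s : State) : Prop :=
  Set.InjOn (outputExponent m s) (Set.Iio (s.nat 2 0)) ∧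
    P = ∑ t ∈ Finset.range (s.nat 2 0), MvPolynomial.monomial (outputExponent m s t) (s.num 1 t)

end RealRAM

/-! ## Normal ordering in the Weyl algebra -/

section Weyl

open Finset Complex

variable {A : Type*} [Semiring A] [Algebra ℂ A] {q p : A}

/-! On one mode, `a†^x L(n̂) a^y` with `x = max(i,j) - j` and `y = max(i,j) - i` lowers `|n⟩` by
`y`, is filtered by `L`, and is raised by `x`. For `n ≤ N` the argument of `L` is still an integer
in `{0,…,N}`, so `L` lets only `n = j` through. The result is a multiple of `|i⟩`, and the square
root prefactor makes the multiple `1` (`modeElem_of_le`). So on the truncated space the products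
over the modes are the matrix units `|i⟩⟨j|`, and `interpolationOp H` acts there as `H`. Exchanging
`i` and `j` gives the formal adjoint (`modeElem_symm`), so a Hermitian `H` gives a symmetric
operator.

The direct sum and the statements on exponentials use only two facts about this operator `A`: it is
symmetric and densely defined, and it contains the finite-dimensional space `K` in its domain and
equals `H` there. Symmetry makes `A` map `Kᗮ ∩ dom A` into `Kᗮ` (`exists_complementary_block`). It
also conserves inner products of Schrödinger curves, which gives uniqueness. Every evolution `U` of
`A` is `e^{itH}` on `K`, because `U (-s) e^{isH} ψ` is constant in `s` (`evolution_eq_expI`). A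
unitary group that preserves `K` preserves `Kᗮ`, and it splits (`evolution_iff`).

For the polynomial form, the Lagrange polynomial is expanded in falling factorials
(`lagrange_basis_eq_newton`), and the `r`-th falling factorial of `n̂` is `a†^r a^r`. Each
transition operator is thus a combination of `a†^u a^v` with `u + v = |i - j| + 2r ≤ 3N`.
Substituting `a, a† = (q ± ip)/√2` and applying closed formulas for the normal ordering of `(q +
lp)^n` and `p^b q^a` yields explicit coefficients. The degree is at most `∑ 3 N_k`, and this sum is
at most the product when every term is at least `2`.

The coefficients are bounded nests of sums and products with polynomially many terms, and there are
`∏ (3 N_k + 1)^2 ≤ (∏ (N_k + 1))^4` candidate monomials. The structures `NatComp`, `Computes` and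
`PolyProg` pair the correctness of a program fragment with a polynomial time bound, so the program
is assembled along the shape of the formulas. -/

theorem weyl_mul_pow (h : p * q = q * p + (-I) • (1 : A)) (a : ℕ) :
    p * q ^ a = q ^ a * p + (-(I * a)) • q ^ (a - 1) := by
  induction a with
  | zero => simp
  | succ a ih =>
    rw [pow_succ, ← mul_assoc, ih, add_mul, mul_assoc, h, mul_add, smul_mul_assoc, ← mul_assoc]
    rcases a with _ | a
    · simp
    · simp only [Nat.add_sub_cancel, ← pow_succ, mul_smul_comm, mul_one]
      push_cast
      module

/-- Coefficients of the normal ordering of `p ^ b * q ^ a`. -/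
noncomputable def swapCoeff (b a c : ℕ) : ℂ :=
  (-I) ^ c * b.descFactorial c * a.descFactorial c / c.factorial

/-- Pascal type recursion: one more `p` on the left either passes the power of `q` or differentiates
`q^(a-c)`, which contributes the factor `-i(a-c)`. -/
theorem swapCoeff_succ (b a c : ℕ) :
    swapCoeff (b + 1) a (c + 1) =
      swapCoeff b a (c + 1) - I * ((a - c : ℕ) : ℂ) * swapCoeff b a c := by
  have h0 : (c.factorial : ℂ) ≠ 0 := by exact_mod_cast c.factorial_ne_zero
  have h1 : (c : ℂ) + 1 ≠ 0 := by exact_mod_cast c.succ_ne_zero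
  have h2 : ((b + 1).descFactorial (c + 1) : ℂ) =
      b.descFactorial (c + 1) + (c + 1) * b.descFactorial c := by
    rw [Nat.succ_descFactorial_succ, Nat.descFactorial_succ]
    rcases le_or_gt c b with h | h
    · push_cast [h]; ring
    · simp [Nat.descFactorial_eq_zero_iff_lt.2 h]
  simp only [swapCoeff, h2, Nat.factorial_succ, Nat.descFactorial_succ a]
  push_cast
  field_simp
  ring

/-- The Leibniz rule, with `p` acting on powers of `q` as `-i d/dq`. Terms with `c > a` have
coefficient zero, so the truncated exponent `a - c` does no harm. -/
theorem weyl_pow_mul_pow (h : p * q = q * p + (-I) • (1 : A)) (a b : ℕ) :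
    p ^ b * q ^ a =
      ∑ c ∈ range (b + 1), swapCoeff b a c • (q ^ (a - c) * p ^ (b - c)) := by
  induction b with
  | zero => simp [swapCoeff]
  | succ b ih =>
    have hp : ∀ c ∈ range (b + 1), p * (swapCoeff b a c • (q ^ (a - c) * p ^ (b - c))) =
        swapCoeff b a c • (q ^ (a - c) * p ^ (b + 1 - c)) +
        (-(I * ((a - c : ℕ) : ℂ) * swapCoeff b a c)) •
          (q ^ (a - (c + 1)) * p ^ (b + 1 - (c + 1))) := by
      intro c hc
      have hc' : b + 1 - c = (b - c) + 1 := by have := mem_range.1 hc; omega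
      rw [mul_smul_comm, ← mul_assoc, weyl_mul_pow h, add_mul, mul_assoc, hc', pow_succ',
        smul_mul_assoc, Nat.add_sub_add_right, Nat.sub_sub a c 1]
      module
    rw [pow_succ', mul_assoc, ih, mul_sum, sum_congr rfl hp, sum_add_distrib,
      sum_range_succ' _ (b + 1)]
    -- The terms in which `p` passes through are reindexed to match the differentiated ones. The
    -- term `c = 0` is split off, and the term `c = b + 1` may be added because its coefficient
    -- vanishes.
    have h1 : ∑ c ∈ range (b + 1), swapCoeff b a c • (q ^ (a - c) * p ^ (b + 1 - c)) =
        ∑ c ∈ range (b + 1),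
          swapCoeff b a (c + 1) • (q ^ (a - (c + 1)) * p ^ (b + 1 - (c + 1))) +
        swapCoeff (b + 1) a 0 • (q ^ (a - 0) * p ^ (b + 1 - 0)) := by
      have h0 : swapCoeff (b + 1) a 0 = swapCoeff b a 0 := by simp [swapCoeff]
      rw [h0, ← sum_range_succ' (fun c => swapCoeff b a c • (q ^ (a - c) * p ^ (b + 1 - c))),
        sum_range_succ _ (b + 1)]
      simp [swapCoeff]
    rw [h1, add_right_comm, ← sum_add_distrib]
    congr 1
    refine sum_congr rfl fun c _ => ?_
    rw [swapCoeff_succ, ← add_smul, sub_eq_add_neg]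

/-- Coefficients of the normal ordering of `(q + l p) ^ n`. -/
noncomputable def powCoeff (l : ℂ) (n b c : ℕ) : ℂ :=
  n.descFactorial (b + 2 * c) / (b.factorial * c.factorial) * l ^ b * (-I * l / 2) ^ c

theorem powCoeff_eq_zero (l : ℂ) {n b c : ℕ} (h : n < b + 2 * c) : powCoeff l n b c = 0 := by
  simp [powCoeff, Nat.descFactorial_eq_zero_iff_lt.2 h]

theorem powCoeff_zero_zero (l : ℂ) (n : ℕ) : powCoeff l n 0 0 = 1 := by simp [powCoeff]

theorem succ_descFactorial_cast (n k : ℕ) :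
    ((n + 1).descFactorial k : ℂ) = n.descFactorial k + k * n.descFactorial (k - 1) := by
  rcases k with _ | k
  · simp
  rw [Nat.succ_descFactorial_succ, Nat.descFactorial_succ]
  rcases le_or_gt k n with h | h
  · push_cast [h]
    ring
  · simp [Nat.descFactorial_eq_zero_iff_lt.2 h]

theorem powCoeff_succ_zero_right (l : ℂ) (n b : ℕ) :
    powCoeff l (n + 1) (b + 1) 0 = powCoeff l n (b + 1) 0 + l * powCoeff l n b 0 := by
  have h0 : (b.factorial : ℂ) ≠ 0 := by exact_mod_cast b.factorial_ne_zero
  have h1 : (b : ℂ) + 1 ≠ 0 := by exact_mod_cast b.succ_ne_zero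
  simp only [powCoeff, succ_descFactorial_cast, Nat.factorial_succ]
  simp only [Nat.mul_zero, Nat.add_zero, Nat.add_sub_cancel]
  push_cast
  field_simp
  ring

theorem powCoeff_succ_zero_left (l : ℂ) (n c : ℕ) :
    powCoeff l (n + 1) 0 (c + 1) =
      powCoeff l n 0 (c + 1) - I * l * ((n - 2 * c : ℕ) : ℂ) * powCoeff l n 0 c := by
  have h0 : (c.factorial : ℂ) ≠ 0 := by exact_mod_cast c.factorial_ne_zero
  have h1 : (c : ℂ) + 1 ≠ 0 := by exact_mod_cast c.succ_ne_zero
  simp only [powCoeff, succ_descFactorial_cast, Nat.factorial_succ]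
  have h2 : 0 + 2 * (c + 1) - 1 = 2 * c + 1 := by omega
  rw [h2, Nat.descFactorial_succ n (2 * c)]
  simp only [Nat.zero_add]
  push_cast
  field_simp
  ring

/-- Three sources for a term after multiplication by `q + lp` on the left: `q` raises its own power,
`lp` moves to the right and raises `b`, or `lp` is contracted with a `q` and raises `c`. The two
preceding lemmas are the boundary cases in which a source is absent. -/
theorem powCoeff_succ_succ (l : ℂ) (n b c : ℕ) :
    powCoeff l (n + 1) (b + 1) (c + 1) =
      powCoeff l n (b + 1) (c + 1) + l * powCoeff l n b (c + 1)
        - I * l * ((n - (b + 1 + 2 * c) : ℕ) : ℂ) * powCoeff l n (b + 1) c := by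
  have h0 : (c.factorial : ℂ) ≠ 0 := by exact_mod_cast c.factorial_ne_zero
  have h1 : (c : ℂ) + 1 ≠ 0 := by exact_mod_cast c.succ_ne_zero
  have h0' : (b.factorial : ℂ) ≠ 0 := by exact_mod_cast b.factorial_ne_zero
  have h1' : (b : ℂ) + 1 ≠ 0 := by exact_mod_cast b.succ_ne_zero
  simp only [powCoeff, succ_descFactorial_cast, Nat.factorial_succ]
  have h2 : b + 1 + 2 * (c + 1) - 1 = (b + 1 + 2 * c) + 1 := by omega
  have h3 : b + 2 * (c + 1) = (b + 1 + 2 * c) + 1 := by omega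
  rw [h2, h3, Nat.descFactorial_succ n (b + 1 + 2 * c)]
  push_cast
  field_simp
  ring

/-- The formula is the coefficient of `t^n/n!` in `exp(tq) exp(tlp) exp(-ilt²/2)`, as
Baker–Campbell–Hausdorff predicts. The proof is by induction through the recursion for `powCoeff`.
Since coefficients with `b + 2c > n` vanish, both sums may run over the same range `M`. -/
theorem weyl_add_pow (h : p * q = q * p + (-I) • (1 : A)) (l : ℂ) (n M : ℕ) (hM : n < M) :
    (q + l • p) ^ n = ∑ b ∈ range M, ∑ c ∈ range M,
      powCoeff l n b c • (q ^ (n - (b + 2 * c)) * p ^ b) := by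
  obtain ⟨M, rfl⟩ : ∃ K, M = K + 1 := ⟨M - 1, by omega⟩
  induction n with
  | zero =>
    rw [sum_range_succ', sum_range_succ']
    rw [sum_eq_zero, sum_eq_zero]
    · simp [powCoeff_zero_zero]
    · intro c _; rw [powCoeff_eq_zero _ (by omega), zero_smul]
    · intro b _
      refine sum_eq_zero fun c _ => ?_
      rw [powCoeff_eq_zero _ (by omega), zero_smul]
  | succ n ih =>
    set T : ℕ → ℕ → A := fun b c => q ^ (n + 1 - (b + 2 * c)) * p ^ b with hT
    have hstep : ∀ b c, (q + l • p) * (powCoeff l n b c • (q ^ (n - (b + 2 * c)) * p ^ b)) =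
        powCoeff l n b c • T b c + (l * powCoeff l n b c) • T (b + 1) c +
          (-(I * l * ((n - (b + 2 * c) : ℕ) : ℂ) * powCoeff l n b c)) • T b (c + 1) := by
      intro b c
      rcases lt_or_ge n (b + 2 * c) with hlt | hle
      · simp [powCoeff_eq_zero l hlt]
      · have e1 : n + 1 - (b + 2 * c) = (n - (b + 2 * c)) + 1 := by omega
        have e2 : n + 1 - (b + 1 + 2 * c) = n - (b + 2 * c) := by omega
        have e3 : n + 1 - (b + 2 * (c + 1)) = n - (b + 2 * c) - 1 := by omega
        simp only [hT, e1, e2, e3]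
        rw [mul_smul_comm, add_mul, smul_mul_assoc, ← mul_assoc p, weyl_mul_pow h, add_mul,
          smul_mul_assoc, mul_assoc _ p, ← pow_succ' p, ← mul_assoc q, ← pow_succ' q]
        module
    rw [pow_succ', ih (by omega), mul_sum]
    simp only [mul_sum, hstep, sum_add_distrib]
    -- The last index has coefficient zero since `n < M`. Dropping it makes room for the shift `b ↦
    -- b + 1`; `hC` does the same for `c`.
    have hB : ∑ b ∈ range (M + 1), ∑ c ∈ range (M + 1), (l * powCoeff l n b c) • T (b + 1) c =
        ∑ b ∈ range M, ∑ c ∈ range (M + 1), (l * powCoeff l n b c) • T (b + 1) c := by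
      rw [sum_range_succ, sum_eq_zero (s := range (M + 1)), add_zero]
      intro c _
      rw [powCoeff_eq_zero _ (by omega), mul_zero, zero_smul]
    have hC : ∀ b, ∑ c ∈ range (M + 1),
          (-(I * l * ((n - (b + 2 * c) : ℕ) : ℂ) * powCoeff l n b c)) • T b (c + 1) =
        ∑ c ∈ range M,
          (-(I * l * ((n - (b + 2 * c) : ℕ) : ℂ) * powCoeff l n b c)) • T b (c + 1) := by
      intro b
      rw [sum_range_succ, powCoeff_eq_zero _ (by omega), mul_zero, neg_zero, zero_smul, add_zero]
    change _ = ∑ b ∈ range (M + 1), ∑ c ∈ range (M + 1), powCoeff l (n + 1) b c • T b c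
    clear_value T
    simp only [hC, hB]
    simp only [sum_range_succ' _ M, sum_add_distrib]
    simp only [powCoeff_succ_succ, powCoeff_succ_zero_left, powCoeff_succ_zero_right,
      powCoeff_zero_zero, sub_eq_add_neg, add_smul, sum_add_distrib, Nat.zero_add]
    abel

end Weyl

/-! ## Action of the mode operators on the Fock basis -/

section ModeOperators

open Finset

theorem creation_single {m : ℕ} (k : Fin m) (n : Fin m → ℕ) (c : ℂ) :
    creation k (Finsupp.single n c) =
      Finsupp.single (Function.update n k (n k + 1)) (c * ((Real.sqrt (n k + 1) : ℝ) : ℂ)) := by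
  simp [creation]

theorem annihilation_single {m : ℕ} (k : Fin m) (n : Fin m → ℕ) (c : ℂ) :
    annihilation k (Finsupp.single n c) =
      Finsupp.single (Function.update n k (n k - 1)) (c * ((Real.sqrt (n k) : ℝ) : ℂ)) := by
  simp [annihilation]

theorem creation_pow_single {m : ℕ} (k : Fin m) (u : ℕ) (n : Fin m → ℕ) (c : ℂ) :
    (creation k ^ u) (Finsupp.single n c) = Finsupp.single (Function.update n k (n k + u))
      (c * ((Real.sqrt ((n k + u).descFactorial u) : ℝ) : ℂ)) := by
  induction u with
  | zero => simp
  | succ u ih =>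
    rw [pow_succ', Module.End.mul_apply, ih, creation_single]
    simp only [Function.update_self, Function.update_idem]
    rw [mul_assoc, ← Complex.ofReal_mul, ← Real.sqrt_mul (by positivity), ← Nat.add_assoc,
      Nat.succ_descFactorial_succ]
    push_cast
    rw [mul_comm ((n k : ℝ) + u + 1)]

/-- For `v > n k` the weight contains a vanishing falling factorial, so the truncated occupation
number is irrelevant. -/
theorem annihilation_pow_single {m : ℕ} (k : Fin m) (v : ℕ) (n : Fin m → ℕ) (c : ℂ) :
    (annihilation k ^ v) (Finsupp.single n c) = Finsupp.single (Function.update n k (n k - v))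
      (c * ((Real.sqrt ((n k).descFactorial v) : ℝ) : ℂ)) := by
  induction v with
  | zero => simp
  | succ v ih =>
    rw [pow_succ', Module.End.mul_apply, ih, annihilation_single]
    simp only [Function.update_self, Function.update_idem]
    rw [mul_assoc, ← Complex.ofReal_mul, ← Real.sqrt_mul (by positivity), Nat.sub_sub,
      Nat.descFactorial_succ]
    push_cast
    rw [mul_comm (((n k - v : ℕ) : ℝ))]

/-- The two square roots coincide, which makes `a†^r a^r` the falling factorial of the number
operator. This links the Newton form to normal ordering. -/
theorem creation_pow_mul_annihilation_pow_single {m : ℕ} (k : Fin m) (r : ℕ) (n : Fin m → ℕ)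
    (c : ℂ) : (creation k ^ r * annihilation k ^ r) (Finsupp.single n c) =
      Finsupp.single n (c * ((n k).descFactorial r : ℂ)) := by
  rw [Module.End.mul_apply, annihilation_pow_single, creation_pow_single]
  simp only [Function.update_self, Function.update_idem]
  rcases lt_or_ge (n k) r with h | h
  · simp [Nat.descFactorial_eq_zero_iff_lt.2 h]
  · rw [Nat.sub_add_cancel h, Function.update_eq_self, mul_assoc, ← Complex.ofReal_mul,
      Real.mul_self_sqrt (by positivity)]
    simp

theorem number_single {m : ℕ} (k : Fin m) (n : Fin m → ℕ) (c : ℂ) :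
    number k (Finsupp.single n c) = Finsupp.single n (c * (n k : ℂ)) := by
  have := creation_pow_mul_annihilation_pow_single k 1 n c
  simpa [number] using this

theorem aeval_number_single {m : ℕ} (k : Fin m) (L : Polynomial ℂ) (n : Fin m → ℕ) (c : ℂ) :
    Polynomial.aeval (number k) L (Finsupp.single n c) =
      Finsupp.single n (c * L.eval (n k : ℂ)) := by
  induction L using Polynomial.induction_on' generalizing c with
  | add f g hf hg => simp [hf, hg, mul_add]
  | monomial r a =>
    have h : ∀ r : ℕ, (number k ^ r) (Finsupp.single n c) =
        Finsupp.single n (c * (n k : ℂ) ^ r) := by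
      intro r
      induction r with
      | zero => simp
      | succ r ih =>
        rw [pow_succ', Module.End.mul_apply, ih, number_single, mul_assoc, ← pow_succ]
    rw [Polynomial.aeval_monomial, Module.End.mul_apply, h]
    simp only [Polynomial.eval_monomial, Module.algebraMap_end_apply, Finsupp.smul_single,
      smul_eq_mul]
    rw [mul_left_comm]

/-- Equality of operators can be tested on the Fock basis. -/
theorem end_ext {m : ℕ} {S T : Module.End ℂ (FinVec m)}
    (h : ∀ n c, S (Finsupp.single n c) = T (Finsupp.single n c)) : S = T :=
  Finsupp.lhom_ext h

theorem annihilation_mul_creation {m : ℕ} (k : Fin m) :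
    annihilation k * creation k = creation k * annihilation k + 1 := by
  refine end_ext fun n c => ?_
  have h := number_single k n c
  rw [number] at h
  rw [LinearMap.add_apply, h, Module.End.one_apply, Module.End.mul_apply, creation_single,
    annihilation_single]
  simp only [Function.update_self, Function.update_idem, Nat.add_sub_cancel,
    Function.update_eq_self]
  rw [mul_assoc, ← Complex.ofReal_mul, ← Finsupp.single_add]
  push_cast
  rw [← Complex.ofReal_mul, Real.mul_self_sqrt (by positivity)]
  push_cast
  ring_nf

theorem sqrt_two_mul_self : ((Real.sqrt 2 : ℝ) : ℂ) * ((Real.sqrt 2 : ℝ) : ℂ) = 2 := by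
  rw [← Complex.ofReal_mul, Real.mul_self_sqrt (by norm_num)]; norm_num

theorem sqrt_two_ne_zero : ((Real.sqrt 2 : ℝ) : ℂ) ≠ 0 := by
  intro h; have := sqrt_two_mul_self; rw [h] at this; norm_num at this

theorem momentum_eq {m : ℕ} (k : Fin m) : (momentum k : Module.End ℂ (FinVec m)) =
    (1 / (Complex.I * ((Real.sqrt 2 : ℝ) : ℂ))) •
      (annihilation k + (-1 : ℂ) • creation k) := by
  refine LinearMap.ext fun f => ?_
  simp [momentum, sub_eq_add_neg]

theorem momentum_mul_position {m : ℕ} (k : Fin m) :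
    (momentum k : Module.End ℂ (FinVec m)) * position k =
      position k * momentum k + (-Complex.I) • (1 : Module.End ℂ (FinVec m)) := by
  have h := annihilation_mul_creation k
  have hs : (1 / (Complex.I * ((Real.sqrt 2 : ℝ) : ℂ))) * (1 / ((Real.sqrt 2 : ℝ) : ℂ)) =
      -Complex.I / 2 := by
    rw [div_mul_div_comm, mul_assoc, sqrt_two_mul_self, one_mul, one_div, mul_inv, Complex.inv_I]
    ring
  rw [momentum_eq, position, smul_mul_smul_comm, smul_mul_smul_comm,
    mul_comm (1 / ((Real.sqrt 2 : ℝ) : ℂ)), hs]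
  simp only [add_mul, mul_add, smul_mul_assoc, mul_smul_comm, h]
  module

theorem annihilation_eq {m : ℕ} (k : Fin m) :
    annihilation k = (1 / ((Real.sqrt 2 : ℝ) : ℂ)) • (position k + Complex.I • momentum k) := by
  have h1 : (1 / ((Real.sqrt 2 : ℝ) : ℂ)) * (1 / ((Real.sqrt 2 : ℝ) : ℂ)) = 1 / 2 := by
    rw [div_mul_div_comm, sqrt_two_mul_self, one_mul]
  have h2 : (1 / ((Real.sqrt 2 : ℝ) : ℂ)) *
      (Complex.I * (1 / (Complex.I * ((Real.sqrt 2 : ℝ) : ℂ)))) = 1 / 2 := by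
    rw [← h1]
    congr 1
    have := sqrt_two_ne_zero
    field_simp
  rw [position, momentum_eq, smul_add, smul_smul, smul_smul, smul_smul, mul_assoc, h1, h2]
  module

theorem creation_eq {m : ℕ} (k : Fin m) :
    creation k = (1 / ((Real.sqrt 2 : ℝ) : ℂ)) • (position k + (-Complex.I) • momentum k) := by
  have h1 : (1 / ((Real.sqrt 2 : ℝ) : ℂ)) * (1 / ((Real.sqrt 2 : ℝ) : ℂ)) = 1 / 2 := by
    rw [div_mul_div_comm, sqrt_two_mul_self, one_mul]
  have h2 : (1 / ((Real.sqrt 2 : ℝ) : ℂ)) *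
      (-Complex.I * (1 / (Complex.I * ((Real.sqrt 2 : ℝ) : ℂ)))) = -(1 / 2) := by
    rw [← h1, ← mul_neg]
    congr 1
    have := sqrt_two_ne_zero
    field_simp
  rw [position, momentum_eq, smul_add, smul_smul, smul_smul, smul_smul, mul_assoc, h1, h2]
  module

/-! ## Newton form of the Lagrange polynomials -/

/-- Coefficients of the Lagrange polynomial `L_l` of the nodes `0,…,N` in the basis of falling
factorials. -/
noncomputable def newtonCoeff (l r : ℕ) : ℝ :=
  (-1) ^ (r + l) * r.descFactorial l / (l.factorial * r.factorial)

/-- Each term is `(-1)^(r+l) C(x,r) C(r,l)`, and `C(x,r) C(r,l) = C(x,l) C(x-l,r-l)`. What remains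
is the alternating sum of row `x - l` of Pascal's triangle, which vanishes unless `x = l`. -/
theorem sum_newtonCoeff (N l x : ℕ) (hx : x ≤ N) :
    ∑ r ∈ range (N + 1), newtonCoeff l r * x.descFactorial r = if x = l then 1 else 0 := by
  have h1 : ∀ r ∈ range (N + 1), r ∉ range (x + 1) → newtonCoeff l r * x.descFactorial r = 0 := by
    intro r _ hr
    rw [Nat.descFactorial_eq_zero_iff_lt.2 (by simpa using hr)]
    simp
  rw [← sum_subset (range_subset_range.2 (by omega)) h1]
  have h2 : ∀ r, newtonCoeff l r * x.descFactorial r =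
      (-1) ^ (r + l) * (x.choose r * r.choose l : ℕ) := by
    intro r
    have hr : (r.factorial : ℝ) ≠ 0 := by exact_mod_cast r.factorial_ne_zero
    have hl : (l.factorial : ℝ) ≠ 0 := by exact_mod_cast l.factorial_ne_zero
    rw [newtonCoeff, Nat.descFactorial_eq_factorial_mul_choose x,
      Nat.descFactorial_eq_factorial_mul_choose r]
    push_cast
    field_simp
  simp only [h2]
  rcases lt_or_ge x l with hlt | hle
  · rw [if_neg (by omega)]
    refine sum_eq_zero fun r hr => ?_
    rw [Nat.choose_eq_zero_of_lt (n := r) (k := l) (by have := mem_range.1 hr; omega)]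
    simp
  · have h3 : ∑ r ∈ range (x + 1), (-1 : ℝ) ^ (r + l) * (x.choose r * r.choose l : ℕ) =
        ∑ r ∈ range (x - l + 1), (-1 : ℝ) ^ r * (x.choose l * (x - l).choose r : ℕ) := by
      rw [show x + 1 = l + (x - l + 1) by omega, sum_range_add, sum_eq_zero, zero_add]
      · refine sum_congr rfl fun r hr => ?_
        have hr' := mem_range.1 hr
        rw [Nat.choose_mul (by omega), Nat.add_sub_cancel_left,
          show l + r + l = r + 2 * l by ring, pow_add, pow_mul]
        simp
      · intro r hr
        rw [Nat.choose_eq_zero_of_lt (mem_range.1 hr)]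
        simp
    have h4 := Int.alternating_sum_range_choose (n := x - l)
    have h5 : ∑ r ∈ range (x - l + 1), (-1 : ℝ) ^ r * ((x - l).choose r : ℝ) =
        if x - l = 0 then 1 else 0 := by
      have := congrArg (fun z : ℤ => (z : ℝ)) h4
      push_cast at this
      exact this
    rw [h3]
    have h6 : ∀ r, (-1 : ℝ) ^ r * (x.choose l * (x - l).choose r : ℕ) =
        x.choose l * ((-1 : ℝ) ^ r * ((x - l).choose r : ℝ)) := by
      intro r; push_cast; ring
    simp only [h6, ← mul_sum, h5]
    rcases eq_or_ne x l with rfl | hne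
    · simp
    · rw [if_neg (by omega), if_neg hne, mul_zero]

/-- Both sides have degree at most `N` and agree at the `N + 1` nodes. -/
theorem lagrange_basis_eq_newton (N l : ℕ) (hl : l ≤ N) :
    Lagrange.basis (range (N + 1)) (fun x : ℕ => (x : ℂ)) l =
      ∑ r ∈ range (N + 1), Polynomial.C (newtonCoeff l r : ℂ) * descPochhammer ℂ r := by
  have hinj : Set.InjOn (fun x : ℕ => (x : ℂ)) (range (N + 1) : Finset ℕ) :=
    fun a _ b _ h => Nat.cast_injective h
  refine Polynomial.eq_of_degrees_lt_of_eval_index_eq (range (N + 1)) hinj ?_ ?_ ?_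
  · rw [Lagrange.degree_basis hinj (mem_range.2 (by omega))]
    simp only [card_range, Nat.add_sub_cancel]
    exact_mod_cast Nat.lt_succ_self N
  · refine lt_of_le_of_lt (Polynomial.degree_sum_le _ _) ?_
    rw [Finset.sup_lt_iff (by simp)]
    intro r hr
    refine lt_of_le_of_lt (Polynomial.degree_le_of_natDegree_le
      ((Polynomial.natDegree_C_mul_le _ _).trans (descPochhammer_natDegree ℂ r).le)) ?_
    simp only [card_range]
    exact_mod_cast mem_range.1 hr
  · intro x hx
    have hx' := mem_range.1 hx
    have h := sum_newtonCoeff N l x (by omega)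
    simp only [Polynomial.eval_finsetSum, Polynomial.eval_mul, Polynomial.eval_C,
      descPochhammer_eval_eq_descFactorial]
    have h' : ∑ r ∈ range (N + 1), (newtonCoeff l r : ℂ) * (x.descFactorial r : ℂ) =
        if x = l then 1 else 0 := by
      have := congrArg (fun z : ℝ => (z : ℂ)) h
      push_cast at this
      rw [this]
      split_ifs <;> simp
    rw [h']
    split_ifs with hxl
    · subst hxl
      exact Lagrange.eval_basis_self hinj hx
    · exact Lagrange.eval_basis_of_ne (v := fun x : ℕ => (x : ℂ)) (Ne.symm hxl) hx

theorem aeval_number_lagrange {m : ℕ} (k : Fin m) (N l : ℕ) (hl : l ≤ N) :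
    Polynomial.aeval (number k : Module.End ℂ (FinVec m))
        (Lagrange.basis (range (N + 1)) (fun x : ℕ => (x : ℂ)) l) =
      ∑ r ∈ range (N + 1), (newtonCoeff l r : ℂ) • (creation k ^ r * annihilation k ^ r) := by
  refine end_ext fun n c => ?_
  rw [aeval_number_single, lagrange_basis_eq_newton N l hl]
  simp only [LinearMap.sum_apply, LinearMap.smul_apply, creation_pow_mul_annihilation_pow_single,
    Polynomial.eval_finsetSum, Polynomial.eval_mul, Polynomial.eval_C,
    descPochhammer_eval_eq_descFactorial, Finsupp.smul_single, smul_eq_mul]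
  rw [mul_sum, Finsupp.single_finsetSum]
  refine sum_congr rfl fun r _ => ?_
  ring_nf

/-! ## Normal ordered form of the transition operators -/

/-- The coefficient of `q ^ α * p ^ β` in `creation ^ u * annihilation ^ v`. -/
noncomputable def ladderCoeff (u v α β : ℕ) : ℂ :=
  (1 / ((Real.sqrt 2 : ℝ) : ℂ)) ^ (u + v) *
    ∑ b ∈ range (u + 1), ∑ b' ∈ range (v + 1), ∑ c ∈ range (u + 1), ∑ c' ∈ range (v + 1),
      ∑ d ∈ range (b + 1),
        powCoeff (-Complex.I) u b c * powCoeff Complex.I v b' c' *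
          swapCoeff b (v - (b' + 2 * c')) d *
          ((if α = (u - (b + 2 * c)) + (v - (b' + 2 * c') - d) then 1 else 0) *
            (if β = (b - d) + b' then 1 else 0))

/-- Coefficients are collected by testing each exponent pair with indicators. `ladderCoeff` has this
shape so that plain nested loops can evaluate it. -/
theorem sum_indicator_smul {M : Type*} [AddCommGroup M] [Module ℂ M] (D a b : ℕ) (ha : a < D)
    (hb : b < D) (z : ℂ) (f : ℕ → ℕ → M) :
    ∑ x ∈ range D ×ˢ range D,
      (z * ((if x.1 = a then 1 else 0) * (if x.2 = b then 1 else 0))) • f x.1 x.2 = z • f a b := by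
  rw [sum_eq_single_of_mem (a, b) (by simp [ha, hb])]
  · simp
  · intro x _ h
    by_cases h1 : x.1 = a
    · have h2 : x.2 ≠ b := fun h2 => h (Prod.ext h1 h2)
      simp [h2]
    · simp [h1]

/-- Both powers are expanded by `weyl_add_pow`; the inner factor `p^b q^(v-(b'+2c'))` is then
reordered by `weyl_pow_mul_pow`, which produces the fifth index `d`. -/
theorem creation_pow_mul_annihilation_pow {m : ℕ} (k : Fin m) (u v D : ℕ) (hD : u + v < D) :
    (creation k ^ u * annihilation k ^ v : Module.End ℂ (FinVec m)) =
      ∑ x ∈ range D ×ˢ range D,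
        ladderCoeff u v x.1 x.2 • (position k ^ x.1 * momentum k ^ x.2) := by
  have hc := momentum_mul_position k
  have e1 := weyl_add_pow hc (-Complex.I) u (u + 1) (by omega)
  have e2 := weyl_add_pow hc Complex.I v (v + 1) (by omega)
  have e : (creation k ^ u * annihilation k ^ v : Module.End ℂ (FinVec m)) =
      (1 / ((Real.sqrt 2 : ℝ) : ℂ)) ^ (u + v) • ((position k + (-Complex.I) • momentum k) ^ u *
        (position k + Complex.I • momentum k) ^ v) := by
    rw [creation_eq, annihilation_eq, smul_pow, smul_pow, smul_mul_smul_comm, ← pow_add]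
  rw [e]
  refine (congrArg₂ (fun x y => (1 / ((Real.sqrt 2 : ℝ) : ℂ)) ^ (u + v) • (x * y)) e1 e2).trans ?_
  simp only [ladderCoeff, mul_smul, ← smul_sum]
  congr 1
  simp only [sum_smul, sum_mul_sum]
  -- The sum over exponent pairs is moved inside the five other sums, where the indicators leave a
  -- single pair.
  conv_rhs => rw [sum_comm]
  refine sum_congr rfl fun b hb => ?_
  conv_rhs => rw [sum_comm]
  refine sum_congr rfl fun b' hb' => ?_
  conv_rhs => rw [sum_comm]
  refine sum_congr rfl fun c _ => ?_
  conv_rhs => rw [sum_comm]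
  refine sum_congr rfl fun c' _ => ?_
  conv_rhs => rw [sum_comm]
  rw [smul_mul_smul_comm, mul_assoc, ← mul_assoc (momentum k ^ b),
    weyl_pow_mul_pow hc, sum_mul, mul_sum, smul_sum]
  refine sum_congr rfl fun d _ => ?_
  have hb1 := mem_range.1 hb
  have hb2 := mem_range.1 hb'
  rw [sum_indicator_smul D _ _ (by omega) (by omega) _
    (fun α β => position k ^ α * momentum k ^ β), smul_mul_assoc, mul_smul_comm, smul_smul,
    pow_add, pow_add]
  simp only [mul_assoc]

/-- The coefficient of `q ^ α * p ^ β` in the transition operator. -/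
noncomputable def modeCoeff (N i j α β : ℕ) : ℂ :=
  ((Real.sqrt ((min i j).factorial / (max i j).factorial) : ℝ) : ℂ) *
    ∑ r ∈ range (N + 1), (newtonCoeff (min i j) r : ℂ) *
      ladderCoeff (max i j - j + r) (max i j - i + r) α β

theorem transitionOp_eq_sum {m : ℕ} (k : Fin m) {N i j : ℕ} (hi : i ≤ N) (hj : j ≤ N) :
    transitionOp k N i j = ∑ r ∈ range (N + 1),
      (((Real.sqrt ((min i j).factorial / (max i j).factorial) : ℝ) : ℂ) *
        (newtonCoeff (min i j) r : ℂ)) •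
        (creation k ^ (max i j - j + r) * annihilation k ^ (max i j - i + r)) := by
  rw [transitionOp, aeval_number_lagrange k N _ (by omega), mul_sum, sum_mul, smul_sum]
  refine sum_congr rfl fun r _ => ?_
  rw [mul_smul_comm, smul_mul_assoc, smul_smul, pow_add, add_comm _ r, pow_add]
  simp only [mul_assoc]

/-- The range `3 * N + 1` suffices because the ladder exponents add up to `|i - j| + 2r ≤ N + 2N`.
-/
theorem transitionOp_eq {m : ℕ} (k : Fin m) {N i j : ℕ} (hi : i ≤ N) (hj : j ≤ N) :
    transitionOp k N i j = ∑ x ∈ range (3 * N + 1) ×ˢ range (3 * N + 1),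
      modeCoeff N i j x.1 x.2 • (position k ^ x.1 * momentum k ^ x.2) := by
  rw [transitionOp_eq_sum k hi hj]
  have h : ∀ r ∈ range (N + 1), (creation k ^ (max i j - j + r) *
      annihilation k ^ (max i j - i + r) : Module.End ℂ (FinVec m)) = _ := fun r hr =>
    creation_pow_mul_annihilation_pow k _ _ (3 * N + 1)
      (by have := mem_range.1 hr; omega)
  rw [sum_congr rfl fun r hr => by rw [h r hr]]
  simp only [modeCoeff, mul_sum, sum_smul, smul_sum]
  rw [sum_comm]
  refine sum_congr rfl fun x _ => sum_congr rfl fun r _ => ?_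
  rw [smul_smul, mul_assoc]

/-- A nonzero coefficient has a nonzero summand, whose indicators determine `α` and `β`.
Contractions only lower the total degree. -/
theorem le_of_ladderCoeff_ne_zero {u v α β : ℕ} (h : ladderCoeff u v α β ≠ 0) :
    α + β ≤ u + v := by
  obtain ⟨b, hb, h⟩ := exists_ne_zero_of_sum_ne_zero (right_ne_zero_of_mul h)
  obtain ⟨b', hb', h⟩ := exists_ne_zero_of_sum_ne_zero h
  obtain ⟨c, hc, h⟩ := exists_ne_zero_of_sum_ne_zero h
  obtain ⟨c', hc', h⟩ := exists_ne_zero_of_sum_ne_zero h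
  obtain ⟨d, hd, h⟩ := exists_ne_zero_of_sum_ne_zero h
  have h1 := left_ne_zero_of_mul (right_ne_zero_of_mul h)
  have h2 := right_ne_zero_of_mul (right_ne_zero_of_mul h)
  simp only [ne_eq, ite_eq_right_iff, one_ne_zero, imp_false, not_not] at h1 h2
  have hb1 := mem_range.1 hb
  have hb2 := mem_range.1 hb'
  omega

theorem le_of_modeCoeff_ne_zero {N i j α β : ℕ} (hi : i ≤ N) (hj : j ≤ N)
    (h : modeCoeff N i j α β ≠ 0) : α + β ≤ 3 * N := by
  obtain ⟨r, hr, h⟩ := exists_ne_zero_of_sum_ne_zero (right_ne_zero_of_mul h)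
  have h1 := le_of_ladderCoeff_ne_zero (right_ne_zero_of_mul h)
  have h2 := mem_range.1 hr
  omega

end ModeOperators

/-! ## Matrix elements of the interpolation operator -/

section MatrixElements

open Finset

/-- The value at `x` of the Lagrange polynomial `L_l` of the nodes `0,…,N`. -/
noncomputable def lagrangeValue (N l x : ℕ) : ℝ :=
  ∑ r ∈ range (N + 1), newtonCoeff l r * x.descFactorial r

theorem eval_lagrange_basis {N l : ℕ} (hl : l ≤ N) (x : ℕ) :
    (Lagrange.basis (range (N + 1)) (fun x : ℕ => (x : ℂ)) l).eval (x : ℂ) =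
      (lagrangeValue N l x : ℂ) := by
  rw [lagrange_basis_eq_newton N l hl, lagrangeValue]
  simp only [Polynomial.eval_finsetSum, Polynomial.eval_mul, Polynomial.eval_C,
    descPochhammer_eval_eq_descFactorial]
  push_cast
  rfl

/-- The occupation number into which the transition operator takes `n`. -/
def modeTarget (i j n : ℕ) : ℕ := n - (max i j - i) + (max i j - j)

/-- The factor that the transition operator produces on the occupation number `n`. -/
noncomputable def modeWeight (N i j n : ℕ) : ℝ :=
  Real.sqrt ((min i j).factorial / (max i j).factorial) *
    (Real.sqrt (n.descFactorial (max i j - i)) *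
      lagrangeValue N (min i j) (n - (max i j - i)) *
      Real.sqrt ((modeTarget i j n).descFactorial (max i j - j)))

theorem transitionOp_single {m : ℕ} (k : Fin m) {N i j : ℕ} (hi : i ≤ N) (n : Fin m → ℕ) (c : ℂ) :
    transitionOp k N i j (Finsupp.single n c) =
      Finsupp.single (Function.update n k (modeTarget i j (n k)))
        (c * (modeWeight N i j (n k) : ℂ)) := by
  rw [transitionOp, LinearMap.smul_apply, Module.End.mul_apply, Module.End.mul_apply,
    annihilation_pow_single, aeval_number_single, creation_pow_single]
  simp only [Function.update_self, Function.update_idem]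
  rw [eval_lagrange_basis (by omega), Finsupp.smul_single, smul_eq_mul, modeWeight, modeTarget]
  push_cast
  ring_nf

/-- The matrix element of the transition operator between the occupation numbers `n` and `n'`. -/
noncomputable def modeElem (N i j n' n : ℕ) : ℝ :=
  if n' = modeTarget i j n then modeWeight N i j n else 0

/-- The adjoint of `a†^x L a^y` is `a†^y L a^x`, and both elements evaluate `L` at the same point `n
- y = n' - x`. If `n < y` or `n' < x`, a falling factorial kills one side and the target condition
fails on the other, so truncated subtraction creates no spurious element. -/
theorem modeElem_symm (N i j n' n : ℕ) : modeElem N i j n' n = modeElem N j i n n' := by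
  simp only [modeElem, modeWeight, modeTarget, max_comm j i, min_comm j i]
  obtain ⟨y, hy⟩ : ∃ y, y = max i j - i := ⟨_, rfl⟩
  obtain ⟨x, hx⟩ : ∃ x, x = max i j - j := ⟨_, rfl⟩
  simp only [← hy, ← hx]
  rcases lt_or_ge n y with hn | hn
  · rw [Nat.descFactorial_eq_zero_iff_lt.2 hn, if_neg (by omega : ¬ n = n' - x + y)]
    simp
  rcases lt_or_ge n' x with hn' | hn'
  · rw [Nat.descFactorial_eq_zero_iff_lt.2 hn', if_neg (by omega : ¬ n' = n - y + x)]
    simp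
  by_cases h : n' = n - y + x
  · have h2 : n = n' - x + y := by omega
    have h3 : n - y = n' - x := by omega
    rw [if_pos h, if_pos h2, ← h, ← h2, h3]
    ring
  · rw [if_neg h, if_neg (by omega)]

theorem modeElem_of_le {N i j n : ℕ} (_ : i ≤ N) (hj : j ≤ N) (hn : n ≤ N) (n' : ℕ) :
    modeElem N i j n' n = if n = j ∧ n' = i then 1 else 0 := by
  have key : modeWeight N i j n = if n = j then 1 else 0 := by
    rcases lt_or_ge n (max i j - i) with hlt | hle
    · rw [modeWeight, Nat.descFactorial_eq_zero_iff_lt.2 hlt, if_neg (by omega)]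
      simp
    -- The lowered number `n - (max i j - i)` is still at most `N`, hence a node of the
    -- interpolation.
    rw [modeWeight, lagrangeValue, sum_newtonCoeff N _ _ (by omega)]
    split_ifs with h1 h2 h2
    · subst h2
      have e1 : modeTarget i n n = i := by unfold modeTarget; omega
      have h0 : ∀ a : ℕ, (a.factorial : ℝ) ≠ 0 := fun a => by exact_mod_cast a.factorial_ne_zero
      rw [e1, mul_one, ← Real.sqrt_mul (by positivity), ← Real.sqrt_mul (by positivity),
        Real.sqrt_eq_one]
      rcases le_total i n with h | h
      -- One of the two ladder exponents is zero, and the other falling factorial is `max!/min!`,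
      -- which cancels the prefactor.
      · have h3 := Nat.factorial_mul_descFactorial (n := n) (k := n - i) (by omega)
        rw [show n - (n - i) = i by omega] at h3
        have h3' : (i.factorial : ℝ) * (n.descFactorial (n - i)) = n.factorial := by
          exact_mod_cast h3
        have := h0 n
        rw [max_eq_right h, min_eq_left h, Nat.sub_self, Nat.descFactorial_zero]
        field_simp
        push_cast
        linarith
      · have h3 := Nat.factorial_mul_descFactorial (n := i) (k := i - n) (by omega)
        rw [show i - (i - n) = n by omega] at h3
        have h3' : (n.factorial : ℝ) * (i.descFactorial (i - n)) = i.factorial := by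
          exact_mod_cast h3
        have := h0 i
        rw [max_eq_left h, min_eq_right h, Nat.sub_self, Nat.descFactorial_zero]
        field_simp
        push_cast
        linarith
    · omega
    · omega
    · simp
  rw [modeElem, key]
  by_cases h : n = j
  · subst h
    have e1 : modeTarget i n n = i := by unfold modeTarget; omega
    simp [e1]
  · simp [h]

/-- A product of operators that act each on one mode, on a Fock basis vector. -/
theorem list_prod_single {m : ℕ} (T : Fin m → Module.End ℂ (FinVec m)) (φ : Fin m → ℕ → ℕ)
    (w : Fin m → ℕ → ℂ)
    (hT : ∀ k n c, T k (Finsupp.single n c) =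
      Finsupp.single (Function.update n k (φ k (n k))) (c * w k (n k)))
    (n : Fin m → ℕ) (c : ℂ) :
    (List.ofFn T).prod (Finsupp.single n c) =
      Finsupp.single (fun k => φ k (n k)) (c * ∏ k, w k (n k)) := by
  -- Induction over lists without repetition: no mode is hit twice, so each factor still sees the
  -- original occupation number.
  have key : ∀ l : List (Fin m), l.Nodup → (l.map T).prod (Finsupp.single n c) =
      Finsupp.single (fun k => if k ∈ l then φ k (n k) else n k)
        (c * (l.map fun k => w k (n k)).prod) := by
    intro l hl
    induction l with
    | nil => simp
    | cons k l ih =>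
      obtain ⟨hk, hl⟩ := List.nodup_cons.1 hl
      rw [List.map_cons, List.prod_cons, Module.End.mul_apply, ih hl, hT]
      simp only [hk, if_false, List.map_cons, List.prod_cons]
      congr 1
      · funext x
        by_cases hx : x = k
        · subst hx; simp
        · simp [hx]
      · ring
  rw [List.ofFn_eq_map, key _ (List.nodup_finRange m)]
  simp only [List.mem_finRange, if_true]
  rw [← List.ofFn_eq_map, List.prod_ofFn]

theorem prod_transitionOp_single_apply {m : ℕ} {N : Fin m → ℕ}
    (i j : (k : Fin m) → Fin (N k + 1)) (n n' : Fin m → ℕ) :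
    (List.ofFn fun k : Fin m => transitionOp k (N k) (i k) (j k)).prod
      (Finsupp.single n (1 : ℂ)) n' =
      ((∏ k, modeElem (N k) (i k) (j k) (n' k) (n k) : ℝ) : ℂ) := by
  rw [list_prod_single _ (fun k => modeTarget (i k) (j k))
    (fun k x => (modeWeight (N k) (i k) (j k) x : ℂ))
    (fun k n c => transitionOp_single k (Nat.lt_succ_iff.1 (i k).2) n c)]
  rw [Finsupp.single_apply, one_mul]
  split_ifs with h
  · push_cast
    refine prod_congr rfl fun k _ => ?_
    rw [modeElem, if_pos (congrFun h k).symm]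
  · obtain ⟨k, hk⟩ := Function.ne_iff.1 h
    rw [prod_eq_zero (mem_univ k), Complex.ofReal_zero]
    rw [modeElem, if_neg (Ne.symm hk)]

theorem interpolationOp_single_apply {m : ℕ} {N : Fin m → ℕ}
    (H : cutoffSpace N →L[ℂ] cutoffSpace N) (n n' : Fin m → ℕ) :
    interpolationOp H (Finsupp.single n 1) n' =
      ∑ i : (k : Fin m) → Fin (N k + 1), ∑ j : (k : Fin m) → Fin (N k + 1),
        entry H i j * ((∏ k, modeElem (N k) (i k) (j k) (n' k) (n k) : ℝ) : ℂ) := by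
  simp only [interpolationOp, LinearMap.sum_apply, Finsupp.finsetSum_apply, LinearMap.smul_apply,
    Finsupp.smul_apply, prod_transitionOp_single_apply, smul_eq_mul]

theorem entry_conj {m : ℕ} {N : Fin m → ℕ} {H : cutoffSpace N →L[ℂ] cutoffSpace N}
    (hH : (H : cutoffSpace N →ₗ[ℂ] cutoffSpace N).IsSymmetric)
    (i j : (k : Fin m) → Fin (N k + 1)) : (starRingEnd ℂ) (entry H i j) = entry H j i := by
  exact (inner_conj_symm (H (cutoffKet N j)) (cutoffKet N i)).trans (hH _ _)

/-- Conjugation transposes the matrix of `H`, and the real mode elements are transposed by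
exchanging `i` and `j`; relabelling the double sum matches the two. -/
theorem interpolationOp_conj {m : ℕ} {N : Fin m → ℕ} {H : cutoffSpace N →L[ℂ] cutoffSpace N}
    (hH : (H : cutoffSpace N →ₗ[ℂ] cutoffSpace N).IsSymmetric) (n n' : Fin m → ℕ) :
    (starRingEnd ℂ) (interpolationOp H (Finsupp.single n 1) n') =
      interpolationOp H (Finsupp.single n' 1) n := by
  rw [interpolationOp_single_apply, interpolationOp_single_apply, sum_comm]
  simp only [map_sum, map_mul, entry_conj hH, Complex.conj_ofReal]
  refine sum_congr rfl fun j _ => sum_congr rfl fun i _ => ?_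
  simp only [modeElem_symm _ (i _ : ℕ) (j _ : ℕ)]

/-- Below the cutoffs the product of the mode elements is that of the matrix unit `|i⟩⟨j'|`, so only
`j' = j` contributes. -/
theorem interpolationOp_single_of_le {m : ℕ} {N : Fin m → ℕ}
    (H : cutoffSpace N →L[ℂ] cutoffSpace N) (j : (k : Fin m) → Fin (N k + 1)) :
    interpolationOp H (Finsupp.single (fun k => (j k : ℕ)) 1) =
      ∑ i : (k : Fin m) → Fin (N k + 1),
        entry H i j • Finsupp.single (fun k => (i k : ℕ)) (1 : ℂ) := by
  classical
  ext n'
  rw [interpolationOp_single_apply]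
  simp only [Finsupp.finsetSum_apply, Finsupp.smul_apply, smul_eq_mul, Finsupp.single_apply]
  refine sum_congr rfl fun i _ => ?_
  have h : ∀ j' : (k : Fin m) → Fin (N k + 1),
      ∏ k, modeElem (N k) (i k) (j' k) (n' k) (j k) =
        if j' = j ∧ (fun k => (i k : ℕ)) = n' then 1 else 0 := by
    intro j'
    simp only [modeElem_of_le (Nat.lt_succ_iff.1 (i _).2) (Nat.lt_succ_iff.1 (j' _).2)
      (Nat.lt_succ_iff.1 (j _).2)]
    rw [prod_ite_zero]
    simp only [mem_univ, forall_true_left, prod_const_one]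
    congr 1
    simp only [funext_iff, Fin.ext_iff, forall_and, eq_comm]
  simp only [h]
  rw [sum_eq_single_of_mem j (mem_univ j)]
  · split_ifs <;> simp_all
  · intro j' _ hj'
    simp [hj']

/-! ## The interpolation operator as an unbounded operator -/

theorem inner_ket_left {m : ℕ} (n : Fin m → ℕ) (x : FockSpace m) : inner ℂ (ket n) x = x n := by
  rw [ket, lp.inner_single_left]
  simp

theorem inner_ket_right {m : ℕ} (n : Fin m → ℕ) (x : FockSpace m) :
    inner ℂ x (ket n) = (starRingEnd ℂ) (x n) := by
  rw [← inner_conj_symm, inner_ket_left]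

theorem toFock_single {m : ℕ} (n : Fin m → ℕ) (c : ℂ) :
    toFock m (Finsupp.single n c) = c • ket n := by
  simp [toFock]

theorem toUnbounded_apply {m : ℕ} (T : Module.End ℂ (FinVec m)) (x : (toUnbounded T).domain)
    (f : FinVec m) (h : (x : FockSpace m) = toFock m f) :
    toUnbounded T x = toFock m (T f) := by
  have : (LinearEquiv.ofInjective (toFock m) (toFock_injective m)).symm x = f := by
    exact (LinearEquiv.symm_apply_eq _).2 (Subtype.ext h)
  exact congrArg (fun g => toFock m (T g)) this

theorem dense_range_toFock (m : ℕ) :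
    Dense (LinearMap.range (toFock m) : Set (FockSpace m)) := by
  classical
  intro x
  have h := lp.hasSum_single (p := 2) (by norm_num) x
  refine mem_closure_of_tendsto h (Filter.Eventually.of_forall fun s => ?_)
  refine Submodule.sum_mem _ fun n _ => ⟨Finsupp.single n (x n), ?_⟩
  rw [toFock_single, ket]
  rw [← lp.single_smul, smul_eq_mul, mul_one]

/-- The domain consists of finite combinations, so sesquilinearity reduces symmetry to matrix
elements. -/
theorem isHermitianOp_toUnbounded {m : ℕ} {T : Module.End ℂ (FinVec m)}
    (hT : ∀ n n', (starRingEnd ℂ) (T (Finsupp.single n 1) n') = T (Finsupp.single n' 1) n) :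
    IsHermitianOp (toUnbounded T) := by
  refine ⟨dense_range_toFock m, ?_⟩
  rintro ⟨_, f, rfl⟩ ⟨_, g, rfl⟩
  rw [toUnbounded_apply T _ f rfl, toUnbounded_apply T _ g rfl]
  change inner ℂ (toFock m (T f)) (toFock m g) = inner ℂ (toFock m f) (toFock m (T g))
  have hs : ∀ (n : Fin m → ℕ) (c : ℂ), (Finsupp.single n c : FinVec m) =
      c • Finsupp.single n 1 := by intro n c; simp
  induction f using Finsupp.induction_linear with
  | zero => simp
  | add f f' hf hf' => simp only [map_add, inner_add_left, hf, hf']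
  | single n c =>
    induction g using Finsupp.induction_linear with
    | zero => simp
    | add g g' hg hg' => simp only [map_add, inner_add_right, hg, hg']
    | single n' c' =>
      rw [hs n, hs n']
      simp only [map_smul, inner_smul_left, inner_smul_right, toFock_single, one_smul,
        inner_ket_left, inner_ket_right, toFock_apply, hT]

theorem cutoffSpace_eq_sum {m : ℕ} {N : Fin m → ℕ} {y : FockSpace m} (hy : y ∈ cutoffSpace N) :
    y = ∑ i : (k : Fin m) → Fin (N k + 1),
      inner ℂ (ket fun k => (i k : ℕ)) y • ket (fun k => (i k : ℕ)) := by
  classical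
  refine Submodule.span_induction (p := fun y _ => y = ∑ i : (k : Fin m) → Fin (N k + 1),
      inner ℂ (ket fun k => (i k : ℕ)) y • ket (fun k => (i k : ℕ))) ?_ ?_ ?_ ?_ hy
  · rintro _ ⟨l, rfl⟩
    rw [sum_eq_single_of_mem l (mem_univ l)]
    · rw [inner_ket_left]
      change ket (fun k => (l k : ℕ)) = ket (fun k => (l k : ℕ)) (fun k => (l k : ℕ)) • _
      simp [ket]
    · intro i _ hi
      have hne : (fun k => (i k : ℕ)) ≠ fun k => (l k : ℕ) :=
        fun h => hi (funext fun k => Fin.ext (congrFun h k))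
      rw [inner_ket_left]
      change ket (fun k => (l k : ℕ)) (fun k => (i k : ℕ)) • _ = _
      simp [ket, hne]
  · simp
  · intro y z _ _ hy hz
    conv_lhs => rw [hy, hz]
    simp only [inner_add_right, add_smul, sum_add_distrib]
  · intro a y _ hy
    conv_lhs => rw [hy]
    simp only [inner_smul_right, smul_sum, mul_smul]

/-- Together with symmetry, this is all that the abstract block arguments need to know about the
interpolation operator. -/
theorem toUnbounded_interpolationOp_of_mem {m : ℕ} {N : Fin m → ℕ}
    (H : cutoffSpace N →L[ℂ] cutoffSpace N) (x : cutoffSpace N) :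
    ∃ h : (x : FockSpace m) ∈ (toUnbounded (interpolationOp H)).domain,
      toUnbounded (interpolationOp H) ⟨x, h⟩ = H x := by
  set c : ((k : Fin m) → Fin (N k + 1)) → ℂ := fun j => inner ℂ (ket fun k => (j k : ℕ)) (x : _)
  have hx : (x : FockSpace m) =
      toFock m (∑ j, c j • Finsupp.single (fun k => (j k : ℕ)) (1 : ℂ)) := by
    rw [map_sum]
    refine (cutoffSpace_eq_sum x.2).trans (sum_congr rfl fun j _ => ?_)
    rw [map_smul, toFock_single, one_smul]
  have hx' : x = ∑ j, c j • cutoffKet N j := by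
    refine Subtype.ext ((cutoffSpace_eq_sum x.2).trans ?_)
    rw [AddSubmonoidClass.coe_finsetSum]
    rfl
  refine ⟨⟨_, hx.symm⟩, ?_⟩
  rw [toUnbounded_apply _ _ _ hx]
  conv_rhs => rw [hx']
  rw [map_sum, map_sum, map_sum, AddSubmonoidClass.coe_finsetSum]
  refine sum_congr rfl fun j _ => ?_
  rw [map_smul, map_smul, map_smul, interpolationOp_single_of_le, Submodule.coe_smul,
    cutoffSpace_eq_sum (H (cutoffKet N j)).2, map_sum]
  refine congrArg _ (sum_congr rfl fun i _ => ?_)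
  rw [map_smul, toFock_single, one_smul]
  rfl

end MatrixElements

/-! ## Unbounded operators with a finite-dimensional bounded block -/

section Blocks

variable {E : Type*} [NormedAddCommGroup E] [InnerProductSpace ℂ E]

/-! ### Schrödinger curves of symmetric operators: conservation and uniqueness -/

theorem SolvesSchrodinger.inner_eq {A : E →ₗ.[ℂ] E} (hA : A.IsFormalAdjoint A) {φ χ : ℝ → E}
    (hφ : SolvesSchrodinger A φ) (hχ : SolvesSchrodinger A χ) (t : ℝ) :
    inner ℂ (φ t) (χ t) = inner ℂ (φ 0) (χ 0) := by
  have hd : ∀ s, HasDerivAt (fun s => inner ℂ (φ s) (χ s)) 0 s := by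
    intro s
    obtain ⟨h1, d1⟩ := hφ s
    obtain ⟨h2, d2⟩ := hχ s
    have h := d1.inner ℂ d2
    have hs := hA ⟨φ s, h1⟩ ⟨χ s, h2⟩
    simp only at hs
    have h0 : inner ℂ (φ s) (Complex.I • A ⟨χ s, h2⟩) +
        inner ℂ (Complex.I • A ⟨φ s, h1⟩) (χ s) = 0 := by
      rw [inner_smul_right, inner_smul_left, hs, Complex.conj_I]
      ring
    rwa [h0] at h
  exact is_const_of_deriv_eq_zero (fun s => (hd s).differentiableAt) (fun s => (hd s).deriv) t 0

/-- The difference of two solutions is a solution that starts at zero, and its norm is conserved. -/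
theorem SolvesSchrodinger.eq {A : E →ₗ.[ℂ] E} (hA : A.IsFormalAdjoint A) {φ χ : ℝ → E}
    (hφ : SolvesSchrodinger A φ) (hχ : SolvesSchrodinger A χ) (h0 : φ 0 = χ 0) : φ = χ := by
  have hsub : SolvesSchrodinger A (fun t => φ t - χ t) := by
    intro t
    obtain ⟨h1, d1⟩ := hφ t
    obtain ⟨h2, d2⟩ := hχ t
    refine ⟨A.domain.sub_mem h1 h2, ?_⟩
    have e : A ⟨φ t - χ t, A.domain.sub_mem h1 h2⟩ = A ⟨φ t, h1⟩ - A ⟨χ t, h2⟩ :=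
      A.map_sub ⟨φ t, h1⟩ ⟨χ t, h2⟩
    rw [e, smul_sub]
    exact d1.sub d2
  funext t
  have h := hsub.inner_eq hA hsub t
  simp only [h0, sub_self, inner_zero_left] at h
  exact sub_eq_zero.1 (inner_self_eq_zero.1 h)

/-! ### Exponentials of bounded operators and unitary groups -/

theorem expI_zero (B : E →L[ℂ] E) : expI B 0 = ContinuousLinearMap.id ℂ E := by
  simp only [expI, Complex.ofReal_zero, mul_zero, zero_smul, NormedSpace.exp_zero]
  rfl

theorem expI_add [CompleteSpace E] (B : E →L[ℂ] E) (s t : ℝ) :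
    expI B (s + t) = expI B s ∘L expI B t := by
  have h : Commute ((Complex.I * (s : ℂ)) • B) ((Complex.I * (t : ℂ)) • B) :=
    ((Commute.refl B).smul_left _).smul_right _
  let _ : NormedAlgebra ℚ (E →L[ℂ] E) := NormedAlgebra.restrictScalars ℚ ℂ _
  have := NormedSpace.exp_add_of_commute h
  rw [expI, Complex.ofReal_add, mul_add, add_smul, this]
  rfl

theorem hasDerivAt_expI [CompleteSpace E] (B : E →L[ℂ] E) (x : E) (t : ℝ) :
    HasDerivAt (fun t => expI B t x) (Complex.I • B (expI B t x)) t := by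
  have h1 := (hasDerivAt_exp_smul_const' (𝕂 := ℂ) (Complex.I • B) (t : ℂ)).scomp t
    (Complex.ofRealCLM.hasDerivAt (x := t))
  have h2 := ((ContinuousLinearMap.apply ℂ E x).hasFDerivAt.restrictScalars ℝ).comp_hasDerivAt
    t h1
  have e : ∀ s : ℝ, expI B s = NormedSpace.exp ((s : ℂ) • (Complex.I • B)) := by
    intro s
    rw [expI, smul_smul, mul_comm]
  simp only [e]
  refine (h2.congr_deriv ?_)
  change (Complex.ofRealCLM 1 • (Complex.I • B *
    NormedSpace.exp ((t : ℂ) • Complex.I • B)) : E →L[ℂ] E) x = _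
  rw [Complex.ofRealCLM_apply, Complex.ofReal_one, one_smul]
  rfl

/-- The group law transports the derivative from `0` to `t`. The derivative is written `U t (iAx)`
rather than `iA (U t x)`, since `U t x` may leave the domain of `A`. -/
theorem hasDerivAt_evolution {A : E →ₗ.[ℂ] E} {U : ℝ → E →L[ℂ] E} (hU : IsEvolution A U)
    (x : A.domain) (t : ℝ) :
    HasDerivAt (fun t => U t x) (U t (Complex.I • A x)) t := by
  have h0 : HasDerivAt (fun τ => U τ x) (Complex.I • A x) (t - t) := by
    rw [sub_self]; exact hU.generator x
  have h1 := h0.comp_sub_const t t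
  have h2 := (U t).hasFDerivAt.restrictScalars ℝ |>.comp_hasDerivAt t h1
  refine h2.congr_of_eventuallyEq (Filter.Eventually.of_forall fun τ => ?_)
  have := hU.add t (τ - t)
  rw [add_sub_cancel] at this
  simp [this]

theorem IsEvolution.neg_apply {A : E →ₗ.[ℂ] E} {U : ℝ → E →L[ℂ] E} (hU : IsEvolution A U)
    (t : ℝ) (x : E) : U (-t) (U t x) = x := by
  have h := hU.add (-t) t
  rw [neg_add_cancel, hU.zero] at h
  exact (DFunLike.congr_fun h x).symm

theorem boundedSum_apply (K : Submodule ℂ E) [K.HasOrthogonalProjection] (B : K →L[ℂ] K)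
    (C : Kᗮ →L[ℂ] Kᗮ) (x : E) : boundedSum K B C x =
      (B (K.orthogonalProjectionOnto x) : E) + (C (Kᗮ.orthogonalProjectionOnto x) : E) := rfl

variable (K : Submodule ℂ E) [FiniteDimensional ℂ K]

theorem projection_add_projection_orthogonal (x : E) :
    (K.orthogonalProjectionOnto x : E) + (Kᗮ.orthogonalProjectionOnto x : E) = x :=
  K.starProjection_add_starProjection_orthogonal x

theorem projection_coe_add_coe (a : K) (b : Kᗮ) :
    K.orthogonalProjectionOnto ((a : E) + b) = a := by
  rw [map_add, Submodule.orthogonalProjectionOnto_mem_subspace_eq_self,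
    Submodule.orthogonalProjectionOnto_apply_of_mem_orthogonal b.2, add_zero]

theorem projection_orthogonal_coe_add_coe (a : K) (b : Kᗮ) :
    Kᗮ.orthogonalProjectionOnto ((a : E) + b) = b := by
  rw [map_add, Submodule.orthogonalProjectionOnto_mem_subspace_eq_self,
    Submodule.orthogonalProjectionOnto_apply_of_mem_orthogonal
      (Submodule.le_orthogonal_orthogonal K a.2), zero_add]

variable {K} {A : E →ₗ.[ℂ] E} {H : K →L[ℂ] K}

/-- The curve `e^{itH} ψ` solves the Schrödinger equation of `A`. -/
theorem solvesSchrodinger_expI (hK : ∀ x : K, ∃ h : (x : E) ∈ A.domain, A ⟨x, h⟩ = H x)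
    (ψ : K) : SolvesSchrodinger A (fun t => (expI H t ψ : E)) := by
  intro t
  obtain ⟨h, e⟩ := hK (expI H t ψ)
  refine ⟨h, ?_⟩
  rw [e]
  exact (K.subtypeL.hasFDerivAt.restrictScalars ℝ).comp_hasDerivAt t (hasDerivAt_expI H ψ t)

/-- Unitarity of `e^{itH}` follows from the conservation law for `A`. -/
theorem inner_expI (hA : A.IsFormalAdjoint A)
    (hK : ∀ x : K, ∃ h : (x : E) ∈ A.domain, A ⟨x, h⟩ = H x) (t : ℝ) (x y : K) :
    inner ℂ (expI H t x) (expI H t y) = inner ℂ x y := by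
  have h := (solvesSchrodinger_expI hK x).inner_eq hA (solvesSchrodinger_expI hK y) t
  simp only [expI_zero] at h
  exact h

/-- The curve `U (-s) e^{isH} ψ` has derivative zero. The uniqueness lemma for Schrödinger curves
does not apply directly, because `U t ψ` is not known in advance to stay in the domain of `A`. -/
theorem evolution_eq_expI (hK : ∀ x : K, ∃ h : (x : E) ∈ A.domain, A ⟨x, h⟩ = H x)
    {U : ℝ → E →L[ℂ] E} (hU : IsEvolution A U) (ψ : K) (t : ℝ) :
    U t ψ = expI H t ψ := by
  have hUK : ∀ (x : K) (t : ℝ), HasDerivAt (fun t => U t x) (U t (Complex.I • (H x : E))) t := by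
    intro x t
    obtain ⟨h, e⟩ := hK x
    have := hasDerivAt_evolution hU ⟨x, h⟩ t
    rwa [e] at this
  -- `U` is differentiable only strongly, on fixed vectors of `K`. Expanding the moving vector in a
  -- finite basis reduces the product rule to scalar coefficients times curves `U (-s) (b i)`.
  let b := stdOrthonormalBasis ℂ K
  set y : ℝ → K := fun s => expI H s ψ with hy
  have hsum : ∀ z : K, z = ∑ i, (b.repr z i) • b i := fun z => (b.sum_repr z).symm
  have hcoef : ∀ i s, HasDerivAt (fun s => b.repr (y s) i)
      (b.repr (Complex.I • H (y s)) i) s := by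
    intro i s
    have h1 := hasDerivAt_expI H ψ s
    simp only [b.repr_apply_apply]
    have h2 := (((innerSL ℂ (b i)).hasFDerivAt (x := y s)).restrictScalars ℝ).comp_hasDerivAt s h1
    exact h2
  have hg : ∀ s, HasDerivAt (fun s => U (-s) (y s : E)) 0 s := by
    intro s
    have h1 : ∀ i ∈ Finset.univ, HasDerivAt (fun s => b.repr (y s) i • U (-s) (b i : E))
        (b.repr (y s) i • (-(U (-s) (Complex.I • (H (b i) : E)))) +
          b.repr (Complex.I • H (y s)) i • U (-s) (b i : E)) s := by
      intro i _
      have h2 := (hUK (b i) (-s)).scomp s (hasDerivAt_neg s)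
      simp only [neg_smul, one_smul] at h2
      exact (hcoef i s).smul h2
    have h3 := HasDerivAt.fun_sum h1
    have e1 : (fun s => U (-s) (y s : E)) =
        fun s => ∑ i, b.repr (y s) i • U (-s) (b i : E) := by
      funext s
      conv_lhs => rw [hsum (y s)]
      simp only [AddSubmonoidClass.coe_finsetSum, Submodule.coe_smul, map_sum, map_smul]
    have e2 : ∑ i, (b.repr (y s) i • (-(U (-s) (Complex.I • (H (b i) : E)))) +
          b.repr (Complex.I • H (y s)) i • U (-s) (b i : E)) = 0 := by
      rw [Finset.sum_add_distrib]
      have e3 : ∑ i, b.repr (Complex.I • H (y s)) i • U (-s) (b i : E) =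
          U (-s) ((Complex.I • H (y s) : K) : E) := by
        conv_rhs => rw [hsum (Complex.I • H (y s))]
        simp only [AddSubmonoidClass.coe_finsetSum, Submodule.coe_smul, map_sum, map_smul]
      have e4 : ∑ i, b.repr (y s) i • (-(U (-s) (Complex.I • (H (b i) : E)))) =
          -U (-s) ((Complex.I • H (y s) : K) : E) := by
        conv_rhs => rw [hsum (y s)]
        simp only [AddSubmonoidClass.coe_finsetSum, Submodule.coe_smul, map_sum, map_smul,
          Finset.smul_sum, smul_neg, Finset.sum_neg_distrib]
        refine congrArg _ (Finset.sum_congr rfl fun i _ => ?_)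
        rw [smul_comm]
      rw [e3, e4, neg_add_cancel]
    rw [e1]
    rwa [e2] at h3
  have hconst := is_const_of_deriv_eq_zero (fun s => (hg s).differentiableAt)
    (fun s => (hg s).deriv) t 0
  simp only [hy, expI_zero, neg_zero, hU.zero] at hconst
  have h5 := congrArg (U t) hconst
  have h6 := hU.neg_apply (-t) (expI H t ψ : E)
  rw [neg_neg] at h6
  rw [h6] at h5
  exact h5.symm

/-- The part in the orthogonal complement of `K` of an operator with a block on `K`. -/
theorem exists_complementary_block (hA : IsHermitianOp A)
    (hK : ∀ x : K, ∃ h : (x : E) ∈ A.domain, A ⟨x, h⟩ = H x) :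
    ∃ H' : Kᗮ →ₗ.[ℂ] Kᗮ, IsHermitianOp H' ∧ A = unboundedSum K H H' ∧
      (∀ x : Kᗮ, x ∈ H'.domain ↔ (x : E) ∈ A.domain) ∧
      ∀ (x : H'.domain) (h : ((x : Kᗮ) : E) ∈ A.domain), (H' x : E) = A ⟨x, h⟩ := by
  -- For `u ∈ K`, symmetry gives `⟨Ax, u⟩ = ⟨x, Hu⟩`, which vanishes because `Hu ∈ K`.
  have hmem : ∀ x : A.domain, (x : E) ∈ Kᗮ → A x ∈ Kᗮ := by
    intro x hx
    rw [Submodule.mem_orthogonal']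
    intro u hu
    obtain ⟨h, e⟩ := hK ⟨u, hu⟩
    have := hA.2 x ⟨u, h⟩
    simp only at this
    rw [this, e]
    exact (Submodule.mem_orthogonal' _ _).1 hx _ (H ⟨u, hu⟩).2
  let D : Submodule ℂ Kᗮ := A.domain.comap Kᗮ.subtype
  let H' : Kᗮ →ₗ.[ℂ] Kᗮ :=
    { domain := D
      toFun := LinearMap.codRestrict Kᗮ
        (A.toFun ∘ₗ Kᗮ.subtype.restrict (p := D) (q := A.domain) (fun _ hx => hx))
        (fun x => hmem _ x.1.2) }
  have hH' : ∀ (x : H'.domain) (h : ((x : Kᗮ) : E) ∈ A.domain), (H' x : E) = A ⟨x, h⟩ :=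
    fun x h => rfl
  have hdom : ∀ x : Kᗮ, x ∈ H'.domain ↔ (x : E) ∈ A.domain := fun x => Iff.rfl
  -- Since `K` lies in the domain, subtracting the `K` component does not affect membership in it.
  have hproj : ∀ x : E, x ∈ A.domain ↔ (Kᗮ.orthogonalProjectionOnto x : E) ∈ A.domain := by
    intro x
    have h1 := projection_add_projection_orthogonal K x
    have h2 := (hK (K.orthogonalProjectionOnto x)).1
    constructor
    · intro hx
      have : (Kᗮ.orthogonalProjectionOnto x : E) = x - K.orthogonalProjectionOnto x :=
        eq_sub_of_add_eq' h1
      rw [this]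
      exact A.domain.sub_mem hx h2
    · intro hx
      rw [← h1]
      exact A.domain.add_mem h2 hx
  refine ⟨H', ⟨?_, ?_⟩, ?_, hdom, hH'⟩
  -- A continuous surjection maps a dense set to a dense set, and the projection sends `dom A` into
  -- the new domain.
  · have hsurj : Function.Surjective Kᗮ.orthogonalProjectionOnto := fun x =>
      ⟨x, Submodule.orthogonalProjectionOnto_mem_subspace_eq_self x⟩
    refine (hsurj.denseRange.dense_image Kᗮ.orthogonalProjectionOnto.continuous hA.1).mono ?_
    rintro _ ⟨x, hx, rfl⟩
    exact (hproj x).1 hx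
  · intro x y
    exact hA.2 ⟨x, x.2⟩ ⟨y, y.2⟩
  · refine LinearPMap.ext (Submodule.ext hproj) ?_
    intro x hx hx'
    obtain ⟨h2, e2⟩ := hK (K.orthogonalProjectionOnto x)
    have h3 := (hproj x).1 hx
    have h4 : (⟨x, hx⟩ : A.domain) =
        ⟨K.orthogonalProjectionOnto x, h2⟩ + ⟨Kᗮ.orthogonalProjectionOnto x, h3⟩ :=
      Subtype.ext (projection_add_projection_orthogonal K x).symm
    rw [h4, A.map_add, e2]
    rfl

/-- From left to right, `U t` and its inverse `U (-t)` both act on `K` as exponentials of `H`, so `U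
t` preserves `Kᗮ` and its restriction is the required group. From right to left, each property is
checked on the two blocks. -/
theorem evolution_iff (hA : IsHermitianOp A)
    (hK : ∀ x : K, ∃ h : (x : E) ∈ A.domain, A ⟨x, h⟩ = H x) {H' : Kᗮ →ₗ.[ℂ] Kᗮ}
    (hdom : ∀ x : Kᗮ, x ∈ H'.domain ↔ (x : E) ∈ A.domain)
    (hH' : ∀ (x : H'.domain) (h : ((x : Kᗮ) : E) ∈ A.domain), (H' x : E) = A ⟨x, h⟩)
    (U : ℝ → E →L[ℂ] E) :
    IsEvolution A U ↔ ∃ U' : ℝ → Kᗮ →L[ℂ] Kᗮ, IsEvolution H' U' ∧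
      ∀ t : ℝ, U t = boundedSum K (expI H t) (U' t) := by
  constructor
  · intro hU
    have hUK := evolution_eq_expI hK hU
    have hmem : ∀ t (x : Kᗮ), U t (x : E) ∈ Kᗮ := by
      intro t x
      rw [Submodule.mem_orthogonal]
      intro u hu
      rw [← hU.inner_map (-t), hU.neg_apply, hUK ⟨u, hu⟩ (-t)]
      exact (Submodule.mem_orthogonal _ _).1 x.2 _ (expI H (-t) ⟨u, hu⟩).2
    let U' : ℝ → Kᗮ →L[ℂ] Kᗮ := fun t => (U t ∘L Kᗮ.subtypeL).codRestrict Kᗮ (hmem t)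
    have hU' : ∀ t (x : Kᗮ), (U' t x : E) = U t x := fun t x => rfl
    have hU'' : ∀ (x : Kᗮ) t, U' t x = Kᗮ.orthogonalProjectionOnto (U t x) := by
      intro x t
      rw [← hU', Submodule.orthogonalProjectionOnto_mem_subspace_eq_self]
    refine ⟨U', ⟨?_, ?_, ?_, ?_, ?_⟩, ?_⟩
    · ext x
      rw [hU', hU.zero]
      rfl
    · intro s t
      ext x
      rw [hU', hU.add]
      rfl
    · intro t x y
      exact hU.inner_map t x y
    · intro x
      simp only [hU'']
      exact Kᗮ.orthogonalProjectionOnto.continuous.comp (hU.continuous x)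
    · intro x
      have hx := (hdom x).1 x.2
      have h1 := hU.generator ⟨x, hx⟩
      have h2 := (Kᗮ.orthogonalProjectionOnto.hasFDerivAt.restrictScalars ℝ).comp_hasDerivAt
        (0 : ℝ) h1
      simp only [hU'']
      have h3 : Complex.I • H' x = Kᗮ.orthogonalProjectionOnto (Complex.I • A ⟨x, hx⟩) := by
        rw [← hH' x hx, map_smul, Submodule.orthogonalProjectionOnto_mem_subspace_eq_self]
      rw [h3]
      exact h2
    · intro t
      ext1 x
      rw [boundedSum_apply, hU', ← hUK, ← map_add, projection_add_projection_orthogonal]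
  · rintro ⟨U', hU', hU⟩
    have happ : ∀ t (x : E), U t x = (expI H t (K.orthogonalProjectionOnto x) : E) +
        (U' t (Kᗮ.orthogonalProjectionOnto x) : E) := by
      intro t x
      rw [hU, boundedSum_apply]
    refine ⟨?_, ?_, ?_, ?_, ?_⟩
    · ext1 x
      rw [happ, expI_zero, hU'.zero]
      exact projection_add_projection_orthogonal K x
    · intro s t
      ext1 x
      rw [happ, expI_add, hU'.add, ContinuousLinearMap.comp_apply (U s), happ t x, happ s,
        projection_coe_add_coe, projection_orthogonal_coe_add_coe]
      rfl
    · intro t x y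
      have ho : ∀ (a : K) (b : Kᗮ), inner ℂ (a : E) (b : E) = 0 := fun a b =>
        (Submodule.mem_orthogonal _ _).1 b.2 _ a.2
      have ho' : ∀ (a : K) (b : Kᗮ), inner ℂ (b : E) (a : E) = 0 := fun a b =>
        (Submodule.mem_orthogonal' _ _).1 b.2 _ a.2
      have hsplit : ∀ (a a' : K) (b b' : Kᗮ),
          inner ℂ ((a : E) + b) ((a' : E) + b') = inner ℂ a a' + inner ℂ b b' := by
        intro a a' b b'
        rw [inner_add_left, inner_add_right, inner_add_right, ho, ho', add_zero, zero_add]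
        rfl
      rw [happ, happ, hsplit, inner_expI hA.2 hK, hU'.inner_map, ← hsplit,
        projection_add_projection_orthogonal, projection_add_projection_orthogonal]
    · intro x
      simp only [happ]
      refine Continuous.add ?_ ?_
      · refine continuous_subtype_val.comp ?_
        exact continuous_iff_continuousAt.2 fun t => (hasDerivAt_expI H _ t).continuousAt
      · exact continuous_subtype_val.comp (hU'.continuous _)
    · intro x
      obtain ⟨h2, e2⟩ := hK (K.orthogonalProjectionOnto (x : E))
      have h1 := projection_add_projection_orthogonal K (x : E)
      have h3 : (Kᗮ.orthogonalProjectionOnto (x : E) : E) ∈ A.domain := by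
        rw [eq_sub_of_add_eq' h1]
        exact A.domain.sub_mem x.2 h2
      have h4 : x = ⟨K.orthogonalProjectionOnto (x : E), h2⟩ +
          ⟨Kᗮ.orthogonalProjectionOnto (x : E), h3⟩ := Subtype.ext h1.symm
      have h5 := hU'.generator ⟨_, (hdom _).2 h3⟩
      have h6 := hasDerivAt_expI H (K.orthogonalProjectionOnto (x : E)) 0
      rw [expI_zero] at h6
      have h7 := (K.subtypeL.hasFDerivAt.restrictScalars ℝ).comp_hasDerivAt (0 : ℝ) h6
      have h8 := (Kᗮ.subtypeL.hasFDerivAt.restrictScalars ℝ).comp_hasDerivAt (0 : ℝ) h5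
      have h9 := h7.add h8
      simp only [happ]
      have h10 : Complex.I • A x = ((Complex.I • H (K.orthogonalProjectionOnto (x : E)) : K) : E) +
          ((Complex.I • H' ⟨_, (hdom _).2 h3⟩ : Kᗮ) : E) := by
        conv_lhs => rw [h4, A.map_add, e2]
        rw [smul_add, Submodule.coe_smul, Submodule.coe_smul, hH' _ h3]
      rw [h10]
      exact h9

end Blocks

/-! ## Polynomial time computations on the real RAM

A computation uses the natural arrays `6, 7, …` for loop variables (cell `0`) and the complex arrays
`2, 3, …` as registers (cell `0`). -/

namespace RealRAM

open Finset

/-- The size of the input, `m + ∏ (N_k + 1)`. -/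
def inputSize (s : State) : ℕ := s.nat 0 0 + ∏ k ∈ range (s.nat 0 0), (s.nat 1 k + 1)

theorem one_le_inputSize (s : State) : 1 ≤ inputSize s := by
  have : 0 < ∏ k ∈ range (s.nat 0 0), (s.nat 1 k + 1) := prod_pos fun _ _ => Nat.succ_pos _
  unfold inputSize
  omega

/-- `s` and `s'` have the same input arrays, prefix product arrays and first `d` loop variables. -/
structure Agree (d : ℕ) (s s' : State) : Prop where
  nat : ∀ a < d + 6, a ≠ 2 → a ≠ 3 → s.nat a = s'.nat a
  num : s.num 0 = s'.num 0

theorem Agree.mono {d d' : ℕ} {s s' : State} (h : Agree d' s s') (hd : d ≤ d') : Agree d s s' :=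
  ⟨fun a ha => h.nat a (by omega), h.num⟩

theorem Agree.inputSize_eq {d : ℕ} {s s' : State} (h : Agree d s s') :
    inputSize s = inputSize s' := by
  simp only [inputSize, h.nat 0 (by omega) (by omega) (by omega),
    h.nat 1 (by omega) (by omega) (by omega)]

/-- A context has to survive everything a subcomputation may overwrite: deeper loop variables,
registers, and the output arrays (natural `2`, `3` and complex `1`), none of which `Agree` mentions.
-/
def Stable (d : ℕ) (Q : State → Prop) : Prop := ∀ s s', Agree d s s' → Q s → Q s'

/-- `g` is bounded by a polynomial in the input size, on the states that satisfy `Q`. -/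
def PolyBounded (Q : State → Prop) (g : State → ℕ) : Prop :=
  ∃ c, ∀ s, Q s → g s ≤ c * inputSize s ^ c

namespace PolyBounded

variable {Q Q' : State → Prop} {f g : State → ℕ}

theorem mono (hg : PolyBounded Q g) (h : ∀ s, Q s → f s ≤ g s) : PolyBounded Q f :=
  hg.imp fun _ hc s hs => (h s hs).trans (hc s hs)

theorem restrict (hg : PolyBounded Q g) (h : ∀ s, Q' s → Q s) : PolyBounded Q' g :=
  hg.imp fun _ hc s hs => hc s (h s hs)

theorem of_pow (Q : State → Prop) (c : ℕ) : PolyBounded Q (fun s => c * inputSize s ^ c) :=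
  ⟨c, fun _ _ => le_rfl⟩

theorem const (Q : State → Prop) (c : ℕ) : PolyBounded Q (fun _ => c) :=
  ⟨c, fun s _ => Nat.le_mul_of_pos_right _ (Nat.pow_pos (one_le_inputSize s))⟩

theorem add (hf : PolyBounded Q f) (hg : PolyBounded Q g) : PolyBounded Q (fun s => f s + g s) := by
  obtain ⟨a, ha⟩ := hf
  obtain ⟨b, hb⟩ := hg
  refine ⟨a + b, fun s hs => ?_⟩
  have h1 := one_le_inputSize s
  calc f s + g s ≤ a * inputSize s ^ a + b * inputSize s ^ b := add_le_add (ha s hs) (hb s hs)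
    _ ≤ a * inputSize s ^ (a + b) + b * inputSize s ^ (a + b) := by
      gcongr <;> omega
    _ = _ := by ring

theorem mul (hf : PolyBounded Q f) (hg : PolyBounded Q g) : PolyBounded Q (fun s => f s * g s) := by
  obtain ⟨a, ha⟩ := hf
  obtain ⟨b, hb⟩ := hg
  -- One constant serves as factor and as exponent, so it must dominate both `a * b` and `a + b`.
  refine ⟨a * b + a + b, fun s hs => ?_⟩
  have h1 := one_le_inputSize s
  calc f s * g s ≤ (a * inputSize s ^ a) * (b * inputSize s ^ b) :=
        Nat.mul_le_mul (ha s hs) (hb s hs)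
    _ = (a * b) * inputSize s ^ (a + b) := by ring
    _ ≤ (a * b + a + b) * inputSize s ^ (a * b + a + b) := by
      gcongr <;> omega

end PolyBounded

/-- `g` is given by an integer expression that is evaluated in polynomial time. -/
structure NatComp (d : ℕ) (Q : State → Prop) (g : State → ℕ) : Prop where
  dep : ∀ s s', Agree d s s' → g s = g s'
  bdd : PolyBounded Q g
  expr : ∃ e : NatExpr, (∀ s, e.eval s = g s) ∧ PolyBounded Q fun s => e.cost s

theorem size_le_self (n : ℕ) : n.size ≤ n := Nat.size_le.2 Nat.lt_two_pow_self

namespace NatComp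

variable {d : ℕ} {Q : State → Prop} {f g : State → ℕ}

theorem lit (d : ℕ) (Q : State → Prop) (n : ℕ) : NatComp d Q (fun _ => n) :=
  ⟨fun _ _ _ => rfl, .const Q n, .lit n, fun _ => rfl, .const Q (1 + n.size)⟩

/-- Values are polynomially bounded, not just their bit lengths, so the logarithmic charge for the
result is covered by the value itself. -/
theorem binary (op : NatExpr → NatExpr → NatExpr) (φ : ℕ → ℕ → ℕ)
    (heval : ∀ a b s, (op a b).eval s = φ (a.eval s) (b.eval s))
    (hcost : ∀ a b s, (op a b).cost s =
      a.cost s + b.cost s + 1 + (φ (a.eval s) (b.eval s)).size)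
    (hφ : PolyBounded Q (fun s => φ (f s) (g s)))
    (hf : NatComp d Q f) (hg : NatComp d Q g) : NatComp d Q (fun s => φ (f s) (g s)) := by
  obtain ⟨a, ha, ca⟩ := hf.expr
  obtain ⟨b, hb, cb⟩ := hg.expr
  refine ⟨fun s s' h => by rw [hf.dep s s' h, hg.dep s s' h], hφ, op a b,
    fun s => by rw [heval, ha, hb], ?_⟩
  refine (((ca.add cb).add (.const Q 1)).add hφ).mono fun s _ => ?_
  rw [hcost, ha, hb]
  have := size_le_self (φ (f s) (g s))
  omega

theorem add (hf : NatComp d Q f) (hg : NatComp d Q g) : NatComp d Q (fun s => f s + g s) :=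
  binary .add (· + ·) (fun _ _ _ => rfl) (fun _ _ _ => rfl) (hf.bdd.add hg.bdd) hf hg

theorem mul (hf : NatComp d Q f) (hg : NatComp d Q g) : NatComp d Q (fun s => f s * g s) :=
  binary .mul (· * ·) (fun _ _ _ => rfl) (fun _ _ _ => rfl) (hf.bdd.mul hg.bdd) hf hg

theorem sub (hf : NatComp d Q f) (hg : NatComp d Q g) : NatComp d Q (fun s => f s - g s) :=
  binary .sub (· - ·) (fun _ _ _ => rfl) (fun _ _ _ => rfl)
    (hf.bdd.mono fun _ _ => Nat.sub_le _ _) hf hg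

theorem div (hf : NatComp d Q f) (hg : NatComp d Q g) : NatComp d Q (fun s => f s / g s) :=
  binary .div (· / ·) (fun _ _ _ => rfl) (fun _ _ _ => rfl)
    (hf.bdd.mono fun _ _ => Nat.div_le_self _ _) hf hg

theorem mod (hf : NatComp d Q f) (hg : NatComp d Q g) : NatComp d Q (fun s => f s % g s) :=
  binary .mod (· % ·) (fun _ _ _ => rfl) (fun _ _ _ => rfl)
    (hf.bdd.mono fun _ _ => Nat.mod_le _ _) hf hg

theorem load (a : ℕ) (ha : a < d + 6) (h2 : a ≠ 2) (h3 : a ≠ 3) (hg : NatComp d Q g)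
    (hb : PolyBounded Q (fun s => s.nat a (g s))) : NatComp d Q (fun s => s.nat a (g s)) := by
  obtain ⟨e, he, ce⟩ := hg.expr
  refine ⟨fun s s' h => by rw [hg.dep s s' h, h.nat a ha h2 h3], hb, .load a e,
    fun s => by rw [NatExpr.eval, he], ?_⟩
  refine ((ce.add (.const Q 1)).add hb).mono fun s _ => ?_
  rw [NatExpr.cost, he]
  have := size_le_self (s.nat a (g s))
  omega

theorem min (hf : NatComp d Q f) (hg : NatComp d Q g) :
    NatComp d Q (fun s => Min.min (f s) (g s)) := by
  have h := hf.sub (hf.sub hg)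
  have e : (fun s => Min.min (f s) (g s)) = fun s => f s - (f s - g s) := by
    funext s; omega
  rwa [e]

theorem max (hf : NatComp d Q f) (hg : NatComp d Q g) :
    NatComp d Q (fun s => Max.max (f s) (g s)) := by
  have h := hf.add (hg.sub hf)
  have e : (fun s => Max.max (f s) (g s)) = fun s => f s + (g s - f s) := by
    funext s; omega
  rwa [e]

end NatComp

/-- The context inside a loop with variable `d` and bound `b`. -/
def push (d : ℕ) (Q : State → Prop) (b : State → ℕ) : State → Prop :=
  fun s => Q s ∧ s.nat (d + 6) 0 < b s

theorem Stable.push {d : ℕ} {Q : State → Prop} {b : State → ℕ} (hQ : Stable d Q)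
    (hb : NatComp d Q b) : Stable (d + 1) (push d Q b) := by
  intro s s' h hs
  have h' := h.mono (Nat.le_succ d)
  refine ⟨hQ s s' h' hs.1, ?_⟩
  rw [← hb.dep s s' h', ← h.nat (d + 6) (by omega) (by omega) (by omega)]
  exact hs.2

theorem NatComp.weaken {d : ℕ} {Q : State → Prop} {g b : State → ℕ} (hg : NatComp d Q g) :
    NatComp (d + 1) (push d Q b) g := by
  obtain ⟨e, he, ce⟩ := hg.expr
  exact ⟨fun s s' h => hg.dep s s' (h.mono (Nat.le_succ d)), hg.bdd.restrict fun _ h => h.1, e, he,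
    ce.restrict fun _ h => h.1⟩

theorem NatComp.var {d : ℕ} {Q : State → Prop} {b : State → ℕ} (hb : NatComp d Q b) :
    NatComp (d + 1) (push d Q b) (fun s => s.nat (d + 6) 0) :=
  NatComp.load (d + 6) (by omega) (by omega) (by omega) (NatComp.lit _ _ 0)
    ((hb.weaken (b := b)).bdd.mono fun _ h => h.2.le)

/-- `f` is computed into register `r` in polynomial time, without changes to the lower registers
and to the first `d` loop variables. -/
structure Computes (d r : ℕ) (Q : State → Prop) (f : State → ℂ) : Prop where
  dep : ∀ s s', Agree d s s' → f s = f s'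
  prog : ∃ p : Prog, (∀ s, Q s → (p.exec s).num (r + 2) 0 = f s ∧
    (∀ a < d + 6, (p.exec s).nat a = s.nat a) ∧ ∀ a < r + 2, (p.exec s).num a = s.num a) ∧
    PolyBounded Q fun s => p.time s

theorem agree_of_frame {d r : ℕ} {s s' : State} (h1 : ∀ a < d + 6, s'.nat a = s.nat a)
    (h2 : ∀ a < r + 2, s'.num a = s.num a) : Agree d s s' :=
  ⟨fun a ha _ _ => (h1 a ha).symm, (h2 0 (by omega)).symm⟩

theorem writeNum_num_self (s : State) (a x : ℕ) (v : ℂ) : (s.writeNum a x v).num a x = v := by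
  simp [State.writeNum]

theorem writeNum_num_of_ne (s : State) {a b : ℕ} (h : b ≠ a) (x : ℕ) (v : ℂ) :
    (s.writeNum a x v).num b = s.num b := by
  simp [State.writeNum, h]

namespace Computes

variable {d r : ℕ} {Q : State → Prop} {f g : State → ℂ}

theorem congr (hf : Computes d r Q f) (h : ∀ s, f s = g s) : Computes d r Q g := by
  rwa [← funext h]

theorem of_expr (e : NumExpr) (he : ∀ s, e.eval s = f s)
    (hdep : ∀ s s', Agree d s s' → f s = f s') (hc : PolyBounded Q fun s => e.cost s) :
    Computes d r Q f := by
  refine ⟨hdep, .setNum (r + 2) (.lit 0) e, fun s _ => ⟨?_, fun _ _ => rfl, fun a ha => ?_⟩, ?_⟩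
  · simp only [Prog.exec, NatExpr.eval, writeNum_num_self, he]
  · exact writeNum_num_of_ne _ (by omega) _ _
  · exact ((hc.add (.const Q 1)).add (.const Q 1)).mono fun s _ => by
      simp only [Prog.time, NatExpr.cost, Nat.size_zero]; omega

theorem ofNat {n : State → ℕ} (hn : NatComp d Q n) : Computes d r Q (fun s => (n s : ℂ)) := by
  obtain ⟨e, he, ce⟩ := hn.expr
  exact of_expr (.ofNat e) (fun s => by rw [NumExpr.eval, he])
    (fun s s' h => by rw [hn.dep s s' h]) (ce.add (.const Q 1))

theorem imagUnit : Computes d r Q (fun _ => Complex.I) :=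
  of_expr .imagUnit (fun _ => rfl) (fun _ _ _ => rfl) (.const Q 1)

theorem input {n : State → ℕ} (hn : NatComp d Q n) : Computes d r Q (fun s => s.num 0 (n s)) := by
  obtain ⟨e, he, ce⟩ := hn.expr
  exact of_expr (.load 0 e) (fun s => by rw [NumExpr.eval, he])
    (fun s s' h => by rw [hn.dep s s' h, h.num]) (ce.add (.const Q 1))

/-- Stack discipline: the second operand goes to register `r + 1`, which leaves the first one in
register `r` intact. -/
theorem binary (op : NumExpr → NumExpr → NumExpr) (φ : ℂ → ℂ → ℂ)
    (heval : ∀ a b s, (op a b).eval s = φ (a.eval s) (b.eval s))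
    (hcost : ∀ a b s, (op a b).cost s = a.cost s + b.cost s + 1)
    (hQ : Stable d Q) (hf : Computes d r Q f) (hg : Computes d (r + 1) Q g) :
    Computes d r Q (fun s => φ (f s) (g s)) := by
  obtain ⟨p, hp, c, tp⟩ := hf.prog
  obtain ⟨p', hp', c', tp'⟩ := hg.prog
  refine ⟨fun s s' h => by rw [hf.dep s s' h, hg.dep s s' h],
    .seq p (.seq p' (.setNum (r + 2) (.lit 0)
      (op (.load (r + 2) (.lit 0)) (.load (r + 3) (.lit 0))))), fun s hs => ?_, ?_⟩
  · obtain ⟨h1, h2, h3⟩ := hp s hs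
    have hag := agree_of_frame h2 h3
    obtain ⟨h1', h2', h3'⟩ := hp' _ (hQ _ _ hag hs)
    simp only [Prog.exec, NatExpr.eval, heval, NumExpr.eval, writeNum_num_self]
    refine ⟨?_, fun a ha => ?_, fun a ha => ?_⟩
    · rw [h1', h3' (r + 2) (by omega), h1, ← hg.dep _ _ hag]
    · exact (h2' a ha).trans (h2 a ha)
    · rw [writeNum_num_of_ne _ (by omega), h3' a (by omega), h3 a ha]
  · refine (((PolyBounded.of_pow Q c).add (.of_pow Q c')).add (.const Q 7)).mono fun s hs => ?_
    obtain ⟨h1, h2, h3⟩ := hp s hs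
    have hag := agree_of_frame h2 h3
    have t1 := tp s hs
    have t2 := tp' _ (hQ _ _ hag hs)
    rw [← hag.inputSize_eq] at t2
    beta_reduce at t1 t2
    simp only [Prog.time, NatExpr.cost, hcost, NumExpr.cost, Nat.size_zero]
    omega

theorem sub (hQ : Stable d Q) (hf : Computes d r Q f) (hg : Computes d (r + 1) Q g) :
    Computes d r Q (fun s => f s - g s) :=
  binary .sub (· - ·) (fun _ _ _ => rfl) (fun _ _ _ => rfl) hQ hf hg

theorem mul (hQ : Stable d Q) (hf : Computes d r Q f) (hg : Computes d (r + 1) Q g) :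
    Computes d r Q (fun s => f s * g s) :=
  binary .mul (· * ·) (fun _ _ _ => rfl) (fun _ _ _ => rfl) hQ hf hg

theorem div (hQ : Stable d Q) (hf : Computes d r Q f) (hg : Computes d (r + 1) Q g) :
    Computes d r Q (fun s => f s / g s) :=
  binary .div (· / ·) (fun _ _ _ => rfl) (fun _ _ _ => rfl) hQ hf hg

theorem sqrt {x : State → ℝ} (hx : Computes d r Q (fun s => (x s : ℂ))) :
    Computes d r Q (fun s => ((Real.sqrt (x s) : ℝ) : ℂ)) := by
  obtain ⟨p, hp, tp⟩ := hx.prog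
  refine ⟨fun s s' h => by rw [Complex.ofReal_injective (hx.dep s s' h)],
    .seq p (.setNum (r + 2) (.lit 0) (.sqrt (.load (r + 2) (.lit 0)))), fun s hs => ?_, ?_⟩
  · obtain ⟨h1, h2, h3⟩ := hp s hs
    simp only [Prog.exec, NatExpr.eval, NumExpr.eval, writeNum_num_self]
    refine ⟨by rw [h1, Complex.ofReal_re], fun a ha => h2 a ha, fun a ha => ?_⟩
    rw [writeNum_num_of_ne _ (by omega), h3 a ha]
  · refine (tp.add (.const Q 5)).mono fun s hs => ?_
    simp only [Prog.time, NatExpr.cost, NumExpr.cost, Nat.size_zero]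
    omega

/-- Register `r` holds the accumulator of a fold, and each round computes its term into register `r
+ 1`. By `hdep` a term does not depend on what earlier rounds changed, so it can be referred back to
the initial state. -/
theorem loop (op : NumExpr → NumExpr → NumExpr) (φ : ℂ → ℂ → ℂ)
    (heval : ∀ a b s, (op a b).eval s = φ (a.eval s) (b.eval s))
    (hcost : ∀ a b s, (op a b).cost s = a.cost s + b.cost s + 1) (z : ℕ)
    {b : State → ℕ} {F : State → ℕ → ℂ} (hQ : Stable d Q) (hb : NatComp d Q b)
    (hdep : ∀ i s s', Agree d s s' → F s i = F s' i)
    (hF : Computes (d + 1) (r + 1) (push d Q b) (fun s => F s (s.nat (d + 6) 0))) :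
    Computes d r Q
      (fun s => Nat.rec (motive := fun _ => ℂ) (z : ℂ) (fun i acc => φ acc (F s i)) (b s)) := by
  obtain ⟨e, he, ce, te⟩ := hb.expr
  obtain ⟨p, hp, c, tp⟩ := hF.prog
  set body : Prog := .seq p (.setNum (r + 2) (.lit 0)
      (op (.load (r + 2) (.lit 0)) (.load (r + 3) (.lit 0)))) with hbody
  set init : Prog := .setNum (r + 2) (.lit 0) (.ofNat (.lit z)) with hinit
  have hround : ∀ (s σ : State) (i : ℕ), Q s → i < b s → (∀ a < d + 6, σ.nat a = s.nat a) →
      (∀ a < r + 2, σ.num a = s.num a) → Agree d s (σ.writeNat (d + 6) 0 i) ∧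
        push d Q b (σ.writeNat (d + 6) 0 i) := by
    intro s σ i hs hi h2 h3
    have hag : Agree d s (σ.writeNat (d + 6) 0 i) := by
      refine agree_of_frame (r := r) (fun a ha => ?_) h3
      rw [← h2 a ha]
      simp only [State.writeNat]
      rw [Function.update_of_ne (by omega)]
    refine ⟨hag, hQ _ _ hag hs, ?_⟩
    rw [← hb.dep _ _ hag]
    simpa [State.writeNat] using hi
  have hinv : ∀ s, Q s → ∀ i ≤ b s,
      (iterate (d + 6) body.exec (init.exec s) i).num (r + 2) 0 =
        Nat.rec (motive := fun _ => ℂ) (z : ℂ) (fun i acc => φ acc (F s i)) i ∧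
      (∀ a < d + 6, (iterate (d + 6) body.exec (init.exec s) i).nat a = s.nat a) ∧
      ∀ a < r + 2, (iterate (d + 6) body.exec (init.exec s) i).num a = s.num a := by
    intro s hs i
    induction i with
    | zero =>
      intro _
      simp only [iterate, hinit, Prog.exec, NatExpr.eval, NumExpr.eval, writeNum_num_self]
      exact ⟨rfl, fun a ha => rfl, fun a ha => writeNum_num_of_ne _ (by omega) _ _⟩
    | succ i ih =>
      intro hi
      obtain ⟨h1, h2, h3⟩ := ih (by omega)
      set σ := iterate (d + 6) body.exec (init.exec s) i with hσ
      obtain ⟨hag, hpush⟩ := hround s σ i hs (by omega) h2 h3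
      have hvar : (σ.writeNat (d + 6) 0 i).nat (d + 6) 0 = i := by simp [State.writeNat]
      obtain ⟨h1', h2', h3'⟩ := hp _ hpush
      have hstep : iterate (d + 6) body.exec (init.exec s) (i + 1) =
          body.exec (σ.writeNat (d + 6) 0 i) := rfl
      rw [hstep]
      simp only [hbody, Prog.exec, NatExpr.eval, heval, NumExpr.eval, writeNum_num_self]
      refine ⟨?_, fun a ha => ?_, fun a ha => ?_⟩
      · rw [h1', hvar, h3' (r + 2) (by omega), ← hdep i _ _ hag]
        exact congrArg (fun x => φ x (F s i)) h1
      · refine (h2' a (by omega)).trans ?_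
        rw [← h2 a ha]
        simp only [State.writeNat]
        rw [Function.update_of_ne (by omega)]
      · rw [writeNum_num_of_ne _ (by omega), h3' a (by omega)]
        exact h3 a ha
  have hinitag : ∀ s, Agree d s (init.exec s) := fun s =>
    agree_of_frame (r := r) (fun a _ => rfl) (fun a ha => writeNum_num_of_ne _ (by omega) _ _)
  have hbound : ∀ s, e.eval (init.exec s) = b s := fun s => by
    rw [he, hb.dep _ _ (hinitag s)]
  refine ⟨fun s s' h => ?_, .seq init (.forLoop (d + 6) e body), fun s hs => ?_, ?_⟩
  · rw [hb.dep s s' h]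
    have : F s = F s' := funext fun i => hdep i s s' h
    rw [this]
  · simp only [Prog.exec]
    rw [hbound]
    exact hinv s hs (b s) le_rfl
  · have hT := ((PolyBounded.const Q (z.size + 10)).add (.of_pow Q ce)).add
      (hb.bdd.mul (((PolyBounded.const Q 10).add hb.bdd).add (.of_pow Q c)))
    refine hT.mono fun s hs => ?_
    have t1 := te _ (hQ _ _ (hinitag s) hs)
    rw [← (hinitag s).inputSize_eq] at t1
    beta_reduce at t1
    have hsum : ∑ i ∈ range (b s), (1 + i.size +
        body.time ((iterate (d + 6) body.exec (init.exec s) i).writeNat (d + 6) 0 i)) ≤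
        b s * (10 + b s + c * inputSize s ^ c) := by
      have hle : ∀ i ∈ range (b s), (1 + i.size +
          body.time ((iterate (d + 6) body.exec (init.exec s) i).writeNat (d + 6) 0 i)) ≤
          10 + b s + c * inputSize s ^ c := by
        intro i hi
        have hi' := mem_range.1 hi
        obtain ⟨_, h2, h3⟩ := hinv s hs i hi'.le
        obtain ⟨hag, hpush⟩ := hround s _ i hs hi' h2 h3
        have t2 := tp _ hpush
        rw [← hag.inputSize_eq] at t2
        beta_reduce at t2
        have := size_le_self i
        generalize (iterate (d + 6) body.exec (init.exec s) i).writeNat (d + 6) 0 i = τ at t2 ⊢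
        simp only [hbody, Prog.time, NatExpr.cost, hcost, NumExpr.cost, Nat.size_zero]
        omega
      refine (sum_le_sum hle).trans ?_
      simp
    simp only [Prog.time]
    rw [hbound]
    have hi : (Prog.time init s) = 1 + 0 + (1 + z.size + 1) + 1 := by
      simp only [hinit, Prog.time, NatExpr.cost, NumExpr.cost, Nat.size_zero]
    omega

theorem sum {b : State → ℕ} {F : State → ℕ → ℂ} (hQ : Stable d Q) (hb : NatComp d Q b)
    (hdep : ∀ i s s', Agree d s s' → F s i = F s' i)
    (hF : Computes (d + 1) (r + 1) (push d Q b) (fun s => F s (s.nat (d + 6) 0))) :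
    Computes d r Q (fun s => ∑ i ∈ range (b s), F s i) := by
  refine (loop .add (· + ·) (fun _ _ _ => rfl) (fun _ _ _ => rfl) 0 hQ hb hdep hF).congr
    fun s => ?_
  induction b s with
  | zero => simp
  | succ n ih => rw [sum_range_succ, ← ih]

theorem prod {b : State → ℕ} {F : State → ℕ → ℂ} (hQ : Stable d Q) (hb : NatComp d Q b)
    (hdep : ∀ i s s', Agree d s s' → F s i = F s' i)
    (hF : Computes (d + 1) (r + 1) (push d Q b) (fun s => F s (s.nat (d + 6) 0))) :
    Computes d r Q (fun s => ∏ i ∈ range (b s), F s i) := by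
  refine (loop .mul (· * ·) (fun _ _ _ => rfl) (fun _ _ _ => rfl) 1 hQ hb hdep hF).congr
    fun s => ?_
  induction b s with
  | zero => simp
  | succ n ih => rw [prod_range_succ, ← ih]

theorem pow {z : ℂ} {n : State → ℕ} (hQ : Stable d Q) (hn : NatComp d Q n)
    (hz : ∀ {d r Q}, Stable d Q → Computes d r Q (fun _ => z)) :
    Computes d r Q (fun s => z ^ n s) := by
  refine (prod (F := fun _ _ => z) hQ hn (fun _ _ _ _ => rfl) (hz (hQ.push hn))).congr fun s => ?_
  simp

theorem descFactorial {n k : State → ℕ} (hQ : Stable d Q) (hn : NatComp d Q n)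
    (hk : NatComp d Q k) : Computes d r Q (fun s => ((n s).descFactorial (k s) : ℂ)) := by
  refine (prod (b := k) (F := fun s i => ((n s - i : ℕ) : ℂ)) hQ hk
    (fun i s s' h => by rw [hn.dep s s' h]) (ofNat (hn.weaken.sub hk.var))).congr fun s => ?_
  rw [Nat.descFactorial_eq_prod_range]
  push_cast
  rfl

theorem factorial {n : State → ℕ} (hQ : Stable d Q) (hn : NatComp d Q n) :
    Computes d r Q (fun s => ((n s).factorial : ℂ)) :=
  (descFactorial hQ hn hn).congr fun s => by rw [Nat.descFactorial_self]

/-- Truncated subtraction replaces branching: `(a - b) + (b - a)` is the distance, and `1` minus it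
is the indicator. -/
theorem indicator {a b : State → ℕ} (ha : NatComp d Q a) (hb : NatComp d Q b) :
    Computes d r Q (fun s => if a s = b s then 1 else 0) := by
  refine (ofNat ((NatComp.lit d Q 1).sub ((ha.sub hb).add (hb.sub ha)))).congr fun s => ?_
  split_ifs with h
  · simp [h]
  · have : 1 - (a s - b s + (b s - a s)) = 0 := by omega
    rw [this, Nat.cast_zero]

end Computes

end RealRAM

/-! ## Computation of the coefficients -/

namespace RealRAM

open Finset

namespace Computes

variable {d r : ℕ} {Q : State → Prop}

theorem one : Computes d r Q (fun _ => (1 : ℂ)) :=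
  (ofNat (NatComp.lit d Q 1)).congr fun _ => by simp

theorem negI (hQ : Stable d Q) : Computes d r Q (fun _ => -Complex.I) :=
  (sub hQ (ofNat (NatComp.lit d Q 0)) imagUnit).congr fun _ => by simp

theorem negOne (hQ : Stable d Q) : Computes d r Q (fun _ => (-1 : ℂ)) :=
  (sub hQ (ofNat (NatComp.lit d Q 0)) (ofNat (NatComp.lit d Q 1))).congr fun _ => by simp

theorem invSqrtTwo (hQ : Stable d Q) : Computes d r Q (fun _ => 1 / ((Real.sqrt 2 : ℝ) : ℂ)) :=
  div hQ one (sqrt (x := fun _ => 2) ((ofNat (NatComp.lit d Q 2)).congr fun _ => by simp))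

theorem powCoeff {l : ℂ} (hl : ∀ {d r Q}, Stable d Q → Computes d r Q (fun _ => l))
    {n b c : State → ℕ} (hQ : Stable d Q) (hn : NatComp d Q n) (hb : NatComp d Q b)
    (hc : NatComp d Q c) : Computes d r Q (fun s => powCoeff l (n s) (b s) (c s)) :=
  mul hQ (mul hQ
    (div hQ (descFactorial hQ hn (hb.add ((NatComp.lit d Q 2).mul hc)))
      (mul hQ (factorial hQ hb) (factorial hQ hc)))
    (pow hQ hb hl))
    (pow hQ hc fun hQ =>
      (div hQ (mul hQ (negI hQ) (hl hQ)) (ofNat (NatComp.lit _ _ 2))).congr fun _ => by simp)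

theorem swapCoeff {b a c : State → ℕ} (hQ : Stable d Q) (hb : NatComp d Q b) (ha : NatComp d Q a)
    (hc : NatComp d Q c) : Computes d r Q (fun s => swapCoeff (b s) (a s) (c s)) :=
  div hQ (mul hQ (mul hQ (pow hQ hc negI) (descFactorial hQ hb hc)) (descFactorial hQ ha hc))
    (factorial hQ hc)

theorem newtonCoeff {l n : State → ℕ} (hQ : Stable d Q) (hl : NatComp d Q l)
    (hn : NatComp d Q n) : Computes d r Q (fun s => (newtonCoeff (l s) (n s) : ℂ)) :=
  (div hQ (mul hQ (pow hQ (hn.add hl) negOne) (descFactorial hQ hn hl))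
    (mul hQ (factorial hQ hl) (factorial hQ hn))).congr fun s => by
      rw [_root_.newtonCoeff]
      push_cast
      rfl

/-- One loop for each of the five sums. The digit in a hypothesis name is the nesting level, and
`x`, `y`, `z`, `w`, `e` are the loop variables `b`, `b'`, `c`, `c'`, `d`. -/
theorem ladderCoeff {u v α β : State → ℕ} (hQ : Stable d Q) (hu : NatComp d Q u)
    (hv : NatComp d Q v) (hα : NatComp d Q α) (hβ : NatComp d Q β) :
    Computes d r Q (fun s => ladderCoeff (u s) (v s) (α s) (β s)) := by
  refine mul hQ (pow hQ (hu.add hv) invSqrtTwo) ?_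
  have b0 := hu.add (NatComp.lit d Q 1)
  have Q1 := hQ.push b0
  have u1 := hu.weaken (b := fun s => u s + 1)
  have v1 := hv.weaken (b := fun s => u s + 1)
  have α1 := hα.weaken (b := fun s => u s + 1)
  have β1 := hβ.weaken (b := fun s => u s + 1)
  have x1 := b0.var
  refine sum hQ b0 (fun i s s' h => by
    simp only [hu.dep s s' h, hv.dep s s' h, hα.dep s s' h, hβ.dep s s' h]) ?_
  have b1 := v1.add (NatComp.lit _ _ 1)
  have Q2 := Q1.push b1
  have u2 := u1.weaken (b := fun s => v s + 1)
  have v2 := v1.weaken (b := fun s => v s + 1)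
  have α2 := α1.weaken (b := fun s => v s + 1)
  have β2 := β1.weaken (b := fun s => v s + 1)
  have x2 := x1.weaken (b := fun s => v s + 1)
  have y2 := b1.var
  refine sum Q1 b1 (fun i s s' h => by
    simp only [u1.dep s s' h, v1.dep s s' h, α1.dep s s' h, β1.dep s s' h,
      h.nat (d + 6) (by omega) (by omega) (by omega)]) ?_
  have b2 := u2.add (NatComp.lit _ _ 1)
  have Q3 := Q2.push b2
  have u3 := u2.weaken (b := fun s => u s + 1)
  have v3 := v2.weaken (b := fun s => u s + 1)
  have α3 := α2.weaken (b := fun s => u s + 1)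
  have β3 := β2.weaken (b := fun s => u s + 1)
  have x3 := x2.weaken (b := fun s => u s + 1)
  have y3 := y2.weaken (b := fun s => u s + 1)
  have z3 := b2.var
  refine sum Q2 b2 (fun i s s' h => by
    simp only [u2.dep s s' h, v2.dep s s' h, α2.dep s s' h, β2.dep s s' h,
      h.nat (d + 6) (by omega) (by omega) (by omega),
      h.nat (d + 1 + 6) (by omega) (by omega) (by omega)]) ?_
  have b3 := v3.add (NatComp.lit _ _ 1)
  have Q4 := Q3.push b3
  have u4 := u3.weaken (b := fun s => v s + 1)
  have v4 := v3.weaken (b := fun s => v s + 1)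
  have α4 := α3.weaken (b := fun s => v s + 1)
  have β4 := β3.weaken (b := fun s => v s + 1)
  have x4 := x3.weaken (b := fun s => v s + 1)
  have y4 := y3.weaken (b := fun s => v s + 1)
  have z4 := z3.weaken (b := fun s => v s + 1)
  have w4 := b3.var
  refine sum Q3 b3 (fun i s s' h => by
    simp only [u3.dep s s' h, v3.dep s s' h, α3.dep s s' h, β3.dep s s' h,
      h.nat (d + 6) (by omega) (by omega) (by omega),
      h.nat (d + 1 + 6) (by omega) (by omega) (by omega),
      h.nat (d + 1 + 1 + 6) (by omega) (by omega) (by omega)]) ?_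
  have b4 := x4.add (NatComp.lit _ _ 1)
  have Q5 := Q4.push b4
  refine sum Q4 b4 (fun i s s' h => by
    simp only [u4.dep s s' h, v4.dep s s' h, α4.dep s s' h, β4.dep s s' h,
      h.nat (d + 6) (by omega) (by omega) (by omega),
      h.nat (d + 1 + 6) (by omega) (by omega) (by omega),
      h.nat (d + 1 + 1 + 6) (by omega) (by omega) (by omega),
      h.nat (d + 1 + 1 + 1 + 6) (by omega) (by omega) (by omega)]) ?_
  have u5 := u4.weaken (b := fun s => s.nat (d + 6) 0 + 1)
  have v5 := v4.weaken (b := fun s => s.nat (d + 6) 0 + 1)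
  have α5 := α4.weaken (b := fun s => s.nat (d + 6) 0 + 1)
  have β5 := β4.weaken (b := fun s => s.nat (d + 6) 0 + 1)
  have x5 := x4.weaken (b := fun s => s.nat (d + 6) 0 + 1)
  have y5 := y4.weaken (b := fun s => s.nat (d + 6) 0 + 1)
  have z5 := z4.weaken (b := fun s => s.nat (d + 6) 0 + 1)
  have w5 := w4.weaken (b := fun s => s.nat (d + 6) 0 + 1)
  have e5 := b4.var
  have a5 := v5.sub (y5.add ((NatComp.lit _ _ 2).mul w5))
  exact mul Q5 (mul Q5 (mul Q5 (powCoeff negI Q5 u5 x5 z5)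
    (powCoeff (fun _ => imagUnit) Q5 v5 y5 w5))
    (swapCoeff Q5 x5 a5 e5))
    (mul Q5 (indicator α5 ((u5.sub (x5.add ((NatComp.lit _ _ 2).mul z5))).add (a5.sub e5)))
      (indicator β5 ((x5.sub e5).add y5)))

theorem modeCoeff {N i j α β : State → ℕ} (hQ : Stable d Q) (hN : NatComp d Q N)
    (hi : NatComp d Q i) (hj : NatComp d Q j) (hα : NatComp d Q α) (hβ : NatComp d Q β) :
    Computes d r Q (fun s => modeCoeff (N s) (i s) (j s) (α s) (β s)) := by
  refine mul hQ (sqrt ?_) ?_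
  · exact (div hQ (factorial hQ (hi.min hj)) (factorial hQ (hi.max hj))).congr fun s => by
      push_cast; rfl
  have hb := hN.add (NatComp.lit d Q 1)
  refine sum hQ hb (fun n s s' h => by
    simp only [hi.dep s s' h, hj.dep s s' h, hα.dep s s' h, hβ.dep s s' h]) ?_
  have Q1 := hQ.push hb
  have i1 := hi.weaken (b := fun s => N s + 1)
  have j1 := hj.weaken (b := fun s => N s + 1)
  have m1 := i1.max j1
  exact mul Q1 (newtonCoeff Q1 (i1.min j1) hb.var)
    (ladderCoeff Q1 ((m1.sub j1).add hb.var) ((m1.sub i1).add hb.var) hα.weaken hβ.weaken)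

end Computes

end RealRAM

/-! ## The program -/

namespace RealRAM

open Finset

/-- There is a program that takes every state `s` with `Q s` to a state `s'` with `R s s'`, in
polynomial time. -/
def PolyProg (Q : State → Prop) (R : State → State → Prop) : Prop :=
  ∃ p : Prog, (∀ s, Q s → R s (p.exec s)) ∧ PolyBounded Q fun s => p.time s

namespace PolyProg

variable {Q Q' : State → Prop} {R R' : State → State → Prop}

theorem imp (h : PolyProg Q R) (hR : ∀ s s', Q s → R s s' → R' s s') : PolyProg Q R' :=
  Exists.imp (fun _ hp => ⟨fun s hs => hR _ _ hs (hp.1 s hs), hp.2⟩) h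

theorem seq (h : PolyProg Q R) (h' : PolyProg Q' R')
    (hQ : ∀ s s', Q s → R s s' → Q' s' ∧ inputSize s' = inputSize s) :
    PolyProg Q (fun s s'' => ∃ s', R s s' ∧ R' s' s'') := by
  obtain ⟨p, hp, c, tp⟩ := h
  obtain ⟨p', hp', c', tp'⟩ := h'
  refine ⟨.seq p p', fun s hs => ⟨p.exec s, hp s hs, hp' _ (hQ _ _ hs (hp s hs)).1⟩, ?_⟩
  refine ((PolyBounded.of_pow Q c).add (.of_pow Q c')).mono fun s hs => ?_
  obtain ⟨h1, h2⟩ := hQ _ _ hs (hp s hs)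
  have t1 := tp s hs
  have t2 := tp' _ h1
  rw [h2] at t2
  exact add_le_add t1 t2

theorem setNat {d : ℕ} {g h : State → ℕ} (a : ℕ) (hg : NatComp d Q g) (hh : NatComp d Q h) :
    PolyProg Q (fun s s' => s' = s.writeNat a (g s) (h s)) := by
  obtain ⟨e, he, ce⟩ := hg.expr
  obtain ⟨e', he', ce'⟩ := hh.expr
  refine ⟨.setNat a e e', fun s _ => by rw [Prog.exec, he, he'], ?_⟩
  exact ((ce.add ce').add (.const Q 1)).mono fun s _ => le_rfl

theorem copyRegister {d : ℕ} {g : State → ℕ} (a r : ℕ) (hg : NatComp d Q g) :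
    PolyProg Q (fun s s' => s' = s.writeNum a (g s) (s.num (r + 2) 0)) := by
  obtain ⟨e, he, ce⟩ := hg.expr
  refine ⟨.setNum a e (.load (r + 2) (.lit 0)), fun s _ => by
    rw [Prog.exec, he, NumExpr.eval, NatExpr.eval], ?_⟩
  refine (ce.add (.const Q 3)).mono fun s _ => ?_
  simp only [Prog.time, NumExpr.cost, NatExpr.cost, Nat.size_zero]
  omega

/-- The invariant compares the current state with the initial one. Constancy of the input size makes
the time bound of the body the same in all rounds. -/
theorem loop {d : ℕ} {b : State → ℕ} (v : ℕ) (hb : NatComp d Q b) (Inv : State → ℕ → State → Prop)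
    (hbody : PolyProg Q' R') (h0 : ∀ s, Q s → Inv s 0 s)
    (hstep : ∀ s i σ, Q s → i < b s → Inv s i σ → Q' (σ.writeNat v 0 i) ∧
      inputSize (σ.writeNat v 0 i) = inputSize s ∧
      ∀ σ', R' (σ.writeNat v 0 i) σ' → Inv s (i + 1) σ') :
    PolyProg Q (fun s s' => Inv s (b s) s') := by
  obtain ⟨e, he, ce⟩ := hb.expr
  obtain ⟨p, hp, c, tp⟩ := hbody
  have hinv : ∀ s, Q s → ∀ i ≤ b s, Inv s i (iterate v p.exec s i) := by
    intro s hs i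
    induction i with
    | zero => exact fun _ => h0 s hs
    | succ i ih =>
      intro hi
      obtain ⟨h1, _, h3⟩ := hstep s i _ hs (by omega) (ih (by omega))
      exact h3 _ (hp _ h1)
  refine ⟨.forLoop v e p, fun s hs => ?_, ?_⟩
  · rw [Prog.exec, he]
    exact hinv s hs _ le_rfl
  · refine ((ce.add (.const Q 1)).add
      (hb.bdd.mul (((PolyBounded.const Q 1).add hb.bdd).add (.of_pow Q c)))).mono fun s hs => ?_
    simp only [Prog.time]
    rw [he]
    refine Nat.add_le_add_left ?_ _
    have hle : ∀ i ∈ range (b s), (1 + i.size + p.time ((iterate v p.exec s i).writeNat v 0 i)) ≤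
        1 + b s + c * inputSize s ^ c := by
      intro i hi
      have hi' := mem_range.1 hi
      obtain ⟨h1, h2, _⟩ := hstep s i _ hs hi' (hinv s hs i hi'.le)
      have t := tp _ h1
      rw [h2] at t
      beta_reduce at t
      have := size_le_self i
      omega
    exact (sum_le_sum hle).trans (by simp)

end PolyProg

theorem writeNat_nat_self (s : State) (a x v : ℕ) : (s.writeNat a x v).nat a x = v := by
  simp [State.writeNat]

theorem writeNat_nat_of_ne (s : State) {a b : ℕ} (h : b ≠ a) (x v : ℕ) :
    (s.writeNat a x v).nat b = s.nat b := by
  simp [State.writeNat, h]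

theorem writeNat_nat_of_index_ne (s : State) (a : ℕ) {x y : ℕ} (h : y ≠ x) (v : ℕ) :
    (s.writeNat a x v).nat a y = s.nat a y := by
  simp [State.writeNat, h]

theorem writeNum_num_of_index_ne (s : State) (a : ℕ) {x y : ℕ} (h : y ≠ x) (v : ℂ) :
    (s.writeNum a x v).num a y = s.num a y := by
  simp [State.writeNum, h]

/-! ### Bounds for the quantities that occur -/

/-- The number of possible exponents of a variable. -/
def radix (m : ℕ) (N : ℕ → ℕ) (l : ℕ) : ℕ := 3 * N (l % m) + 1

theorem le_prod_succ (N : ℕ → ℕ) {k m : ℕ} (hk : k < m) : N k ≤ ∏ l ∈ range m, (N l + 1) := by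
  have := single_le_prod' (f := fun l => N l + 1) (fun l _ => Nat.succ_pos (N l)) (mem_range.2 hk)
  exact (Nat.le_succ _).trans this

theorem prod_succ_mono (R : ℕ → ℕ) (hR : ∀ l, 1 ≤ R l) {k m : ℕ} (hk : k ≤ m) :
    ∏ l ∈ range k, R l ≤ ∏ l ∈ range m, R l :=
  prod_le_prod_of_subset_of_one_le' (range_subset_range.2 hk) fun l _ _ => hR l

theorem one_le_radix (m : ℕ) (N : ℕ → ℕ) (l : ℕ) : 1 ≤ radix m N l := Nat.succ_pos _

theorem prod_radix (m : ℕ) (N : ℕ → ℕ) :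
    ∏ l ∈ range (m + m), radix m N l = (∏ l ∈ range m, (3 * N l + 1)) ^ 2 := by
  rw [prod_range_add, sq]
  congr 1
  · refine prod_congr rfl fun l hl => ?_
    rw [radix, Nat.mod_eq_of_lt (mem_range.1 hl)]
  · refine prod_congr rfl fun l hl => ?_
    rw [radix, Nat.add_mod_left, Nat.mod_eq_of_lt (mem_range.1 hl)]

/-- Since `3N + 1 ≤ (N + 1)^2`, the number of candidate monomials is polynomial in the input size,
however many modes there are. -/
theorem prod_radix_le (m : ℕ) (N : ℕ → ℕ) :
    ∏ l ∈ range (m + m), radix m N l ≤ (∏ l ∈ range m, (N l + 1)) ^ 4 := by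
  rw [prod_radix]
  have h : ∏ l ∈ range m, (3 * N l + 1) ≤ (∏ l ∈ range m, (N l + 1)) ^ 2 := by
    rw [← prod_pow]
    refine prod_le_prod' fun l _ => ?_
    rcases Nat.eq_zero_or_pos (N l) with h | h
    · simp [h]
    · nlinarith
  calc _ ≤ ((∏ l ∈ range m, (N l + 1)) ^ 2) ^ 2 := Nat.pow_le_pow_left h 2
    _ = _ := by ring

theorem polyBounded_modes (Q : State → Prop) : PolyBounded Q (fun s => s.nat 0 0) :=
  ⟨1, fun s _ => by simp [inputSize]⟩

theorem polyBounded_prod (Q : State → Prop) :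
    PolyBounded Q (fun s => ∏ l ∈ range (s.nat 0 0), (s.nat 1 l + 1)) :=
  ⟨1, fun s _ => by simp [inputSize]⟩

theorem polyBounded_prod_radix (Q : State → Prop) :
    PolyBounded Q (fun s => ∏ l ∈ range (s.nat 0 0 + s.nat 0 0),
      radix (s.nat 0 0) (s.nat 1) l) := by
  have h := polyBounded_prod Q
  refine (h.mul (h.mul (h.mul h))).mono fun s _ => (prod_radix_le _ _).trans_eq ?_
  ring

namespace NatComp

variable {d : ℕ} {Q : State → Prop} {g : State → ℕ}

theorem modes (d : ℕ) (Q : State → Prop) : NatComp d Q (fun s => s.nat 0 0) :=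
  load 0 (by omega) (by omega) (by omega) (lit d Q 0) (polyBounded_modes Q)

theorem cutoff (hg : NatComp d Q g) (h : ∀ s, Q s → g s < s.nat 0 0) :
    NatComp d Q (fun s => s.nat 1 (g s)) :=
  load 1 (by omega) (by omega) (by omega) hg
    ((polyBounded_prod Q).mono fun s hs => le_prod_succ _ (h s hs))

theorem prefixProd (hg : NatComp d Q g)
    (h : ∀ s, Q s → g s ≤ s.nat 0 0 ∧ s.nat 4 (g s) = ∏ l ∈ range (g s), (s.nat 1 l + 1)) :
    NatComp d Q (fun s => s.nat 4 (g s)) :=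
  load 4 (by omega) (by omega) (by omega) hg
    ((polyBounded_prod Q).mono fun s hs => by
      rw [(h s hs).2]
      exact prod_succ_mono _ (fun _ => Nat.succ_pos _) (h s hs).1)

theorem prefixRadix (hg : NatComp d Q g)
    (h : ∀ s, Q s → g s ≤ s.nat 0 0 + s.nat 0 0 ∧
      s.nat 5 (g s) = ∏ l ∈ range (g s), radix (s.nat 0 0) (s.nat 1) l) :
    NatComp d Q (fun s => s.nat 5 (g s)) :=
  load 5 (by omega) (by omega) (by omega) hg
    ((polyBounded_prod_radix Q).mono fun s hs => by
      rw [(h s hs).2]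
      exact prod_succ_mono _ (one_le_radix _ _) (h s hs).1)

/-- At least one mode is required: reduction modulo `0` would be the identity and could address a
cell outside the list of cutoffs. -/
theorem radix (hg : NatComp d Q g) (hm : ∀ s, Q s → 1 ≤ s.nat 0 0) :
    NatComp d Q (fun s => radix (s.nat 0 0) (s.nat 1) (g s)) :=
  ((lit d Q 3).mul (cutoff (hg.mod (modes d Q)) fun s hs => Nat.mod_lt _ (hm s hs))).add
    (lit d Q 1)

end NatComp

/-! ### The tables of prefix products -/

/-- The state `s'` has the input of `s`. -/
structure SameInput (s s' : State) : Prop where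
  modes : s'.nat 0 = s.nat 0
  cutoffs : s'.nat 1 = s.nat 1
  entries : s'.num 0 = s.num 0

theorem SameInput.inputSize_eq {s s' : State} (h : SameInput s s') :
    inputSize s' = inputSize s := by
  rw [inputSize, inputSize, h.modes, h.cutoffs]

/-- The tables of prefix products are filled. -/
structure Ready (s : State) : Prop where
  pos : 1 ≤ s.nat 0 0
  prefixProd : ∀ k ≤ s.nat 0 0, s.nat 4 k = ∏ l ∈ range k, (s.nat 1 l + 1)
  prefixRadix : ∀ k ≤ s.nat 0 0 + s.nat 0 0,
    s.nat 5 k = ∏ l ∈ range k, radix (s.nat 0 0) (s.nat 1) l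

theorem stable_ready : Stable 0 Ready := by
  intro s s' h hs
  have h0 := h.nat 0 (by omega) (by omega) (by omega)
  have h1 := h.nat 1 (by omega) (by omega) (by omega)
  have h4 := h.nat 4 (by omega) (by omega) (by omega)
  have h5 := h.nat 5 (by omega) (by omega) (by omega)
  refine ⟨?_, ?_, ?_⟩
  · rw [← h0]; exact hs.pos
  · rw [← h0, ← h1, ← h4]; exact hs.prefixProd
  · rw [← h0, ← h1, ← h5]; exact hs.prefixRadix

/-- Round `i` reads entry `i` and writes entry `i + 1`. The invariant supplies both the value of the
cell that is read and the size bound needed to charge for reading it. -/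
theorem polyProg_prefixProd : PolyProg (fun s => 1 ≤ s.nat 0 0) (fun s s' => SameInput s s' ∧
    ∀ k ≤ s.nat 0 0, s'.nat 4 k = ∏ l ∈ range k, (s.nat 1 l + 1)) := by
  set Q' : State → Prop := fun s => s.nat 6 0 < s.nat 0 0 ∧
    s.nat 4 (s.nat 6 0) = ∏ l ∈ range (s.nat 6 0), (s.nat 1 l + 1) with hQ'
  have hv : NatComp 1 Q' (fun s => s.nat 6 0) :=
    NatComp.load 6 (by omega) (by omega) (by omega) (NatComp.lit 1 Q' 0)
      ((polyBounded_modes Q').mono fun s hs => hs.1.le)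
  have hbody := PolyProg.setNat 4 (hv.add (NatComp.lit 1 Q' 1))
    ((NatComp.prefixProd hv fun s hs => ⟨hs.1.le, hs.2⟩).mul
      ((NatComp.cutoff hv fun s hs => hs.1).add (NatComp.lit 1 Q' 1)))
  have hinit := PolyProg.setNat (Q := fun s => 1 ≤ s.nat 0 0) 4 (NatComp.lit 0 _ 0)
    (NatComp.lit 0 _ 1)
  have hloop := PolyProg.loop (Q := fun s => 1 ≤ s.nat 0 0 ∧ s.nat 4 0 = 1) 6
    (NatComp.modes 0 _)
    (fun s i σ => SameInput s σ ∧ ∀ k ≤ i, σ.nat 4 k = ∏ l ∈ range k, (s.nat 1 l + 1))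
    hbody (fun s hs => ⟨⟨rfl, rfl, rfl⟩, fun k hk => by
      obtain rfl : k = 0 := by omega
      simpa using hs.2⟩) (by
    rintro s i σ hs hi ⟨hσ, h4⟩
    have hσ' : SameInput s (σ.writeNat 6 0 i) :=
      ⟨hσ.modes, hσ.cutoffs, hσ.entries⟩
    refine ⟨⟨?_, ?_⟩, hσ'.inputSize_eq, ?_⟩
    · rw [writeNat_nat_self, hσ'.modes]; exact hi
    · rw [writeNat_nat_self, hσ'.cutoffs, writeNat_nat_of_ne _ (by omega)]
      exact h4 i le_rfl
    · rintro _ rfl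
      refine ⟨⟨hσ.modes, hσ.cutoffs, hσ.entries⟩, fun k hk => ?_⟩
      rw [writeNat_nat_self, hσ'.cutoffs]
      rcases Nat.lt_or_ge k (i + 1) with hlt | hge
      · rw [writeNat_nat_of_index_ne _ _ (by omega), writeNat_nat_of_ne _ (by omega)]
        exact h4 k (by omega)
      · obtain rfl : k = i + 1 := by omega
        rw [writeNat_nat_self, writeNat_nat_of_ne _ (by omega), h4 i le_rfl, prod_range_succ])
  refine (hinit.seq hloop ?_).imp ?_
  · rintro s _ hs rfl
    exact ⟨⟨hs, writeNat_nat_self _ _ _ _⟩, rfl⟩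
  · rintro s s' hs ⟨_, rfl, h, h'⟩
    exact ⟨⟨h.modes, h.cutoffs, h.entries⟩, h'⟩

theorem polyProg_prefixRadix : PolyProg (fun s => 1 ≤ s.nat 0 0)
    (fun s s' => (SameInput s s' ∧ s'.nat 4 = s.nat 4) ∧
      ∀ k ≤ s.nat 0 0 + s.nat 0 0, s'.nat 5 k =
        ∏ l ∈ range k, radix (s.nat 0 0) (s.nat 1) l) := by
  set Q' : State → Prop := fun s => 1 ≤ s.nat 0 0 ∧ s.nat 6 0 < s.nat 0 0 + s.nat 0 0 ∧
    s.nat 5 (s.nat 6 0) = ∏ l ∈ range (s.nat 6 0), radix (s.nat 0 0) (s.nat 1) l with hQ'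
  have hv : NatComp 1 Q' (fun s => s.nat 6 0) :=
    NatComp.load 6 (by omega) (by omega) (by omega) (NatComp.lit 1 Q' 0)
      (((polyBounded_modes Q').add (polyBounded_modes Q')).mono fun s hs => hs.2.1.le)
  have hbody := PolyProg.setNat 5 (hv.add (NatComp.lit 1 Q' 1))
    ((NatComp.prefixRadix hv fun s hs => ⟨hs.2.1.le, hs.2.2⟩).mul
      (NatComp.radix hv fun s hs => hs.1))
  have hinit := PolyProg.setNat (Q := fun s => 1 ≤ s.nat 0 0) 5 (NatComp.lit 0 _ 0)
    (NatComp.lit 0 _ 1)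
  have hloop := PolyProg.loop (Q := fun s => 1 ≤ s.nat 0 0 ∧ s.nat 5 0 = 1) 6
    ((NatComp.modes 0 _).add (NatComp.modes 0 _))
    (fun s i σ => (SameInput s σ ∧ σ.nat 4 = s.nat 4) ∧
      ∀ k ≤ i, σ.nat 5 k = ∏ l ∈ range k, radix (s.nat 0 0) (s.nat 1) l)
    hbody (fun s hs => ⟨⟨⟨rfl, rfl, rfl⟩, rfl⟩, fun k hk => by
      obtain rfl : k = 0 := by omega
      simpa using hs.2⟩) (by
    rintro s i σ hs hi ⟨⟨hσ, h4⟩, h5⟩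
    have hσ' : SameInput s (σ.writeNat 6 0 i) :=
      ⟨hσ.modes, hσ.cutoffs, hσ.entries⟩
    refine ⟨⟨?_, ?_, ?_⟩, hσ'.inputSize_eq, ?_⟩
    · rw [hσ'.modes]; exact hs.1
    · rw [writeNat_nat_self, hσ'.modes]; exact hi
    · rw [writeNat_nat_self, hσ'.cutoffs, hσ'.modes, writeNat_nat_of_ne _ (by omega)]
      exact h5 i le_rfl
    · rintro _ rfl
      refine ⟨⟨⟨hσ.modes, hσ.cutoffs, hσ.entries⟩, h4⟩, fun k hk => ?_⟩
      rw [writeNat_nat_self, hσ'.cutoffs, hσ'.modes]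
      rcases Nat.lt_or_ge k (i + 1) with hlt | hge
      · rw [writeNat_nat_of_index_ne _ _ (by omega), writeNat_nat_of_ne _ (by omega)]
        exact h5 k (by omega)
      · obtain rfl : k = i + 1 := by omega
        rw [writeNat_nat_self, writeNat_nat_of_ne _ (by omega), h5 i le_rfl, prod_range_succ])
  refine (hinit.seq hloop ?_).imp ?_
  · rintro s _ hs rfl
    exact ⟨⟨hs, writeNat_nat_self _ _ _ _⟩, rfl⟩
  · rintro s s' hs ⟨_, rfl, ⟨h, h4⟩, h'⟩
    exact ⟨⟨⟨h.modes, h.cutoffs, h.entries⟩, h4⟩, h'⟩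

theorem polyProg_ready : PolyProg (fun s => 1 ≤ s.nat 0 0)
    (fun s s' => SameInput s s' ∧ Ready s') := by
  refine (polyProg_prefixProd.seq polyProg_prefixRadix ?_).imp ?_
  · rintro s s' hs ⟨h, _⟩
    exact ⟨by rw [h.modes]; exact hs, h.inputSize_eq⟩
  · rintro s s'' hs ⟨s', ⟨h, h4⟩, ⟨h', h4'⟩, h5⟩
    have e0 : s''.nat 0 = s.nat 0 := h'.modes.trans h.modes
    have e1 : s''.nat 1 = s.nat 1 := h'.cutoffs.trans h.cutoffs
    refine ⟨⟨e0, e1, h'.entries.trans h.entries⟩, ?_, ?_, ?_⟩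
    · rw [e0]; exact hs
    · rw [e0, e1, h4']; exact h4
    · rw [h'.modes, h'.cutoffs]; exact h5

end RealRAM

/-! ### The coefficients and exponents -/

namespace RealRAM

open Finset

/-- The `k`-th digit of `t` in the mixed radix expansion with radices `R`. -/
def digit (R : ℕ → ℕ) (t k : ℕ) : ℕ := t / (∏ l ∈ range k, R l) % R k

/-- The coefficient of the `t`-th monomial, where `h` lists the entries of the matrix. -/
noncomputable def coeffAt (m : ℕ) (N : ℕ → ℕ) (h : ℕ → ℂ) (t : ℕ) : ℂ :=
  ∑ I ∈ range (∏ l ∈ range m, (N l + 1)), ∑ J ∈ range (∏ l ∈ range m, (N l + 1)),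
    h (I * (∏ l ∈ range m, (N l + 1)) + J) * ∏ k ∈ range m, modeCoeff (N k)
      (digit (fun l => N l + 1) I k) (digit (fun l => N l + 1) J k)
      (digit (radix m N) t k) (digit (radix m N) t (m + k))

/-- The coefficient of the `t`-th monomial in terms of the tables. -/
noncomputable def tableCoeff (s : State) (t : ℕ) : ℂ :=
  ∑ I ∈ range (s.nat 4 (s.nat 0 0)), ∑ J ∈ range (s.nat 4 (s.nat 0 0)),
    s.num 0 (I * s.nat 4 (s.nat 0 0) + J) * ∏ k ∈ range (s.nat 0 0), modeCoeff (s.nat 1 k)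
      (I / s.nat 4 k % (s.nat 1 k + 1)) (J / s.nat 4 k % (s.nat 1 k + 1))
      (t / s.nat 5 k % (3 * s.nat 1 k + 1)) (t / s.nat 5 (s.nat 0 0 + k) % (3 * s.nat 1 k + 1))

theorem tableCoeff_eq {s : State} (hs : Ready s) (t : ℕ) :
    tableCoeff s t = coeffAt (s.nat 0 0) (s.nat 1) (s.num 0) t := by
  rw [tableCoeff, coeffAt, hs.prefixProd _ le_rfl]
  refine sum_congr rfl fun I _ => sum_congr rfl fun J _ => congrArg _ (prod_congr rfl fun k hk => ?_)
  have hk' := mem_range.1 hk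
  simp only [digit]
  rw [hs.prefixProd k hk'.le, hs.prefixRadix k (by omega), hs.prefixRadix _ (by omega)]
  simp only [radix, Nat.add_mod_left, Nat.mod_eq_of_lt hk']

theorem Agree.tableCoeff_eq {d : ℕ} {s s' : State} (h : Agree d s s') (t : ℕ) :
    tableCoeff s t = tableCoeff s' t := by
  simp only [tableCoeff, h.nat 0 (by omega) (by omega) (by omega),
    h.nat 1 (by omega) (by omega) (by omega), h.nat 4 (by omega) (by omega) (by omega),
    h.nat 5 (by omega) (by omega) (by omega), h.num]

/-- The number of monomials. -/
def monomialCount (s : State) : ℕ := s.nat 5 (s.nat 0 0 + s.nat 0 0)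

theorem natComp_monomialCount {d : ℕ} {Q : State → Prop} (hQ : ∀ s, Q s → Ready s) :
    NatComp d Q monomialCount :=
  NatComp.prefixRadix ((NatComp.modes d Q).add (NatComp.modes d Q))
    fun s hs => ⟨le_rfl, (hQ s hs).prefixRadix _ le_rfl⟩

/-- The level starts at `1` because array `6` holds the index of the monomial; arrays `7`, `8`, `9`
are then the loop variables for `I`, `J` and `k`. -/
theorem computes_tableCoeff :
    Computes 1 0 (push 0 Ready monomialCount) (fun s => tableCoeff s (s.nat 6 0)) := by
  have Q1 := stable_ready.push (natComp_monomialCount fun _ hs => hs)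
  have bI : NatComp 1 (push 0 Ready monomialCount) (fun s => s.nat 4 (s.nat 0 0)) :=
    NatComp.prefixProd (NatComp.modes _ _) fun s hs => ⟨le_rfl, hs.1.prefixProd _ le_rfl⟩
  have t1 : NatComp 1 (push 0 Ready monomialCount) (fun s => s.nat 6 0) :=
    (natComp_monomialCount fun _ hs => hs).var
  refine Computes.sum Q1 bI (fun I s s' h => by
    simp only [h.nat 0 (by omega) (by omega) (by omega),
      h.nat 1 (by omega) (by omega) (by omega), h.nat 4 (by omega) (by omega) (by omega),
      h.nat 5 (by omega) (by omega) (by omega), h.nat 6 (by omega) (by omega) (by omega),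
      h.num]) ?_
  have Q2 := Q1.push bI
  have bJ := bI.weaken (b := fun s => s.nat 4 (s.nat 0 0))
  have t2 := t1.weaken (b := fun s => s.nat 4 (s.nat 0 0))
  have I2 := bI.var
  refine Computes.sum Q2 bJ (fun J s s' h => by
    simp only [h.nat 0 (by omega) (by omega) (by omega),
      h.nat 1 (by omega) (by omega) (by omega), h.nat 4 (by omega) (by omega) (by omega),
      h.nat 5 (by omega) (by omega) (by omega), h.nat 6 (by omega) (by omega) (by omega),
      h.nat (1 + 6) (by omega) (by omega) (by omega), h.num]) ?_
  have Q3 := Q2.push bJ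
  have D3 := bJ.weaken (b := fun s => s.nat 4 (s.nat 0 0))
  have t3 := t2.weaken (b := fun s => s.nat 4 (s.nat 0 0))
  have I3 := I2.weaken (b := fun s => s.nat 4 (s.nat 0 0))
  have J3 := bJ.var
  refine Computes.mul Q3 (Computes.input ((I3.mul D3).add J3)) ?_
  have bk := NatComp.modes (1 + 1 + 1) (push (1 + 1) (push 1 (push 0 Ready monomialCount)
    fun s => s.nat 4 (s.nat 0 0)) fun s => s.nat 4 (s.nat 0 0))
  refine Computes.prod Q3 bk (fun k s s' h => by
    simp only [h.nat 0 (by omega) (by omega) (by omega),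
      h.nat 1 (by omega) (by omega) (by omega), h.nat 4 (by omega) (by omega) (by omega),
      h.nat 5 (by omega) (by omega) (by omega), h.nat 6 (by omega) (by omega) (by omega),
      h.nat (1 + 6) (by omega) (by omega) (by omega),
      h.nat (1 + 1 + 6) (by omega) (by omega) (by omega)]) ?_
  have Q4 := Q3.push bk
  have t4 := t3.weaken (b := fun s => s.nat 0 0)
  have I4 := I3.weaken (b := fun s => s.nat 0 0)
  have J4 := J3.weaken (b := fun s => s.nat 0 0)
  have k4 := bk.var
  have N4 := k4.cutoff fun s hs => hs.2
  have A4 := k4.prefixProd fun s hs => ⟨hs.2.le, hs.1.1.1.1.prefixProd _ hs.2.le⟩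
  have hB : ∀ s, push (1 + 1 + 1) (push (1 + 1) (push 1 (push 0 Ready monomialCount)
      fun s => s.nat 4 (s.nat 0 0)) fun s => s.nat 4 (s.nat 0 0)) (fun s => s.nat 0 0) s →
      s.nat (1 + 1 + 1 + 6) 0 ≤ s.nat 0 0 + s.nat 0 0 ∧
      s.nat 0 0 + s.nat (1 + 1 + 1 + 6) 0 ≤ s.nat 0 0 + s.nat 0 0 := by
    intro s hs
    have : s.nat (1 + 1 + 1 + 6) 0 < s.nat 0 0 := hs.2
    omega
  have B4 := k4.prefixRadix fun s hs => ⟨(hB s hs).1, hs.1.1.1.1.prefixRadix _ (hB s hs).1⟩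
  have B4' := ((NatComp.modes _ _).add k4).prefixRadix
    fun s hs => ⟨(hB s hs).2, hs.1.1.1.1.prefixRadix _ (hB s hs).2⟩
  have one := NatComp.lit (1 + 1 + 1 + 1) (push (1 + 1 + 1) (push (1 + 1) (push 1
    (push 0 Ready monomialCount) fun s => s.nat 4 (s.nat 0 0)) fun s => s.nat 4 (s.nat 0 0))
    fun s => s.nat 0 0) 1
  have R4 := ((NatComp.lit _ _ 3).mul N4).add one
  exact Computes.modeCoeff Q4 N4 ((I4.div A4).mod (N4.add one)) ((J4.div A4).mod (N4.add one))
    ((t4.div B4).mod R4) ((t4.div B4').mod R4)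

/-- The program for the exponents of one monomial. -/
theorem polyProg_exponents : PolyProg (push 0 Ready monomialCount) (fun s s' =>
    (∀ a < 7, a ≠ 3 → s'.nat a = s.nat a) ∧ s'.num = s.num ∧
      (∀ l < s.nat 0 0 + s.nat 0 0, s'.nat 3 (s.nat 6 0 * (s.nat 0 0 + s.nat 0 0) + l) =
        digit (radix (s.nat 0 0) (s.nat 1)) (s.nat 6 0) l) ∧
      ∀ x < s.nat 6 0 * (s.nat 0 0 + s.nat 0 0), s'.nat 3 x = s.nat 3 x) := by
  have t1 : NatComp 1 (push 0 Ready monomialCount) (fun s => s.nat 6 0) :=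
    (natComp_monomialCount fun _ hs => hs).var
  have hb : NatComp 1 (push 0 Ready monomialCount) (fun s => s.nat 0 0 + s.nat 0 0) :=
    (NatComp.modes _ _).add (NatComp.modes _ _)
  have t2 := t1.weaken (b := fun s => s.nat 0 0 + s.nat 0 0)
  have w2 := hb.weaken (b := fun s => s.nat 0 0 + s.nat 0 0)
  have l2 := hb.var
  have hbody := PolyProg.setNat 3 ((t2.mul w2).add l2)
    ((t2.div (l2.prefixRadix fun s hs => ⟨hs.2.le, hs.1.1.prefixRadix _ hs.2.le⟩)).mod
      (l2.radix fun s hs => hs.1.1.pos))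
  refine PolyProg.loop 7 hb (fun s i σ => (∀ a < 7, a ≠ 3 → σ.nat a = s.nat a) ∧ σ.num = s.num ∧
      (∀ l < i, σ.nat 3 (s.nat 6 0 * (s.nat 0 0 + s.nat 0 0) + l) =
        digit (radix (s.nat 0 0) (s.nat 1)) (s.nat 6 0) l) ∧
      ∀ x < s.nat 6 0 * (s.nat 0 0 + s.nat 0 0), σ.nat 3 x = s.nat 3 x) hbody ?_ ?_
  · exact fun s _ => ⟨fun _ _ _ => rfl, rfl, fun l hl => absurd hl (Nat.not_lt_zero l),
      fun _ _ => rfl⟩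
  · rintro s i σ hs hi ⟨h1, h2, h3, h4⟩
    have e : ∀ a < 7, a ≠ 3 → (σ.writeNat 7 0 i).nat a = s.nat a := fun a ha h => by
      rw [writeNat_nat_of_ne _ (by omega), h1 a ha h]
    have hag : Agree 1 s (σ.writeNat 7 0 i) :=
      ⟨fun a ha _ h => (e a (by omega) h).symm, by rw [← h2]; rfl⟩
    have hv : (σ.writeNat 7 0 i).nat 7 0 = i := writeNat_nat_self _ _ _ _
    refine ⟨⟨stable_ready.push (natComp_monomialCount fun _ hs => hs) _ _ hag hs, ?_⟩,
      hag.inputSize_eq.symm, ?_⟩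
    · change (σ.writeNat 7 0 i).nat 7 0 <
        (σ.writeNat 7 0 i).nat 0 0 + (σ.writeNat 7 0 i).nat 0 0
      rw [hv, e 0 (by omega) (by omega)]
      exact hi
    · rintro _ rfl
      simp only [e 0 (by omega) (by omega), e 1 (by omega) (by omega), e 5 (by omega) (by omega),
        e 6 (by omega) (by omega)]
      have hv' : (σ.writeNat 7 0 i).nat (1 + 6) 0 = i := hv
      rw [hv']
      refine ⟨fun a ha h => ?_, h2, fun l hl => ?_, fun x hx => ?_⟩
      · rw [writeNat_nat_of_ne _ h, e a ha h]
      · rcases Nat.lt_or_ge l i with hlt | hge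
        · rw [writeNat_nat_of_index_ne _ _ (by omega), writeNat_nat_of_ne _ (by omega)]
          exact h3 l hlt
        · obtain rfl : l = i := by omega
          rw [writeNat_nat_self, digit, hs.1.prefixRadix l hi.le]
      · rw [writeNat_nat_of_index_ne _ _ (by omega), writeNat_nat_of_ne _ (by omega)]
        exact h4 x hx

/-- The program for one monomial. -/
theorem polyProg_monomial : PolyProg (push 0 Ready monomialCount) (fun s s' =>
    (∀ a < 7, a ≠ 3 → s'.nat a = s.nat a) ∧ s'.num 0 = s.num 0 ∧
      (∀ l < s.nat 0 0 + s.nat 0 0, s'.nat 3 (s.nat 6 0 * (s.nat 0 0 + s.nat 0 0) + l) =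
        digit (radix (s.nat 0 0) (s.nat 1)) (s.nat 6 0) l) ∧
      (∀ x < s.nat 6 0 * (s.nat 0 0 + s.nat 0 0), s'.nat 3 x = s.nat 3 x) ∧
      s'.num 1 (s.nat 6 0) = tableCoeff s (s.nat 6 0) ∧
      ∀ x, x ≠ s.nat 6 0 → s'.num 1 x = s.num 1 x) := by
  have hstable := stable_ready.push (natComp_monomialCount fun _ hs => hs)
  have t1 : NatComp 1 (push 0 Ready monomialCount) (fun s => s.nat 6 0) :=
    (natComp_monomialCount fun _ hs => hs).var
  have hcoeff : PolyProg (push 0 Ready monomialCount) (fun s s' =>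
      s'.num 2 0 = tableCoeff s (s.nat 6 0) ∧ (∀ a < 7, s'.nat a = s.nat a) ∧
        ∀ a < 2, s'.num a = s.num a) := computes_tableCoeff.prog
  have hstore := PolyProg.copyRegister 1 0 t1
  have hcs := hcoeff.seq hstore (fun s s' hs h => by
    have hag : Agree 1 s s' :=
      ⟨fun a ha _ _ => (h.2.1 a (by omega)).symm, (h.2.2 0 (by omega)).symm⟩
    exact ⟨hstable _ _ hag hs, hag.inputSize_eq.symm⟩)
  refine (polyProg_exponents.seq hcs ?_).imp ?_
  · rintro s s' hs ⟨h1, h2, -, -⟩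
    have hag : Agree 1 s s' := ⟨fun a ha _ h => (h1 a (by omega) h).symm, by rw [h2]⟩
    exact ⟨hstable _ _ hag hs, hag.inputSize_eq.symm⟩
  · rintro s _ hs ⟨s', ⟨h1, h2, h3, h4⟩, s'', ⟨k1, k2, k3⟩, rfl⟩
    have hag : Agree 1 s s' := ⟨fun a ha _ h => (h1 a (by omega) h).symm, by rw [h2]⟩
    have e6 : s''.nat 6 0 = s.nat 6 0 := by
      rw [k2 6 (by omega), h1 6 (by omega) (by omega)]
    rw [e6]
    have hnat : ∀ a, (s''.writeNum 1 (s.nat 6 0) (s''.num (0 + 2) 0)).nat a = s''.nat a :=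
      fun _ => rfl
    refine ⟨fun a ha h => ?_, ?_, fun l hl => ?_, fun x hx => ?_, ?_, fun x hx => ?_⟩
    · rw [hnat, k2 a ha, h1 a ha h]
    · rw [writeNum_num_of_ne _ (by omega), k3 0 (by omega), h2]
    · rw [hnat, k2 3 (by omega)]; exact h3 l hl
    · rw [hnat, k2 3 (by omega)]; exact h4 x hx
    · rw [writeNum_num_self]
      refine k1.trans ?_
      rw [← hag.tableCoeff_eq, h1 6 (by omega) (by omega)]
    · rw [writeNum_num_of_index_ne _ _ hx, k3 1 (by omega), h2]

/-- The program. -/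
theorem polyProg_output : PolyProg (fun s => 1 ≤ s.nat 0 0) (fun s s' =>
    s'.nat 2 0 = ∏ l ∈ range (s.nat 0 0 + s.nat 0 0), radix (s.nat 0 0) (s.nat 1) l ∧
      ∀ t < s'.nat 2 0,
        (∀ l < s.nat 0 0 + s.nat 0 0, s'.nat 3 (t * (s.nat 0 0 + s.nat 0 0) + l) =
          digit (radix (s.nat 0 0) (s.nat 1)) t l) ∧
        s'.num 1 t = coeffAt (s.nat 0 0) (s.nat 1) (s.num 0) t) := by
  have hcount : NatComp 0 Ready monomialCount := natComp_monomialCount fun _ hs => hs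
  have hset := PolyProg.setNat 2 (NatComp.lit 0 Ready 0) hcount
  have hloop := PolyProg.loop 6 hcount (fun s i σ => (∀ a < 6, a ≠ 3 → σ.nat a = s.nat a) ∧
      σ.num 0 = s.num 0 ∧ ∀ t < i,
        (∀ l < s.nat 0 0 + s.nat 0 0, σ.nat 3 (t * (s.nat 0 0 + s.nat 0 0) + l) =
          digit (radix (s.nat 0 0) (s.nat 1)) t l) ∧ σ.num 1 t = tableCoeff s t)
    polyProg_monomial
    (fun s _ => ⟨fun _ _ _ => rfl, rfl, fun t ht => absurd ht (Nat.not_lt_zero t)⟩) (by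
    rintro s i σ hs hi ⟨h1, h2, h3⟩
    have e : ∀ a < 6, a ≠ 3 → (σ.writeNat 6 0 i).nat a = s.nat a := fun a ha h => by
      rw [writeNat_nat_of_ne _ (by omega), h1 a ha h]
    have hag : Agree 0 s (σ.writeNat 6 0 i) :=
      ⟨fun a ha _ h => (e a (by omega) h).symm, h2.symm⟩
    have hv : (σ.writeNat 6 0 i).nat 6 0 = i := writeNat_nat_self _ _ _ _
    refine ⟨⟨stable_ready _ _ hag hs, ?_⟩, hag.inputSize_eq.symm, ?_⟩
    · rw [← hcount.dep _ _ hag]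
      exact hv.trans_lt hi
    · rintro σ' ⟨k1, k2, k3, k4, k5, k6⟩
      simp only [hv, e 0 (by omega) (by omega), e 1 (by omega) (by omega)] at k3 k4 k5 k6
      refine ⟨fun a ha h => (k1 a (by omega) h).trans (e a ha h), k2.trans h2, fun t ht => ?_⟩
      rcases Nat.lt_or_ge t i with hlt | hge
      · obtain ⟨g1, g2⟩ := h3 t hlt
        refine ⟨fun l hl => ?_, ?_⟩
        -- The block of an earlier monomial ends before block `i` begins, so the current round
        -- leaves it unchanged.
        · have hlt' : t * (s.nat 0 0 + s.nat 0 0) + l < i * (s.nat 0 0 + s.nat 0 0) := by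
            have : (t + 1) * (s.nat 0 0 + s.nat 0 0) ≤ i * (s.nat 0 0 + s.nat 0 0) :=
              Nat.mul_le_mul_right _ hlt
            rw [Nat.succ_mul] at this
            omega
          rw [k4 _ hlt', writeNat_nat_of_ne _ (by omega)]
          exact g1 l hl
        · rw [k6 t (by omega)]
          exact g2
      · obtain rfl : t = i := by omega
        exact ⟨k3, k5.trans (hag.tableCoeff_eq t).symm⟩)
  have hsl := hset.seq hloop (fun s s' hs h => by
    subst h
    have hag : Agree 0 s (s.writeNat 2 0 (monomialCount s)) :=
      ⟨fun a _ h _ => (writeNat_nat_of_ne _ h _ _).symm, rfl⟩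
    exact ⟨stable_ready _ _ hag hs, hag.inputSize_eq.symm⟩)
  refine (polyProg_ready.seq hsl fun s s' _ h => ⟨h.2, h.1.inputSize_eq⟩).imp ?_
  rintro s s''' hs ⟨s', ⟨hin, hr⟩, _, rfl, h1, h2, h3⟩
  have e0 : (s'.writeNat 2 0 (monomialCount s')).nat 0 = s.nat 0 := hin.modes
  have e1 : (s'.writeNat 2 0 (monomialCount s')).nat 1 = s.nat 1 := hin.cutoffs
  have hag : Agree 0 s' (s'.writeNat 2 0 (monomialCount s')) :=
    ⟨fun a _ h _ => (writeNat_nat_of_ne _ h _ _).symm, rfl⟩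
  have hc : monomialCount s' = ∏ l ∈ range (s.nat 0 0 + s.nat 0 0),
      radix (s.nat 0 0) (s.nat 1) l := by
    rw [monomialCount, hr.prefixRadix _ le_rfl, hin.modes, hin.cutoffs]
  have h20 : s'''.nat 2 0 = monomialCount s' := by
    rw [h1 2 (by omega) (by omega), writeNat_nat_self]
  refine ⟨h20.trans hc, fun t ht => ?_⟩
  rw [h20, hcount.dep _ _ hag] at ht
  obtain ⟨g1, g2⟩ := h3 t ht
  rw [e0, e1] at g1
  refine ⟨g1, ?_⟩
  rw [g2, ← hag.tableCoeff_eq, tableCoeff_eq hr, hin.modes, hin.cutoffs, hin.entries]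

end RealRAM

/-! ## The polynomial -/

section InterpolationPolynomial

open Finset

/-- Summation over a larger set gives two polynomials a common index set, whence additivity.
Multiplicativity is not available, because monomials are read in normal order. -/
theorem polyOp_eq_sum {m : ℕ} (P : MvPolynomial (Fin m ⊕ Fin m) ℂ)
    {S : Finset ((Fin m ⊕ Fin m) →₀ ℕ)} (hS : P.support ⊆ S) :
    polyOp P = ∑ s ∈ S, P.coeff s • (List.ofFn fun k : Fin m =>
      position k ^ s (Sum.inl k) * momentum k ^ s (Sum.inr k)).prod :=
  sum_subset hS fun s _ hs => by rw [MvPolynomial.notMem_support_iff.1 hs, zero_smul]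

theorem polyOp_add {m : ℕ} (P Q : MvPolynomial (Fin m ⊕ Fin m) ℂ) :
    polyOp (P + Q) = polyOp P + polyOp Q := by
  classical
  rw [polyOp_eq_sum (P + Q) MvPolynomial.support_add, polyOp_eq_sum P subset_union_left,
    polyOp_eq_sum Q subset_union_right, ← sum_add_distrib]
  simp only [MvPolynomial.coeff_add, add_smul]

theorem polyOp_zero {m : ℕ} : polyOp (0 : MvPolynomial (Fin m ⊕ Fin m) ℂ) = 0 := by
  rw [polyOp, MvPolynomial.support_zero, sum_empty]

theorem polyOp_monomial {m : ℕ} (s : (Fin m ⊕ Fin m) →₀ ℕ) (c : ℂ) :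
    polyOp (MvPolynomial.monomial s c) = c • (List.ofFn fun k : Fin m =>
      position k ^ s (Sum.inl k) * momentum k ^ s (Sum.inr k)).prod := by
  rw [polyOp_eq_sum _ MvPolynomial.support_monomial_subset, sum_singleton,
    MvPolynomial.coeff_monomial, if_pos rfl]

theorem polyOp_sum {m : ℕ} {ι : Type*} (S : Finset ι) (f : ι → MvPolynomial (Fin m ⊕ Fin m) ℂ) :
    polyOp (∑ x ∈ S, f x) = ∑ x ∈ S, polyOp (f x) :=
  map_sum (AddMonoidHom.mk' (⟨polyOp, polyOp_zero⟩ : ZeroHom _ _) polyOp_add) f S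

/-- Distributivity for an ordered product in a noncommutative algebra, obtained from multilinearity
of the product map. -/
theorem prod_ofFn_sum_smul {A : Type*} [Semiring A] [Algebra ℂ A] {m : ℕ} {κ : Type*}
    (S : Fin m → Finset κ) (c : Fin m → κ → ℂ) (g : Fin m → κ → A) :
    (List.ofFn fun k => ∑ x ∈ S k, c k x • g k x).prod =
      ∑ r ∈ Fintype.piFinset S, (∏ k, c k (r k)) • (List.ofFn fun k => g k (r k)).prod := by
  classical
  have h := (MultilinearMap.mkPiAlgebraFin ℂ m A).map_sum_finset (fun k x => c k x • g k x) S
  simp only [MultilinearMap.map_smul_univ, MultilinearMap.mkPiAlgebraFin_apply] at h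
  exact h

/-- The exponents `(α, β)` of `q_k` and `p_k` that occur. -/
def exponentRange {m : ℕ} (N : Fin m → ℕ) : Finset (Fin m → ℕ × ℕ) :=
  Fintype.piFinset fun k => range (3 * N k + 1) ×ˢ range (3 * N k + 1)

/-- The exponent vector with the exponents `r k` of `q_k` and `p_k`. -/
noncomputable def pairExponent {m : ℕ} (r : Fin m → ℕ × ℕ) : (Fin m ⊕ Fin m) →₀ ℕ :=
  Finsupp.equivFunOnFinite.symm (Sum.elim (fun k => (r k).1) fun k => (r k).2)

/-- The coefficient of the monomial with the exponents `r`. -/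
noncomputable def interpolationCoeff {m : ℕ} {N : Fin m → ℕ}
    (H : cutoffSpace N →L[ℂ] cutoffSpace N) (r : Fin m → ℕ × ℕ) : ℂ :=
  ∑ i : (k : Fin m) → Fin (N k + 1), ∑ j : (k : Fin m) → Fin (N k + 1),
    entry H i j * ∏ k, modeCoeff (N k) (i k) (j k) (r k).1 (r k).2

/-- The polynomial of `interpolationOp H`. -/
noncomputable def interpolationPoly {m : ℕ} {N : Fin m → ℕ}
    (H : cutoffSpace N →L[ℂ] cutoffSpace N) : MvPolynomial (Fin m ⊕ Fin m) ℂ :=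
  ∑ r ∈ exponentRange N, MvPolynomial.monomial (pairExponent r) (interpolationCoeff H r)

/-- Each mode is put in normal order separately. Distributing the product over the modes gives
exactly the ordered products by which `polyOp` reads monomials. -/
theorem polyOp_interpolationPoly {m : ℕ} {N : Fin m → ℕ}
    (H : cutoffSpace N →L[ℂ] cutoffSpace N) :
    polyOp (interpolationPoly H) = interpolationOp H := by
  have hT : ∀ i j : (k : Fin m) → Fin (N k + 1),
      (List.ofFn fun k : Fin m => transitionOp k (N k) (i k) (j k)).prod =
      ∑ r ∈ exponentRange N, (∏ k, modeCoeff (N k) (i k) (j k) (r k).1 (r k).2) •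
        (List.ofFn fun k : Fin m => position k ^ (r k).1 * momentum k ^ (r k).2).prod := by
    intro i j
    rw [exponentRange, ← prod_ofFn_sum_smul (fun k => range (3 * N k + 1) ×ˢ range (3 * N k + 1))
      (fun k x => modeCoeff (N k) (i k) (j k) x.1 x.2)
      (fun k x => (position k ^ x.1 * momentum k ^ x.2 : Module.End ℂ (FinVec m)))]
    congr 2
    funext k
    exact transitionOp_eq k (Nat.lt_succ_iff.1 (i k).2) (Nat.lt_succ_iff.1 (j k).2)
  rw [interpolationPoly, polyOp_sum, interpolationOp]
  simp only [hT, polyOp_monomial, interpolationCoeff, sum_smul, mul_smul, smul_sum]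
  rw [sum_comm]
  refine sum_congr rfl fun i _ => ?_
  rw [sum_comm]
  rfl

theorem sum_le_prod_of_two_le {ι : Type*} (S : Finset ι) (a : ι → ℕ) (ha : ∀ x, 2 ≤ a x) :
    ∑ x ∈ S, a x ≤ ∏ x ∈ S, a x := by
  classical
  -- The empty set is kept apart; otherwise both factors are at least `2`, and `a + b ≤ a * b`
  -- applies.
  suffices h : (∑ x ∈ S, a x = 0 ∧ ∏ x ∈ S, a x = 1) ∨
      (2 ≤ ∑ x ∈ S, a x ∧ ∑ x ∈ S, a x ≤ ∏ x ∈ S, a x) by omega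
  induction S using Finset.induction_on with
  | empty => simp
  | insert x S hx ih =>
    rw [sum_insert hx, prod_insert hx]
    have h2 := ha x
    right
    rcases ih with ⟨h, h'⟩ | ⟨h, h'⟩
    · rw [h, h']
      omega
    · exact ⟨by omega, by nlinarith⟩

theorem totalDegree_interpolationPoly_le {m : ℕ} {N : Fin m → ℕ}
    (H : cutoffSpace N →L[ℂ] cutoffSpace N) :
    (interpolationPoly H).totalDegree ≤ ∑ k, 3 * N k := by
  refine MvPolynomial.totalDegree_finsetSum_le fun r _ => ?_
  by_cases hc : interpolationCoeff H r = 0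
  · rw [hc, MvPolynomial.monomial_zero, MvPolynomial.totalDegree_zero]
    exact Nat.zero_le _
  obtain ⟨i, -, hi⟩ := exists_ne_zero_of_sum_ne_zero hc
  obtain ⟨j, -, hj⟩ := exists_ne_zero_of_sum_ne_zero hi
  have hk := fun k => prod_ne_zero_iff.1 (right_ne_zero_of_mul hj) k (mem_univ k)
  rw [MvPolynomial.totalDegree_monomial _ hc, Finsupp.sum_fintype _ _ fun _ => rfl,
    Fintype.sum_sum_type, ← sum_add_distrib]
  exact sum_le_sum fun k _ => le_of_modeCoeff_ne_zero (Nat.lt_succ_iff.1 (i k).2)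
    (Nat.lt_succ_iff.1 (j k).2) (hk k)

theorem totalDegree_interpolationPoly_le_prod {m : ℕ} {N : Fin m → ℕ}
    (H : cutoffSpace N →L[ℂ] cutoffSpace N) (hN : (∀ k, N k ≠ 0) ∨ ∀ k, N k = 0) :
    (interpolationPoly H).totalDegree ≤ 3 ^ m * ∏ k, N k := by
  refine (totalDegree_interpolationPoly_le H).trans ?_
  rcases hN with hN | hN
  · refine (sum_le_prod_of_two_le _ _ fun k => ?_).trans_eq ?_
    · have := hN k
      omega
    · rw [prod_mul_distrib, prod_const, card_univ, Fintype.card_fin]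
  · simp [hN]

/-! ### The output of the program -/

namespace RealRAM

/-- The inverse of `finPiFinEquiv` is defined by the same divisions and remainders, so `rfl` closes
the goal once the product is rewritten over `Fin`. -/
theorem digit_finPiFinEquiv {n : ℕ} (R : ℕ → ℕ) (x : (k : Fin n) → Fin (R k)) (k : Fin n) :
    digit R (finPiFinEquiv x : ℕ) k = x k := by
  conv_rhs => rw [← finPiFinEquiv.symm_apply_apply x]
  rw [digit, prod_range]
  rfl

theorem sum_range_prod {M : Type*} [AddCommMonoid M] {n : ℕ} (R : ℕ → ℕ) (f : ℕ → M) :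
    ∑ t ∈ range (∏ l ∈ range n, R l), f t =
      ∑ x : (k : Fin n) → Fin (R k), f (finPiFinEquiv x : ℕ) := by
  rw [prod_range, sum_range, ← Equiv.sum_comp finPiFinEquiv]

theorem exists_finPiFinEquiv_eq {n : ℕ} {R : ℕ → ℕ} {t : ℕ} (ht : t < ∏ l ∈ range n, R l) :
    ∃ x : (k : Fin n) → Fin (R k), (finPiFinEquiv x : ℕ) = t := by
  rw [prod_range] at ht
  exact ⟨finPiFinEquiv.symm ⟨t, ht⟩, by rw [Equiv.apply_symm_apply]⟩

/-- The exponents of the `t`-th monomial. -/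
def digitPair (m : ℕ) (N : ℕ → ℕ) (t : ℕ) (k : Fin m) : ℕ × ℕ :=
  (digit (radix m N) t k, digit (radix m N) t (m + k))

theorem digitPair_injOn (m : ℕ) (N : ℕ → ℕ) :
    Set.InjOn (digitPair m N) (Set.Iio (∏ l ∈ range (m + m), radix m N l)) := by
  intro t ht t' ht' h
  obtain ⟨x, rfl⟩ := exists_finPiFinEquiv_eq ht
  obtain ⟨y, rfl⟩ := exists_finPiFinEquiv_eq ht'
  suffices x = y by rw [this]
  funext l
  apply Fin.ext
  rw [← digit_finPiFinEquiv, ← digit_finPiFinEquiv]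
  induction l using Fin.addCases with
  | left k => exact congrArg Prod.fst (congrFun h k)
  | right k => exact congrArg Prod.snd (congrFun h k)

theorem pairExponent_injective {m : ℕ} :
    Function.Injective (pairExponent : (Fin m → ℕ × ℕ) → _) := by
  intro r r' h
  funext k
  exact Prod.ext (DFunLike.congr_fun h (Sum.inl k)) (DFunLike.congr_fun h (Sum.inr k))

theorem sum_digitPair {M : Type*} [AddCommMonoid M] (m : ℕ) (N : ℕ → ℕ)
    (f : (Fin m → ℕ × ℕ) → M) :
    ∑ t ∈ range (∏ l ∈ range (m + m), radix m N l), f (digitPair m N t) =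
      ∑ r ∈ exponentRange fun k : Fin m => N k, f r := by
  have hl : ∀ k : Fin m, radix m N k = 3 * N k + 1 := fun k => by
    rw [radix, Nat.mod_eq_of_lt k.2]
  have hr : ∀ k : Fin m, radix m N (m + k) = 3 * N k + 1 := fun k => by
    rw [radix, Nat.add_mod_left, Nat.mod_eq_of_lt k.2]
  refine sum_nbij (digitPair m N) (fun t _ => ?_) ?_ (fun r hr' => ?_) fun _ _ => rfl
  · refine Fintype.mem_piFinset.2 fun k => mem_product.2 ⟨?_, ?_⟩
    · rw [← hl]
      exact mem_range.2 (Nat.mod_lt _ (by rw [hl]; omega))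
    · rw [← hr]
      exact mem_range.2 (Nat.mod_lt _ (by rw [hr]; omega))
  · rw [coe_range]
    exact digitPair_injOn m N
  · have hr'' := fun k => mem_product.1 (Fintype.mem_piFinset.1 hr' k)
    -- The preimage is the number whose digits are the exponents of the `q_k` followed by those of
    -- the `p_k`.
    let a : Fin (m + m) → ℕ := Fin.append (fun k => (r k).1) fun k => (r k).2
    have al : ∀ k, a (Fin.castAdd m k) = (r k).1 := fun k => Fin.append_left _ _ k
    have ar : ∀ k, a (Fin.natAdd m k) = (r k).2 := fun k => Fin.append_right _ _ k
    have ha : ∀ l, a l < radix m N l := by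
      intro l
      induction l using Fin.addCases with
      | left k =>
        rw [al, Fin.val_castAdd, hl]
        exact mem_range.1 (hr'' k).1
      | right k =>
        rw [ar, Fin.val_natAdd, hr]
        exact mem_range.1 (hr'' k).2
    refine ⟨(finPiFinEquiv fun l => (⟨a l, ha l⟩ : Fin (radix m N l)) : ℕ), ?_, ?_⟩
    · rw [coe_range, Set.mem_Iio, prod_range]
      exact Fin.is_lt _
    · funext k
      refine Prod.ext ?_ ?_
      · exact (digit_finPiFinEquiv _ _ (Fin.castAdd m k)).trans (al k)
      · exact (digit_finPiFinEquiv _ _ (Fin.natAdd m k)).trans (ar k)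

theorem coeffAt_eq {m : ℕ} {N : ℕ → ℕ}
    (H : cutoffSpace (fun k : Fin m => N k) →L[ℂ] cutoffSpace fun k : Fin m => N k) {h : ℕ → ℂ}
    (hh : ∀ i j : (k : Fin m) → Fin (N k + 1),
      h ((finPiFinEquiv i : ℕ) * ∏ k : Fin m, (N k + 1) + (finPiFinEquiv j : ℕ)) = entry H i j)
    (t : ℕ) : coeffAt m N h t = interpolationCoeff H (digitPair m N t) := by
  rw [coeffAt, sum_range_prod fun l => N l + 1]
  refine sum_congr rfl fun i _ => ?_
  rw [sum_range_prod fun l => N l + 1]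
  refine sum_congr rfl fun j _ => ?_
  rw [prod_range, hh, prod_range]
  refine congrArg _ (prod_congr rfl fun k _ => ?_)
  rw [digit_finPiFinEquiv (fun l => N l + 1) i, digit_finPiFinEquiv (fun l => N l + 1) j]
  rfl

theorem isOutput_interpolationPoly {m : ℕ} {N : Fin m → ℕ}
    {H : cutoffSpace N →L[ℂ] cutoffSpace N} {s s' : State} (hs : IsInput H s)
    (hcount : s'.nat 2 0 = ∏ l ∈ range (s.nat 0 0 + s.nat 0 0), radix (s.nat 0 0) (s.nat 1) l)
    (hout : ∀ t < s'.nat 2 0,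
      (∀ l < s.nat 0 0 + s.nat 0 0, s'.nat 3 (t * (s.nat 0 0 + s.nat 0 0) + l) =
        digit (radix (s.nat 0 0) (s.nat 1)) t l) ∧
      s'.num 1 t = coeffAt (s.nat 0 0) (s.nat 1) (s.num 0) t) :
    IsOutput (interpolationPoly H) s' := by
  obtain ⟨hm, hN, hh⟩ := hs
  subst hm
  -- The cutoffs become the restriction of an array on `ℕ`, the form in which the formulas of the
  -- program use them.
  obtain rfl : (fun k : Fin (s.nat 0 0) => s.nat 1 k) = N := funext hN
  have hexp : ∀ t < s'.nat 2 0, outputExponent (s.nat 0 0) s' t =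
      pairExponent (digitPair (s.nat 0 0) (s.nat 1) t) := by
    intro t ht
    rw [outputExponent, pairExponent, two_mul]
    congr 2
    · funext k
      exact (hout t ht).1 k (by omega)
    · funext k
      rw [add_assoc]
      exact (hout t ht).1 _ (by omega)
  constructor
  · intro t ht t' ht' h
    rw [hexp t ht, hexp t' ht'] at h
    rw [hcount] at ht ht'
    exact digitPair_injOn _ _ ht ht' (pairExponent_injective h)
  · rw [interpolationPoly, ← sum_digitPair (s.nat 0 0) (s.nat 1)
      fun r => MvPolynomial.monomial (pairExponent r) (interpolationCoeff H r), hcount]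
    refine sum_congr rfl fun t ht => ?_
    have ht' : t < s'.nat 2 0 := hcount ▸ mem_range.1 ht
    rw [hexp t ht', (hout t ht').2, coeffAt_eq H hh]

theorem IsInput.inputSize_eq {m : ℕ} {N : Fin m → ℕ}
    {H : cutoffSpace N →L[ℂ] cutoffSpace N} {s : State} (hs : IsInput H s) :
    inputSize s = m + ∏ k, (N k + 1) := by
  obtain ⟨hm, hN, -⟩ := hs
  rw [inputSize, hm, prod_range]
  simp only [hN]

end RealRAM

end InterpolationPolynomial

/-! ## The theorem -/

theorem theorem2 :
    ∃ (prog : RealRAM.Prog) (c : ℕ),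
      ∀ (m : ℕ) (_ : 1 ≤ m) (N : Fin m → ℕ) (H : cutoffSpace N →L[ℂ] cutoffSpace N)
        (_ : (H : cutoffSpace N →ₗ[ℂ] cutoffSpace N).IsSymmetric),
      ∃ P : MvPolynomial (Fin m ⊕ Fin m) ℂ,
        -- degree bound; with only some of the cutoffs equal to `0` it would be `0` and fail
        (((∀ k, N k ≠ 0) ∨ ∀ k, N k = 0) → P.totalDegree ≤ 3 ^ m * ∏ k, N k) ∧
        -- the explicit form of `P(q,p)`
        polyOp P = interpolationOp H ∧
        -- `P(q,p)` is Hermitian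
        IsHermitianOp (toUnbounded (polyOp P)) ∧
        -- `P(q,p) = H ⊕ H'` and `e^{itP(q,p)} = e^{itH} ⊕ e^{itH'}`
        (∃ H' : (cutoffSpace N)ᗮ →ₗ.[ℂ] (cutoffSpace N)ᗮ,
          IsHermitianOp H' ∧
          toUnbounded (polyOp P) = unboundedSum (cutoffSpace N) H H' ∧
          ∀ U : ℝ → FockSpace m →L[ℂ] FockSpace m,
            IsEvolution (toUnbounded (polyOp P)) U ↔
              ∃ U' : ℝ → (cutoffSpace N)ᗮ →L[ℂ] (cutoffSpace N)ᗮ, IsEvolution H' U' ∧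
                ∀ t : ℝ, U t = boundedSum (cutoffSpace N)
                  (expI H t) (U' t)) ∧
        -- `e^{itP(q,p)} ψ = e^{itH} ψ` on the truncated space
        (∀ U : ℝ → FockSpace m →L[ℂ] FockSpace m,
          IsEvolution (toUnbounded (polyOp P)) U → ∀ (ψ : cutoffSpace N) (t : ℝ),
            U t ψ = expI H t ψ) ∧
        -- `e^{itH} ψ` is the unique solution of the Schrödinger equation of `P(q,p)` starting at `ψ`
        (∀ (ψ : cutoffSpace N) (φ : ℝ → FockSpace m),
          (φ 0 = ψ ∧ SolvesSchrodinger (toUnbounded (polyOp P)) φ) ↔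
            ∀ t : ℝ, φ t = expI H t ψ) ∧
        -- `P` is computed in time polynomial in the size of the input
        ∀ s : RealRAM.State, RealRAM.IsInput H s →
          RealRAM.IsOutput P (prog.exec s) ∧
          prog.time s ≤ c * (m + ∏ k, (N k + 1)) ^ c := by

  obtain ⟨prog, hprog, c, hc⟩ := RealRAM.polyProg_output
  refine ⟨prog, c, fun m hm N H hH => ⟨interpolationPoly H,
    totalDegree_interpolationPoly_le_prod H, polyOp_interpolationPoly H, ?_⟩⟩
  rw [polyOp_interpolationPoly H]
  have hA : IsHermitianOp (toUnbounded (interpolationOp H)) :=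
    isHermitianOp_toUnbounded (interpolationOp_conj hH)
  have hK := toUnbounded_interpolationOp_of_mem H
  obtain ⟨H', h1, h2, hdom, hH'⟩ := exists_complementary_block hA hK
  refine ⟨hA, ⟨H', h1, h2, evolution_iff hA hK hdom hH'⟩,
    fun U hU ψ t => evolution_eq_expI hK hU ψ t, fun ψ φ => ⟨?_, fun h => ?_⟩, fun s hs => ?_⟩
  · rintro ⟨h0, hφ⟩ t
    refine congrFun (SolvesSchrodinger.eq hA.2 hφ (solvesSchrodinger_expI hK ψ) ?_) t
    rw [h0, expI_zero]
    rfl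
  · obtain rfl : φ = fun t => ((expI H t ψ : cutoffSpace N) : FockSpace m) := funext h
    refine ⟨?_, solvesSchrodinger_expI hK ψ⟩
    simp only [expI_zero]
    rfl
  · have hs0 : 1 ≤ s.nat 0 0 := hs.1.symm ▸ hm
    obtain ⟨hcount, hout⟩ := hprog s hs0
    exact ⟨RealRAM.isOutput_interpolationPoly hs hcount hout, hs.inputSize_eq ▸ hc s hs0⟩
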